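/- For a nonnegative function $\omega\in L^1([0,1))$ put $\widehat\omega(r)=\int_r^1\omega(s)\,ds$ for $0\le r<1$ and $\omega_x=\int_0^1 s^x\omega(s)\,ds$ for $x\ge 0$. Such an $\omega$, extended to the unit disc $\mathbb D$ by $\omega(z)=\omega(|z|)$, is called a radial weight if $\widehat\omega(r)>0$ for all $0\le r<1$; put $\widehat\omega(z)=\widehat\omega(|z|)$. A radial weight $\omega$ belongs to $\widehat{\mathcal D}$ if there is $C>0$ such that $\widehat\omega(r)\le C\,\widehat\omega\left(\frac{1+r}{2}\right)$ for all $r<1$ sufficiently close to $1$; it belongs to $\widecheck{\mathcal D}$ if there are $K>1$ and $C>1$ such that $\widehat\omega(r)\ge C\,\widehat\omega\left(1-\frac{1-r}{K}\right)$ for all $r<1$ sufficiently close to $1$; and $\mathcal D=\widehat{\mathcal D}\cap\widecheck{\mathcal D}$. In particular, membership of a nonnegative function in one of these classes includes that it is a radial weight. Let $dA=\frac{dx\,dy}{\pi}$ on $\mathbb D$, let $A^2_\omega$ be the space of analytic functions $f$ on $\mathbb D$ with $\int_{\mathbb D}|f|^2\omega\,dA<\infty$, and let $B^\omega_z$ be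 its reproducing kernel at $z\in\mathbb D$, that is, the unique $B^\omega_z\in A^2_\omega$ with $f(z)=\int_{\mathbb D}f\,\overline{B^\omega_z}\,\omega\,dA$ for all $f\in A^2_\omega$. The Bergman projection is $$P_\omega f(z)=\int_{\mathbb D}f(\zeta)\,\overline{B^\omega_z(\zeta)}\,\omega(\zeta)\,dA(\zeta),\qquad z\in\mathbb D.$$ For a radial weight $\nu$, let $L^\infty_{\widehat\nu}$ be the space of measurable $f:\mathbb D\to\mathbb C$ with $\|f\|_{\infty,\widehat\nu}=\operatorname{ess\,sup}_{z\in\mathbb D}|f(z)|\,\widehat\nu(z)<\infty$, and let $H^\infty_{\widehat\nu}$ be the space of analytic functions in $L^\infty_{\widehat\nu}$. We say that $P_\omega:L^\infty_{\widehat\nu}\to H^\infty_{\widehat\nu}$ is bounded if there is $C<\infty$ such that for every $f\in L^\infty_{\widehat\nu}$ the integral defining $P_\omega f(z)$ converges absolutely for every $z\in\mathbb D$, $P_\omega f\in H^\infty_{\widehat\nu}$, and $\|P_\omega f\|_{\infty,\widehat\nu}\le C\|f\|_{\infty,\widehat\nu}$. **Theorem.** Let $\omega$ be a radial weight and $\nu\in\widehat{\mathcal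 D}$. Then the following conditions are equivalent: (i) $P_\omega:L^\infty_{\widehat\nu}\to H^\infty_{\widehat\nu}$ is bounded; (ii) $\nu\in\widecheck{\mathcal D}$ and $\displaystyle\sup_{x\ge 0}\frac{\nu_x}{\omega_{2x}}\left(\frac{\omega}{\widehat\nu}\right)_x<\infty$; (iii) $\omega\in\widehat{\mathcal D}$, $\nu\in\widecheck{\mathcal D}$ and $\displaystyle\sup_{0\le r<1}\frac{\widehat\nu(r)}{\widehat\omega(r)}\int_r^1\frac{\omega(s)}{\widehat\nu(s)}\,ds<\infty$; (iv) $\frac{\omega}{\widehat\nu}\in\mathcal D$ and $\nu\in\widecheck{\mathcal D}$. In (ii) and (iii) the integrals of the nonnegative function $\omega/\widehat\nu$ are a priori allowed to be $+\infty$; finiteness of the supremum includes their finiteness. -/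

import Mathlib

open MeasureTheory Filter Topology Set
open scoped ENNReal NNReal ComplexConjugate

noncomputable section

namespace BergmanGrowth

/-- The tail integral `∫_r^1 ω(s) ds`. -/
def tail (ω : ℝ → ℝ) (r : ℝ) : ℝ := ∫ s in r..1, ω s

/-- The moment `∫_0^1 s^x ω(s) ds`. -/
def moment (ω : ℝ → ℝ) (x : ℝ) : ℝ := ∫ s in (0 : ℝ)..1, s ^ x * ω s

/-- Radial weights: nonnegative functions in `L¹([0,1))` whose tail integrals are all positive.
Only the values of `ω` on `[0,1)` matter; the weight at a point `z` of the disc is `ω ‖z‖`. -/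
structure IsRadialWeight (ω : ℝ → ℝ) : Prop where
  nonneg : ∀ r ∈ Ico (0 : ℝ) 1, 0 ≤ ω r
  integrable : IntegrableOn ω (Ico 0 1)
  tail_pos : ∀ r ∈ Ico (0 : ℝ) 1, 0 < tail ω r

/-- The upper doubling weights. -/
def IsUpperDoubling (ω : ℝ → ℝ) : Prop :=
  IsRadialWeight ω ∧
    ∃ C : ℝ, 0 < C ∧ ∀ᶠ r in 𝓝[<] (1 : ℝ), tail ω r ≤ C * tail ω ((1 + r) / 2)

/-- The lower doubling weights. -/
def IsLowerDoubling (ω : ℝ → ℝ) : Prop :=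
  IsRadialWeight ω ∧
    ∃ K C : ℝ, 1 < K ∧ 1 < C ∧
      ∀ᶠ r in 𝓝[<] (1 : ℝ), C * tail ω (1 - (1 - r) / K) ≤ tail ω r

/-- The doubling weights. -/
def IsDoubling (ω : ℝ → ℝ) : Prop := IsUpperDoubling ω ∧ IsLowerDoubling ω

/-- The open unit disc. -/
def disc : Set ℂ := Metric.ball 0 1

/-- The normalized area measure `dx dy / π` on the unit disc. -/
def discArea : Measure ℂ := ENNReal.ofReal Real.pi⁻¹ • volume.restrict disc

/-- The weighted Bergman space `A²_ω`. -/
def MemBergman (ω : ℝ → ℝ) (f : ℂ → ℂ) : Prop :=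
  DifferentiableOn ℂ f disc ∧ Integrable (fun ζ => ‖f ζ‖ ^ 2 * ω ‖ζ‖) discArea

/-- `K` is the reproducing kernel of `A²_ω` at `z`: it belongs to `A²_ω`, and the inner product
of `A²_ω` against `K` is evaluation at `z`. -/
def IsReproducingAt (ω : ℝ → ℝ) (z : ℂ) (K : ℂ → ℂ) : Prop :=
  MemBergman ω K ∧
    ∀ f : ℂ → ℂ, MemBergman ω f → f z = ∫ ζ, f ζ * conj (K ζ) * (ω ‖ζ‖ : ℂ) ∂discArea

open Classical in
/-- The Bergman reproducing kernel `ζ ↦ B^ω_z(ζ)` of `A²_ω`. For a radial weight `ω` and `z` in the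
disc such a kernel exists, and its values on the disc are uniquely determined. -/
def bergmanKernel (ω : ℝ → ℝ) (z : ℂ) : ℂ → ℂ :=
  if h : ∃ K, IsReproducingAt ω z K then Classical.choose h else 0

/-- The integrand `f(ζ) conj(B^ω_z(ζ)) ω(ζ)` of the Bergman projection. -/
def projIntegrand (ω : ℝ → ℝ) (f : ℂ → ℂ) (z ζ : ℂ) : ℂ :=
  f ζ * conj (bergmanKernel ω z ζ) * (ω ‖ζ‖ : ℂ)

/-- The Bergman projection `P_ω f`. -/
def bergmanProj (ω : ℝ → ℝ) (f : ℂ → ℂ) (z : ℂ) : ℂ :=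
  ∫ ζ, projIntegrand ω f z ζ ∂discArea

/-- The norm `ess sup_{z ∈ 𝔻} |f(z)| v(z)` for a radial function `v ≥ 0`. -/
def growthNorm (v : ℝ → ℝ) (f : ℂ → ℂ) : ℝ≥0∞ :=
  essSup (fun z => ‖f z‖ₑ * ENNReal.ofReal (v ‖z‖)) discArea

/-- The growth space `L^∞_v`. -/
def MemGrowth (v : ℝ → ℝ) (f : ℂ → ℂ) : Prop :=
  AEStronglyMeasurable f discArea ∧ growthNorm v f < ⊤

/-- The space `H^∞_v` of analytic functions in `L^∞_v`. -/
def MemAnalyticGrowth (v : ℝ → ℝ) (f : ℂ → ℂ) : Prop :=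
  DifferentiableOn ℂ f disc ∧ MemGrowth v f

/-- `P_ω : L^∞_v → H^∞_v` is (well defined and) bounded: for every `f ∈ L^∞_v` the integral that
defines `P_ω f` converges absolutely at each point of the disc, `P_ω f ∈ H^∞_v`, and the norm of
`P_ω f` is at most a constant times the norm of `f`. -/
def ProjBounded (ω v : ℝ → ℝ) : Prop :=
  ∃ C : ℝ≥0, ∀ f : ℂ → ℂ, MemGrowth v f →
    (∀ z ∈ disc, Integrable (projIntegrand ω f z) discArea) ∧
    MemAnalyticGrowth v (bergmanProj ω f) ∧
    growthNorm v (bergmanProj ω f) ≤ C * growthNorm v f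

/-- The quotient `ω / ν̂` of a weight by a tail integral. -/
def divTail (ω ν : ℝ → ℝ) (r : ℝ) : ℝ := ω r / tail ν r

/-- `sup_{x ≥ 0} ν_x (ω/ν̂)_x / ω_{2x} < ∞`. Finiteness at `x = 0` includes the integrability of
`ω/ν̂` over `[0,1)`, which has to be spelled out as the moments are real numbers. -/
def MomentCondition (ω ν : ℝ → ℝ) : Prop :=
  IntegrableOn (divTail ω ν) (Ico 0 1) ∧
    ∃ C : ℝ, ∀ x : ℝ, 0 ≤ x → moment ν x / moment ω (2 * x) * moment (divTail ω ν) x ≤ C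

/-- `sup_{0 ≤ r < 1} (ν̂(r)/ω̂(r)) ∫_r^1 ω/ν̂ < ∞`. Finiteness at `r = 0` includes the
integrability of `ω/ν̂` over `[0,1)`. -/
def TailCondition (ω ν : ℝ → ℝ) : Prop :=
  IntegrableOn (divTail ω ν) (Ico 0 1) ∧
    ∃ C : ℝ, ∀ r ∈ Ico (0 : ℝ) 1,
      tail ν r / tail ω r * (∫ s in r..1, ω s / tail ν s) ≤ C

end BergmanGrowth

end

open MeasureTheory Filter Topology Set
open scoped ENNReal NNReal ComplexConjugate

noncomputable section

namespace BergmanGrowth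

/-! Write σ = ω/ν̂, so that ω = ν̂σ. Since ν̂ decreases, ω̂ ≤ ν̂σ̂ and ω_{2x} ≤ ν_x σ_x hold for
free once σ is integrable; the conditions on weights say that these bounds can be reversed up to a
constant. The kernel of a radial weight is ∑ (z̄ζ)ⁿ/(2ω_{2n+1}), so P_ω is governed by moments.

Necessity. Apply P_ω to g(arg ζ)/ν̂(ζ) with g bounded: the variables separate, and the Taylor
coefficients of the image are Fourier coefficients of g times σ_{n+1}/ω_{2n+1}. Taking g = 1 at z =
0 gives integrability of σ. Taking g = e^{iNθ} gives a monomial, hence the moment condition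
(`momentCondition_of_projBounded`). Taking the sawtooth g(θ) = θ gives a series of positive terms of
size 1/n times σ_{n+1}/ω_{2n+1}, and by the free inequality the quotient is at least a constant
times 1/ν_n. Summing over many dyadic blocks of n forces ν̂ to drop by a factor 2 over a long enough
range, which is lower doubling (`isLowerDoubling_of_projBounded`).

Weights. In ω_{2x} = ∫ (s^x ν̂)(s^x σ), the first factor is small compared with ν̂(1 - 1/x) unless 1
- s is comparable to 1/x: for smaller s by exponential decay against upper doubling, for larger s by
lower doubling. The moment condition therefore locates a fixed share of σ_x in that window
(`exists_moment_divTail_le`), and σ is doubling. Conversely, when σ is lower doubling, its mass near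
r lies where ν̂ is comparable to ν̂(r), so ω̂ and ν̂σ̂ are comparable; this gives the tail
condition. Moments of upper doubling weights are comparable to tails, which leads back to the moment
condition.

Sufficiency. Since |fω| ≤ ‖f‖σ, it is enough to bound ν̂(z)∫|B_z|σ. The L¹ mean of the kernel on a
circle is at most a constant times 1 + ∫_0^ρ dt/((1-t)ω̂(t))
(`IsUpperDoubling.exists_integral_norm_kern_le`): the derivative of the kernel is a geometric series
times the series of its coefficient differences, and each factor is estimated in L² by Parseval.
Integrating this majorant against σ satisfies a recursion between the scales Ku and u, which lower
doubling of ν makes contractive (`exists_tail_mul_majorantIntegral_le`). -/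

/-! ### Tails and moments of radial weights -/

/-- A self-improving estimate along a geometric scale gives a uniform bound. -/
lemma le_max_of_le_add_mul {f : ℝ → ℝ} {K q A B u₁ : ℝ} (hK : 1 < K) (hq0 : 0 ≤ q) (hq : q < 1)
    (hKu : K * u₁ ≤ 1) (hu₁ : 0 < u₁)
    (hstep : ∀ u, 0 < u → u ≤ u₁ → f u ≤ A + q * f (K * u))
    (hbase : ∀ u, u₁ ≤ u → u ≤ 1 → f u ≤ B) {u : ℝ} (hu : 0 < u) (hu' : u ≤ 1) :
    f u ≤ max B (A / (1 - q)) := by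
  have hK0 : 0 < K := by linarith
  have key : ∀ n : ℕ, ∀ u, u₁ ≤ K ^ n * u → u ≤ 1 → f u ≤ max B (A / (1 - q)) := by
    intro n
    induction n with
    | zero => intro u h1 h2; exact (hbase u (by simpa using h1) h2).trans (le_max_left _ _)
    | succ n ih =>
      intro u h1 h2
      rcases le_total u₁ u with h | h
      · exact (hbase u h h2).trans (le_max_left _ _)
      · have hup : 0 < u := by
          by_contra hneg
          have : K ^ (n + 1) * u ≤ 0 := mul_nonpos_of_nonneg_of_nonpos (by positivity) (not_lt.1 hneg)
          linarith
        have h3 := ih (K * u) (by rw [pow_succ] at h1; linarith) (by nlinarith)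
        have h4 := hstep u hup h
        -- The claimed bound m satisfies A + q m ≤ m, so it survives each step of the recursion.
        have h5 : A ≤ (1 - q) * max B (A / (1 - q)) := by
          have := le_max_right B (A / (1 - q))
          rw [div_le_iff₀ (by linarith)] at this
          linarith
        nlinarith [mul_le_mul_of_nonneg_left h3 hq0]
  obtain ⟨n, hn⟩ := pow_unbounded_of_one_lt (u₁ / u) hK
  exact key n u (by rw [div_lt_iff₀ hu] at hn; exact hn.le) hu'

namespace IsRadialWeight

variable {ω : ℝ → ℝ}

lemma intervalIntegrable (h : IsRadialWeight ω) {a b : ℝ} (ha : a ∈ Icc (0 : ℝ) 1)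
    (hb : b ∈ Icc (0 : ℝ) 1) : IntervalIntegrable ω volume a b := by
  have : IntervalIntegrable ω volume 0 1 := by
    rw [intervalIntegrable_iff_integrableOn_Ico_of_le zero_le_one]; exact h.integrable
  refine this.mono_set ?_
  rw [uIcc_of_le (zero_le_one' ℝ)]
  exact (uIcc_subset_Icc ha hb)

lemma tail_sub_tail (h : IsRadialWeight ω) {a b : ℝ} (ha : a ∈ Icc (0 : ℝ) 1)
    (hb : b ∈ Icc (0 : ℝ) 1) : tail ω a - tail ω b = ∫ s in a..b, ω s := by
  have h1 : (1 : ℝ) ∈ Icc (0 : ℝ) 1 := by simp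
  have := intervalIntegral.integral_add_adjacent_intervals (h.intervalIntegrable ha hb)
    (h.intervalIntegrable hb h1)
  unfold tail
  linarith

lemma tail_one : tail ω 1 = 0 := by simp [tail]

lemma tail_anti (h : IsRadialWeight ω) {a b : ℝ} (ha : 0 ≤ a) (hab : a ≤ b) (hb : b ≤ 1) :
    tail ω b ≤ tail ω a := by
  have := h.tail_sub_tail (a := a) (b := b) ⟨ha, by linarith⟩ ⟨by linarith, hb⟩
  have h2 : ∫ s in a..b, (0 : ℝ) ≤ ∫ s in a..b, ω s := by
    refine intervalIntegral.integral_mono_on_of_le_Ioo hab (by simp)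
      (h.intervalIntegrable ⟨ha, by linarith⟩ ⟨by linarith, hb⟩) fun s hs => ?_
    exact h.nonneg s ⟨by linarith [hs.1], by linarith [hs.2]⟩
  simp at h2
  linarith

lemma tail_nonneg (h : IsRadialWeight ω) {a : ℝ} (ha : 0 ≤ a) (ha1 : a ≤ 1) : 0 ≤ tail ω a := by
  simpa [tail_one] using h.tail_anti ha ha1 le_rfl

lemma tail_continuousOn (h : IsRadialWeight ω) : ContinuousOn (tail ω) (Icc 0 1) := by
  have h0 : (0 : ℝ) ∈ Icc (0 : ℝ) 1 := by simp
  have h1 : (1 : ℝ) ∈ Icc (0 : ℝ) 1 := by simp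
  have := intervalIntegral.continuousOn_primitive_interval
    (f := ω) (μ := volume) (a := 0) (b := 1) (by
      rw [uIcc_of_le zero_le_one]
      exact (integrableOn_Icc_iff_integrableOn_Ico).2 h.integrable)
  rw [uIcc_of_le zero_le_one] at this
  refine ((continuousOn_const (c := tail ω 0)).sub this).congr fun r hr => ?_
  have := h.tail_sub_tail h0 hr
  simp only [Pi.sub_apply, ← this]; ring

/-- The weight `s ^ x * ω s`. -/
lemma rpow_intervalIntegrable (h : IsRadialWeight ω) {x : ℝ} (hx : 0 ≤ x) {a b : ℝ}
    (ha : a ∈ Icc (0 : ℝ) 1) (hb : b ∈ Icc (0 : ℝ) 1) :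
    IntervalIntegrable (fun s => s ^ x * ω s) volume a b :=
  (h.intervalIntegrable ha hb).continuousOn_mul (Real.continuous_rpow_const hx).continuousOn

lemma moment_split (h : IsRadialWeight ω) {x : ℝ} (hx : 0 ≤ x) {r : ℝ} (hr : r ∈ Icc (0 : ℝ) 1) :
    moment ω x = (∫ s in 0..r, s ^ x * ω s) + ∫ s in r..1, s ^ x * ω s :=
  (intervalIntegral.integral_add_adjacent_intervals
    (h.rpow_intervalIntegrable hx (by simp) hr) (h.rpow_intervalIntegrable hx hr (by simp))).symm

lemma integral_rpow_mul_nonneg (h : IsRadialWeight ω) {x a b : ℝ} (hx : 0 ≤ x) (ha : 0 ≤ a)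
    (hab : a ≤ b) (hb : b ≤ 1) : 0 ≤ ∫ s in a..b, s ^ x * ω s := by
  have : ∫ s in a..b, (0 : ℝ) ≤ ∫ s in a..b, s ^ x * ω s := by
    refine intervalIntegral.integral_mono_on_of_le_Ioo hab (by simp)
      (h.rpow_intervalIntegrable hx ⟨ha, by linarith⟩ ⟨by linarith, hb⟩) fun s hs => ?_
    exact mul_nonneg (Real.rpow_nonneg (by linarith [hs.1]) _)
      (h.nonneg s ⟨by linarith [hs.1], by linarith [hs.2]⟩)
  simpa using this

lemma rpow_mul_tail_le_integral (h : IsRadialWeight ω) {x r : ℝ} (hx : 0 ≤ x) (hr : 0 ≤ r)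
    (hr1 : r ≤ 1) : r ^ x * tail ω r ≤ ∫ s in r..1, s ^ x * ω s := by
  unfold tail
  rw [← intervalIntegral.integral_const_mul]
  refine intervalIntegral.integral_mono_on_of_le_Ioo hr1
    ((h.intervalIntegrable ⟨hr, hr1⟩ (by simp)).const_mul _)
    (h.rpow_intervalIntegrable hx ⟨hr, hr1⟩ (by simp)) fun s hs => ?_
  exact mul_le_mul_of_nonneg_right (Real.rpow_le_rpow hr hs.1.le hx)
      (h.nonneg s ⟨by linarith [hs.1], hs.2⟩)

lemma rpow_mul_tail_le_moment (h : IsRadialWeight ω) {x r : ℝ} (hx : 0 ≤ x) (hr : 0 ≤ r)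
    (hr1 : r ≤ 1) : r ^ x * tail ω r ≤ moment ω x := by
  rw [h.moment_split hx ⟨hr, hr1⟩]
  linarith [h.rpow_mul_tail_le_integral hx hr hr1, h.integral_rpow_mul_nonneg hx le_rfl hr hr1]

lemma moment_anti (h : IsRadialWeight ω) {x y : ℝ} (hx : 0 ≤ x) (hxy : x ≤ y) :
    moment ω y ≤ moment ω x := by
  refine intervalIntegral.integral_mono_on_of_le_Ioo zero_le_one
    (h.rpow_intervalIntegrable (hx.trans hxy) (by simp) (by simp))
    (h.rpow_intervalIntegrable hx (by simp) (by simp)) fun s hs => ?_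
  exact mul_le_mul_of_nonneg_right (Real.rpow_le_rpow_of_exponent_ge hs.1 hs.2.le hxy)
    (h.nonneg s ⟨hs.1.le, hs.2⟩)

lemma moment_pos (h : IsRadialWeight ω) {x : ℝ} (hx : 0 ≤ x) : 0 < moment ω x := by
  refine lt_of_lt_of_le ?_ (h.rpow_mul_tail_le_moment hx (r := 1 / 2) (by norm_num) (by norm_num))
  exact mul_pos (by positivity) (h.tail_pos _ (by norm_num))

lemma moment_zero : moment ω 0 = tail ω 0 := by simp [moment, tail]

/-- The part of a moment over `[0, r]`. -/
lemma integral_rpow_mul_le (h : IsRadialWeight ω) {x y r : ℝ} (hx : 0 ≤ x) (hy : 0 ≤ y)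
    (hr : 0 ≤ r) (hr1 : r ≤ 1) :
    ∫ s in 0..r, s ^ (x + y) * ω s ≤ r ^ x * ∫ s in 0..r, s ^ y * ω s := by
  rw [← intervalIntegral.integral_const_mul]
  refine intervalIntegral.integral_mono_on_of_le_Ioo hr
    (h.rpow_intervalIntegrable (by positivity) (by simp) ⟨hr, hr1⟩)
    ((h.rpow_intervalIntegrable hy (by simp) ⟨hr, hr1⟩).const_mul _) fun s hs => ?_
  rw [Real.rpow_add hs.1, mul_assoc]
  exact mul_le_mul_of_nonneg_right (Real.rpow_le_rpow hs.1.le hs.2.le hx)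
    (mul_nonneg (Real.rpow_nonneg hs.1.le _) (h.nonneg s ⟨hs.1.le, by linarith [hs.2]⟩))

lemma integral_rpow_mul_le_moment (h : IsRadialWeight ω) {x r : ℝ} (hx : 0 ≤ x) (hr : 0 ≤ r)
    (hr1 : r ≤ 1) : ∫ s in 0..r, s ^ x * ω s ≤ moment ω x := by
  rw [h.moment_split hx ⟨hr, hr1⟩]
  linarith [h.integral_rpow_mul_nonneg hx hr hr1 le_rfl]

lemma integral_rpow_mul_le_tail (h : IsRadialWeight ω) {x r : ℝ} (hx : 0 ≤ x) (hr : 0 ≤ r)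
    (hr1 : r ≤ 1) : ∫ s in r..1, s ^ x * ω s ≤ tail ω r := by
  refine intervalIntegral.integral_mono_on_of_le_Ioo hr1
    (h.rpow_intervalIntegrable hx ⟨hr, hr1⟩ (by simp))
    (h.intervalIntegrable ⟨hr, hr1⟩ (by simp)) fun s hs => ?_
  have := h.nonneg s ⟨by linarith [hs.1], hs.2⟩
  have h2 := Real.rpow_le_one (hr.trans hs.1.le) hs.2.le hx
  nlinarith

/-- No doubling is needed: on [1/2, 1] an extra factor s costs at most 2, and the part over [0, 1/2]
is at most 2^{-x} ω̂(0), which is dominated by the part over [1/2, 1] because the latter is at least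
2^{-x} ω̂(1/2). It absorbs the unit shifts of exponent caused by the area element and by rounding.
-/
lemma exists_moment_le_mul_moment_add_one (h : IsRadialWeight ω) :
    ∃ C : ℝ, 0 < C ∧ ∀ x, 0 ≤ x → moment ω x ≤ C * moment ω (x + 1) := by
  have hT := h.tail_pos (1 / 2) (by norm_num)
  have hT0 := h.tail_pos 0 (by norm_num)
  refine ⟨2 * (1 + tail ω 0 / tail ω (1 / 2)), by positivity, fun x hx => ?_⟩
  set I := ∫ s in (1 / 2 : ℝ)..1, s ^ x * ω s with hI
  have h1 : ∫ s in (0 : ℝ)..(1 / 2), s ^ x * ω s ≤ tail ω 0 / tail ω (1 / 2) * I := by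
    have e1 := h.integral_rpow_mul_le (y := 0) hx le_rfl (r := 1 / 2) (by norm_num) (by norm_num)
    have e2 := h.rpow_mul_tail_le_integral hx (r := 1 / 2) (by norm_num) (by norm_num)
    have e3 := h.integral_rpow_mul_le_moment (x := 0) le_rfl (r := 1 / 2) (by norm_num)
      (by norm_num)
    rw [moment_zero] at e3
    have hp : (0 : ℝ) ≤ (1 / 2) ^ x := by positivity
    rw [div_mul_eq_mul_div, le_div_iff₀ hT]
    simp only [add_zero] at e1
    calc _ ≤ ((1 / 2) ^ x * tail ω 0) * tail ω (1 / 2) := by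
          refine mul_le_mul_of_nonneg_right (e1.trans ?_) hT.le
          exact mul_le_mul_of_nonneg_left e3 hp
      _ = tail ω 0 * ((1 / 2) ^ x * tail ω (1 / 2)) := by ring
      _ ≤ _ := mul_le_mul_of_nonneg_left e2 hT0.le
  have h2 : I ≤ 2 * moment ω (x + 1) := by
    have : I ≤ 2 * ∫ s in (1 / 2 : ℝ)..1, s ^ (x + 1) * ω s := by
      rw [hI, ← intervalIntegral.integral_const_mul]
      refine intervalIntegral.integral_mono_on_of_le_Ioo (by norm_num)
        (h.rpow_intervalIntegrable hx (by norm_num) (by simp))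
        ((h.rpow_intervalIntegrable (by positivity) (by norm_num) (by simp)).const_mul _)
        fun s hs => ?_
      have hs0 : 0 < s := by linarith [hs.1]
      rw [Real.rpow_add_one hs0.ne']
      have := mul_nonneg (Real.rpow_nonneg hs0.le x) (h.nonneg s ⟨hs0.le, hs.2⟩)
      nlinarith [hs.1]
    have e := h.moment_split (x := x + 1) (by positivity) (r := 1 / 2) (by norm_num)
    have := h.integral_rpow_mul_nonneg (x := x + 1) (by positivity) le_rfl
      (by norm_num : (0 : ℝ) ≤ 1 / 2) (by norm_num)
    linarith
  rw [h.moment_split hx (r := 1 / 2) (by norm_num)]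
  calc _ ≤ tail ω 0 / tail ω (1 / 2) * I + I := by linarith
    _ = (1 + tail ω 0 / tail ω (1 / 2)) * I := by ring
    _ ≤ (1 + tail ω 0 / tail ω (1 / 2)) * (2 * moment ω (x + 1)) :=
        mul_le_mul_of_nonneg_left h2 (by positivity)
    _ = _ := by ring

end IsRadialWeight

/-- Away from the boundary the two tails lie between positive constants, so the doubling inequality
extends to all radii. A constant of the form 2^b makes its iterates powers of the ratio of scales.
-/
lemma IsUpperDoubling.exists_tail_le_two_pow {ω : ℝ → ℝ} (h : IsUpperDoubling ω) :
    ∃ b : ℕ, ∀ r ∈ Ico (0 : ℝ) 1, tail ω r ≤ 2 ^ b * tail ω ((1 + r) / 2) := by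
  obtain ⟨hw, C, hC, hev⟩ := h
  obtain ⟨l, hl, hl'⟩ := (mem_nhdsLT_iff_exists_Ioo_subset).1 hev
  have hl1 : l < 1 := hl
  set l' := max l 0
  have hl'1 : l' < 1 := max_lt hl1 one_pos
  have hp : 0 < tail ω ((1 + l') / 2) := hw.tail_pos _ ⟨by positivity, by linarith⟩
  obtain ⟨b, hb⟩ := pow_unbounded_of_one_lt (max C (tail ω 0 / tail ω ((1 + l') / 2)))
    (one_lt_two : (1 : ℝ) < 2)
  refine ⟨b, fun r hr => ?_⟩
  have hp' : 0 < tail ω ((1 + r) / 2) :=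
    hw.tail_pos _ ⟨by linarith [hr.1], by linarith [hr.2]⟩
  rcases lt_or_ge l' r with hlr | hlr
  · refine (hl' ⟨(le_max_left _ _).trans_lt hlr, hr.2⟩ : tail ω r ≤ _).trans ?_
    exact mul_le_mul_of_nonneg_right ((le_max_left _ _).trans hb.le) hp'.le
  · have h1 : tail ω ((1 + l') / 2) ≤ tail ω ((1 + r) / 2) :=
      hw.tail_anti (by linarith [hr.1]) (by linarith) (by linarith)
    have h2 := (le_max_right _ _).trans hb.le
    rw [div_le_iff₀ hp] at h2
    calc tail ω r ≤ tail ω 0 := hw.tail_anti le_rfl hr.1 hr.2.le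
      _ ≤ _ := h2
      _ ≤ _ := mul_le_mul_of_nonneg_left h1 (by positivity)

/-- Halving u until it falls below v costs 2^b each time. The summand 1 covers u ≤ v, so that no
ordering of the scales is needed. -/
lemma IsUpperDoubling.exists_tail_le_pow {ω : ℝ → ℝ} (h : IsUpperDoubling ω) :
    ∃ b : ℕ, ∀ u v : ℝ, 0 < u → u ≤ 1 → 0 < v → v ≤ 1 →
      tail ω (1 - u) ≤ (1 + 2 * u / v) ^ b * tail ω (1 - v) := by
  obtain ⟨b, hb⟩ := h.exists_tail_le_two_pow
  have hw := h.1
  refine ⟨b, fun u v hu hu1 hv hv1 => ?_⟩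
  have key : ∀ n : ℕ, ∀ u, 0 < u → u ≤ 1 → u ≤ 2 ^ n * v →
      tail ω (1 - u) ≤ (max 1 (2 * u / v)) ^ b * tail ω (1 - v) := by
    have hbase : ∀ u, 0 < u → u ≤ v →
        tail ω (1 - u) ≤ (max 1 (2 * u / v)) ^ b * tail ω (1 - v) := by
      intro u hu huv
      have h1 := hw.tail_anti (a := 1 - v) (b := 1 - u) (by linarith) (by linarith) (by linarith)
      have h2 := hw.tail_pos (1 - v) ⟨by linarith, by linarith⟩
      have h3 : 1 ≤ (max 1 (2 * u / v)) ^ b := one_le_pow₀ (le_max_left _ _)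
      nlinarith
    intro n
    induction n with
    | zero => intro u hu hu1 huv; exact hbase u hu (by simpa using huv)
    | succ n ih =>
      intro u hu hu1 huv
      rcases le_total u v with huv' | huv'
      · exact hbase u hu huv'
      · have h1 := hb (1 - u) ⟨by linarith, by linarith⟩
        rw [show (1 + (1 - u)) / 2 = 1 - u / 2 by ring] at h1
        have h2 := ih (u / 2) (by positivity) (by linarith) (by rw [pow_succ] at huv; linarith)
        have h3 : 1 ≤ u / v := by rwa [one_le_div hv]
        have e1 : max 1 (2 * (u / 2) / v) = u / v := by
          rw [show 2 * (u / 2) / v = u / v by ring]; exact max_eq_right h3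
        have e2 : max 1 (2 * u / v) = 2 * (u / v) := by
          rw [show 2 * u / v = 2 * (u / v) by ring]; exact max_eq_right (by linarith)
        rw [e1] at h2
        rw [e2, mul_pow, mul_assoc]
        exact h1.trans (mul_le_mul_of_nonneg_left h2 (by positivity))
  obtain ⟨n, hn⟩ := pow_unbounded_of_one_lt (u / v) (one_lt_two : (1 : ℝ) < 2)
  rw [div_lt_iff₀ hv] at hn
  refine (key n u hu hu1 hn.le).trans ?_
  refine mul_le_mul_of_nonneg_right (pow_le_pow_left₀ (by positivity) ?_ _)
    (hw.tail_nonneg (by linarith) (by linarith))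
  have : 0 < 2 * u / v := by positivity
  exact max_le (by linarith) (by linarith)

/-- Moments of an upper doubling weight are dominated by tails. -/
lemma IsUpperDoubling.exists_moment_le_tail {ω : ℝ → ℝ} (h : IsUpperDoubling ω) :
    ∃ C : ℝ, 0 < C ∧ ∀ x, 1 ≤ x → moment ω x ≤ C * tail ω (1 - 1 / x) := by
  obtain ⟨b, hb⟩ := h.exists_tail_le_pow
  have hw := h.1
  -- The moment is split at 1 - lu. The part below gains e^{-l/2}, and comparing tails at the scales
  -- 2u and u costs 5^b; `l` is chosen so that the product is at most 1/2, the contraction factor of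
  -- the recursion from 2u to u.
  obtain ⟨l, hl1, hl⟩ : ∃ l : ℝ, 1 ≤ l ∧ Real.exp (-(l / 2)) * 5 ^ b ≤ 1 / 2 := by
    have : Tendsto (fun l : ℝ => Real.exp (-(l / 2)) * 5 ^ b) atTop (𝓝 (0 * 5 ^ b)) :=
      (Real.tendsto_exp_neg_atTop_nhds_zero.comp
        (tendsto_id.atTop_div_const two_pos)).mul_const _
    rw [zero_mul] at this
    obtain ⟨l, h1, h2⟩ := ((eventually_ge_atTop (1 : ℝ)).and
      (this.eventually_le_const (by norm_num : (0 : ℝ) < 1 / 2))).exists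
    exact ⟨l, h1, h2⟩
  set f : ℝ → ℝ := fun u => moment ω (1 / u) / tail ω (1 - u) with hf
  have hpos : ∀ u, 0 < u → u ≤ 1 → 0 < tail ω (1 - u) := fun u h1 h2 =>
    hw.tail_pos _ ⟨by linarith, by linarith⟩
  have hl0 : 0 < l := by linarith
  have key : ∀ u, 0 < u → u ≤ 1 → f u ≤ max (tail ω 0 / tail ω (1 - 1 / (2 * l)))
      ((1 + 2 * l) ^ b / (1 - 1 / 2)) := by
    intro u hu hu1
    refine le_max_of_le_add_mul (K := 2) (u₁ := 1 / (2 * l)) one_lt_two (by norm_num)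
      (by norm_num) ?_ (by positivity) ?_ ?_ hu hu1
    · rw [mul_one_div, div_le_one (by positivity)]; linarith
    · intro u hu hul
      have hul' : u * (2 * l) ≤ 1 := by rwa [le_div_iff₀ (by positivity)] at hul
      have hlu : l * u ≤ 1 / 2 := by linarith
      have hu2 : u ≤ 1 / 2 := by nlinarith
      have hr : 1 - l * u ∈ Icc (0 : ℝ) 1 := ⟨by linarith, by nlinarith⟩
      have hm := hw.moment_split (x := 1 / u) (by positivity) hr
      have h1 := hw.integral_rpow_mul_le_tail (x := 1 / u) (by positivity) hr.1 hr.2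
      -- Half of the exponent 1/u supplies the small factor, the other half leaves the moment at
      -- scale 2u.
      have h2 := hw.integral_rpow_mul_le (x := 1 / (2 * u)) (y := 1 / (2 * u)) (by positivity)
        (by positivity) hr.1 hr.2
      rw [show 1 / (2 * u) + 1 / (2 * u) = 1 / u by field_simp; norm_num] at h2
      have h3 := hw.integral_rpow_mul_le_moment (x := 1 / (2 * u)) (by positivity) hr.1 hr.2
      have h4 : (1 - l * u) ^ (1 / (2 * u)) ≤ Real.exp (-(l / 2)) := by
        have : 1 - l * u ≤ Real.exp (-(l * u)) := by
          have := Real.add_one_le_exp (-(l * u)); linarith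
        calc (1 - l * u) ^ (1 / (2 * u)) ≤ (Real.exp (-(l * u))) ^ (1 / (2 * u)) :=
              Real.rpow_le_rpow hr.1 this (by positivity)
          _ = _ := by rw [← Real.exp_mul]; congr 1; field_simp
      have h5 := hb (l * u) u (by positivity) (by linarith) hu (by linarith)
      rw [show 2 * (l * u) / u = 2 * l by field_simp] at h5
      have h6 := hb (2 * u) u (by positivity) (by linarith) hu (by linarith)
      rw [show 1 + 2 * (2 * u) / u = 5 by field_simp; norm_num] at h6
      have hp1 := hpos u hu (by linarith)
      have hp2 := hpos (2 * u) (by linarith) (by linarith)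
      have hM : 0 < moment ω (1 / (2 * u)) := hw.moment_pos (by positivity)
      have h7 : moment ω (1 / u) ≤ (1 + 2 * l) ^ b * tail ω (1 - u)
          + Real.exp (-(l / 2)) * moment ω (1 / (2 * u)) := by
        have : (1 - l * u) ^ (1 / (2 * u)) * (∫ s in 0..(1 - l * u), s ^ (1 / (2 * u)) * ω s)
            ≤ Real.exp (-(l / 2)) * moment ω (1 / (2 * u)) :=
          mul_le_mul h4 h3 (hw.integral_rpow_mul_nonneg (by positivity) le_rfl hr.1 hr.2)
            (Real.exp_pos _).le
        linarith
      simp only [hf]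
      rw [div_le_iff₀ hp1]
      refine h7.trans ?_
      rw [add_mul]
      gcongr ?_ + ?_
      · exact le_rfl
      · refine le_of_le_of_eq (b := moment ω (1 / (2 * u)) * tail ω (1 - u) / (tail ω (1 - 2 * u) * 2))
          ?_ (by ring)
        rw [le_div_iff₀ (by positivity)]
        calc Real.exp (-(l / 2)) * moment ω (1 / (2 * u)) * (tail ω (1 - 2 * u) * 2)
            ≤ Real.exp (-(l / 2)) * moment ω (1 / (2 * u)) * (5 ^ b * tail ω (1 - u) * 2) :=
              mul_le_mul_of_nonneg_left (by linarith) (by positivity)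
          _ = (Real.exp (-(l / 2)) * 5 ^ b) * (moment ω (1 / (2 * u)) * tail ω (1 - u) * 2) := by
              ring
          _ ≤ 1 / 2 * (moment ω (1 / (2 * u)) * tail ω (1 - u) * 2) :=
              mul_le_mul_of_nonneg_right hl (by positivity)
          _ = _ := by ring
    · intro u hu hu1
      have hu0 : 0 < u := lt_of_lt_of_le (by positivity) hu
      have hl2 : 1 / (2 * l) ≤ 1 := by rw [div_le_one (by positivity)]; linarith
      have h1 : moment ω (1 / u) ≤ tail ω 0 := by
        rw [← IsRadialWeight.moment_zero]; exact hw.moment_anti le_rfl (by positivity)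
      simp only [hf]
      exact div_le_div₀ (hw.tail_nonneg le_rfl zero_le_one) h1
        (hpos _ (by positivity) hl2)
        (hw.tail_anti (by linarith) (by linarith) (by have : 0 < 1 / (2 * l) := by positivity
                                                      linarith))
  refine ⟨max (tail ω 0 / tail ω (1 - 1 / (2 * l))) ((1 + 2 * l) ^ b / (1 - 1 / 2)),
    lt_max_of_lt_right (div_pos (by positivity) (by norm_num)), fun x hx => ?_⟩
  have hx0 : 0 < x := by linarith
  have := key (1 / x) (by positivity) (by rw [div_le_one hx0]; exact hx)
  simp only [hf, one_div_one_div] at this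
  rwa [div_le_iff₀ (hpos (1 / x) (by positivity) (by rw [div_le_one hx0]; exact hx))] at this

/-! ### Equivalence of the conditions on the weights -/

lemma eventually_nhdsLT_one_iff {p : ℝ → Prop} :
    (∀ᶠ r in 𝓝[<] (1 : ℝ), p r) ↔
      ∃ u₀ : ℝ, 0 < u₀ ∧ u₀ ≤ 1 ∧ ∀ u, 0 < u → u ≤ u₀ → p (1 - u) := by
  constructor
  · intro hev
    obtain ⟨l, hl, hl'⟩ := (mem_nhdsLT_iff_exists_Ioo_subset).1 hev
    have hl1 : l < 1 := hl
    refine ⟨min 1 ((1 - l) / 2), by positivity [sub_pos.2 hl1], min_le_left _ _, fun u hu hu' => ?_⟩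
    have := hu'.trans (min_le_right _ _)
    exact hl' ⟨by linarith, by linarith⟩
  · rintro ⟨u₀, h0, h1, h⟩
    filter_upwards [Ioo_mem_nhdsLT (show 1 - u₀ < 1 by linarith)] with r hr
    have := h (1 - r) (by linarith [hr.2]) (by linarith [hr.1])
    rwa [sub_sub_cancel] at this

lemma exp_neg_two_mul_le {u : ℝ} (hu : 0 ≤ u) (hu' : u ≤ 1 / 2) : Real.exp (-(2 * u)) ≤ 1 - u := by
  have h1 : 0 < 1 - u := by linarith
  rw [Real.exp_neg, inv_le_comm₀ (Real.exp_pos _) h1]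
  have h2 := Real.add_one_le_exp (2 * u)
  refine le_trans ?_ h2
  rw [inv_le_iff_one_le_mul₀ h1]
  nlinarith

lemma one_sub_rpow_ge {u x : ℝ} (hu : 0 ≤ u) (hu' : u ≤ 1 / 2) (hx : 0 ≤ x) :
    Real.exp (-(2 * u * x)) ≤ (1 - u) ^ x := by
  have := Real.rpow_le_rpow (Real.exp_pos _).le (exp_neg_two_mul_le hu hu') hx
  rwa [← Real.exp_mul, neg_mul] at this

lemma one_sub_rpow_le {u x : ℝ} (hu' : u ≤ 1) (hx : 0 ≤ x) :
    (1 - u) ^ x ≤ Real.exp (-(u * x)) := by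
  have h : 1 - u ≤ Real.exp (-u) := by have := Real.add_one_le_exp (-u); linarith
  have := Real.rpow_le_rpow (by linarith) h hx
  rwa [← Real.exp_mul, neg_mul] at this

lemma IsLowerDoubling.exists_mul_tail_le {ν : ℝ → ℝ} (h : IsLowerDoubling ν) :
    ∃ K C u₁ : ℝ, 1 < K ∧ 1 < C ∧ 0 < u₁ ∧ K * u₁ ≤ 1 ∧
      ∀ u, 0 < u → u ≤ u₁ → C * tail ν (1 - u) ≤ tail ν (1 - K * u) := by
  obtain ⟨-, K, C, hK, hC, hev⟩ := h
  obtain ⟨u₀, h0, h1, h⟩ := eventually_nhdsLT_one_iff.1 hev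
  have hK0 : 0 < K := by linarith
  refine ⟨K, C, u₀ / K, hK, hC, by positivity, by rwa [mul_div_cancel₀ _ hK0.ne'],
    fun u hu hu' => ?_⟩
  have := h (K * u) (by positivity) (by rw [le_div_iff₀ hK0] at hu'; linarith)
  rwa [sub_sub_cancel, mul_div_cancel_left₀ _ hK0.ne'] at this

/-- Iterating lower doubling n times gains Cⁿ, which exceeds 1/ε for n large. -/
lemma IsLowerDoubling.exists_tail_le_mul {ν : ℝ → ℝ} (h : IsLowerDoubling ν) {ε : ℝ}
    (hε : 0 < ε) :
    ∃ K u₁ : ℝ, 1 < K ∧ 0 < u₁ ∧ u₁ ≤ 1 ∧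
      ∀ u, 0 < u → u ≤ u₁ → tail ν (1 - u / K) ≤ ε * tail ν (1 - u) := by
  obtain ⟨K, C, u₁, hK, hC, hu₁, hKu, hs⟩ := h.exists_mul_tail_le
  have hw := h.1
  have hK0 : 0 < K := by linarith
  have hC0 : 0 < C := by linarith
  have key : ∀ n : ℕ, ∀ u, 0 < u → u ≤ u₁ → C ^ n * tail ν (1 - u / K ^ n) ≤ tail ν (1 - u) := by
    intro n
    induction n with
    | zero => intro u _ _; simp
    | succ n ih =>
      intro u hu huu
      have hKn : 1 ≤ K ^ (n + 1) := one_le_pow₀ hK.le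
      have h2 := hs (u / K ^ (n + 1)) (by positivity) ((div_le_self hu.le hKn).trans huu)
      rw [show K * (u / K ^ (n + 1)) = u / K ^ n by rw [pow_succ]; field_simp] at h2
      calc C ^ (n + 1) * tail ν (1 - u / K ^ (n + 1))
          = C ^ n * (C * tail ν (1 - u / K ^ (n + 1))) := by ring
        _ ≤ C ^ n * tail ν (1 - u / K ^ n) := mul_le_mul_of_nonneg_left h2 (by positivity)
        _ ≤ _ := ih u hu huu
  obtain ⟨n, hn⟩ := pow_unbounded_of_one_lt (1 / ε) hC
  have hn' := key n
  have hu1 : u₁ ≤ 1 := by nlinarith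
  -- One more power than the iteration needs: it keeps the new ratio of scales above 1 even if n =
  -- 0.
  refine ⟨K ^ (n + 1), u₁, one_lt_pow₀ hK (by simp), hu₁, hu1, fun u hu huu => ?_⟩
  have hKn : K ^ n ≤ K ^ (n + 1) := pow_le_pow_right₀ hK.le (by simp)
  have h1Kn : 1 ≤ K ^ n := one_le_pow₀ hK.le
  have h1 : tail ν (1 - u / K ^ (n + 1)) ≤ tail ν (1 - u / K ^ n) := by
    have e1 : u / K ^ (n + 1) ≤ u / K ^ n := div_le_div_of_nonneg_left hu.le (by positivity) hKn
    have e2 : u / K ^ n ≤ 1 := (div_le_self hu.le h1Kn).trans (by linarith)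
    have e3 : 0 < u / K ^ (n + 1) := by positivity
    exact hw.tail_anti (by linarith) (by linarith) (by linarith)
  have h2 := hn' u hu huu
  have h3 : 0 ≤ tail ν (1 - u) := hw.tail_nonneg (by linarith) (by linarith)
  refine h1.trans ?_
  rw [div_lt_iff₀ hε] at hn
  have h4 : 0 ≤ tail ν (1 - u / K ^ n) :=
    (hw.tail_nonneg (by have := (div_le_self hu.le h1Kn).trans huu; linarith)
      (by have : 0 < u / K ^ n := by positivity
          linarith))
  calc tail ν (1 - u / K ^ n) = 1 * tail ν (1 - u / K ^ n) := by ring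
    _ ≤ (C ^ n * ε) * tail ν (1 - u / K ^ n) := mul_le_mul_of_nonneg_right hn.le h4
    _ = ε * (C ^ n * tail ν (1 - u / K ^ n)) := by ring
    _ ≤ _ := mul_le_mul_of_nonneg_left h2 hε.le

/-! ### The quotient weight ω/ν̂. -/

section DivTail

variable {ω ν : ℝ → ℝ}

lemma tail_mul_divTail (hν : IsRadialWeight ν) {s : ℝ} (hs : s ∈ Ico (0 : ℝ) 1) :
    tail ν s * divTail ω ν s = ω s :=
  mul_div_cancel₀ _ (hν.tail_pos s hs).ne'

lemma divTail_nonneg (hω : IsRadialWeight ω) (hν : IsRadialWeight ν) {s : ℝ}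
    (hs : s ∈ Ico (0 : ℝ) 1) : 0 ≤ divTail ω ν s :=
  div_nonneg (hω.nonneg s hs) (hν.tail_pos s hs).le

lemma divTail_intervalIntegrable (hi : IntegrableOn (divTail ω ν) (Ico 0 1)) {a b : ℝ}
    (ha : a ∈ Icc (0 : ℝ) 1) (hb : b ∈ Icc (0 : ℝ) 1) :
    IntervalIntegrable (divTail ω ν) volume a b := by
  have : IntervalIntegrable (divTail ω ν) volume 0 1 := by
    rw [intervalIntegrable_iff_integrableOn_Ico_of_le zero_le_one]; exact hi
  refine this.mono_set ?_
  rw [uIcc_of_le (zero_le_one' ℝ)]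
  exact (uIcc_subset_Icc ha hb)

lemma tail_le_tail_mul_tail_divTail (hω : IsRadialWeight ω) (hν : IsRadialWeight ν)
    (hi : IntegrableOn (divTail ω ν) (Ico 0 1)) {r : ℝ} (hr : r ∈ Ico (0 : ℝ) 1) :
    tail ω r ≤ tail ν r * tail (divTail ω ν) r := by
  unfold tail
  rw [← intervalIntegral.integral_const_mul]
  refine intervalIntegral.integral_mono_on_of_le_Ioo hr.2.le
    (hω.intervalIntegrable ⟨hr.1, hr.2.le⟩ (by simp))
    ((divTail_intervalIntegrable hi ⟨hr.1, hr.2.le⟩ (by simp)).const_mul _) fun s hs => ?_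
  have hs' : s ∈ Ico (0 : ℝ) 1 := ⟨hr.1.trans hs.1.le, hs.2⟩
  rw [← tail_mul_divTail (ω := ω) hν hs']
  exact mul_le_mul_of_nonneg_right (hν.tail_anti hr.1 hs.1.le hs.2.le) (divTail_nonneg hω hν hs')

lemma isRadialWeight_divTail (hω : IsRadialWeight ω) (hν : IsRadialWeight ν)
    (hi : IntegrableOn (divTail ω ν) (Ico 0 1)) : IsRadialWeight (divTail ω ν) where
  nonneg _ hr := divTail_nonneg hω hν hr
  integrable := hi
  tail_pos r hr := pos_of_mul_pos_right ((hω.tail_pos r hr).trans_le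
    (tail_le_tail_mul_tail_divTail hω hν hi hr)) (hν.tail_pos r hr).le

/-- Comparison of a piece of the moment of `ω` with a piece of the moment of `ω / ν̂`. -/
lemma integral_rpow_mul_le_mul (hω : IsRadialWeight ω) (hν : IsRadialWeight ν)
    (hi : IntegrableOn (divTail ω ν) (Ico 0 1)) {x p q D : ℝ} (hx : 0 ≤ x) (hp : 0 ≤ p)
    (hpq : p ≤ q) (hq : q ≤ 1) (hD : ∀ s ∈ Ioo p q, s ^ x * tail ν s ≤ D) :
    ∫ s in p..q, s ^ (2 * x) * ω s ≤ D * ∫ s in p..q, s ^ x * divTail ω ν s := by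
  have hσ := isRadialWeight_divTail hω hν hi
  rw [← intervalIntegral.integral_const_mul]
  refine intervalIntegral.integral_mono_on_of_le_Ioo hpq
    (hω.rpow_intervalIntegrable (by positivity) ⟨hp, by linarith⟩ ⟨by linarith, hq⟩)
    ((hσ.rpow_intervalIntegrable hx ⟨hp, by linarith⟩ ⟨by linarith, hq⟩).const_mul _)
    fun s hs => ?_
  have hs0 : 0 < s := hp.trans_lt hs.1
  have hs' : s ∈ Ico (0 : ℝ) 1 := ⟨hs0.le, hs.2.trans_le hq⟩
  rw [← tail_mul_divTail (ω := ω) hν hs', two_mul, Real.rpow_add hs0]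
  calc s ^ x * s ^ x * (tail ν s * divTail ω ν s)
      = (s ^ x * tail ν s) * (s ^ x * divTail ω ν s) := by ring
    _ ≤ _ := mul_le_mul_of_nonneg_right (hD s hs)
        (mul_nonneg (Real.rpow_nonneg hs0.le _) (divTail_nonneg hω hν hs'))

/-- The inequality opposite to the moment condition: s^x ν̂(s) ≤ ν_x for every s. It provides the
lower bounds for the sawtooth series. -/
lemma moment_two_mul_le (hω : IsRadialWeight ω) (hν : IsRadialWeight ν)
    (hi : IntegrableOn (divTail ω ν) (Ico 0 1)) {x : ℝ} (hx : 0 ≤ x) :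
    moment ω (2 * x) ≤ moment ν x * moment (divTail ω ν) x :=
  integral_rpow_mul_le_mul hω hν hi hx le_rfl zero_le_one le_rfl fun _ hs =>
    hν.rpow_mul_tail_le_moment hx hs.1.le hs.2.le

/-- With x = 1/u, the moment condition bounds ν̂(1-u)σ_x by a multiple of ω_{2x} = ∫ (s^x ν̂)(s^x
σ). Outside the window (1 - Au, 1 - u/K) the factor s^x ν̂ is at most ε ν̂(1-u), and that
contribution is absorbed on the left; only the mass of σ in the window remains. -/
lemma exists_moment_divTail_le (hω : IsRadialWeight ω) (hν : IsUpperDoubling ν)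
    (hν' : IsLowerDoubling ν) (h : MomentCondition ω ν) :
    ∃ A K C u₁ : ℝ, 1 ≤ A ∧ 1 < K ∧ 0 < C ∧ 0 < u₁ ∧ A * u₁ ≤ 1 / 2 ∧ ∀ u, 0 < u → u ≤ u₁ →
      moment (divTail ω ν) (1 / u) ≤
        C * (tail (divTail ω ν) (1 - A * u) - tail (divTail ω ν) (1 - u / K)) := by
  obtain ⟨hi, C₀, hC₀⟩ := h
  have hνw := hν.1
  have hσ := isRadialWeight_divTail hω hνw hi
  obtain ⟨b, hb⟩ := hν.exists_tail_le_pow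
  -- The factor e² comes from (1-u)^{1/u} ≥ e^{-2}; the choice of `ε` below makes the absorbed term
  -- exactly half of the left-hand side.
  set C₁ : ℝ := Real.exp 2 * max C₀ 1 with hC₁
  have hC₁p : 0 < C₁ := by positivity
  set ε : ℝ := 1 / (2 * C₁) with hε
  have hεp : 0 < ε := by positivity
  obtain ⟨K, u₂, hK, hu₂, hu₂1, hKs⟩ := hν'.exists_tail_le_mul hεp
  -- With y = (1-s)x, e^{-y} bounds s^x and (1 + 2y)^b bounds ν̂(s)/ν̂(1-u).
  obtain ⟨A, hA1, hA⟩ : ∃ A : ℝ, 1 ≤ A ∧ ∀ y, A ≤ y → Real.exp (-y) * (1 + 2 * y) ^ b ≤ ε := by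
    have h1 : Tendsto (fun y : ℝ => 3 ^ b * (y ^ b * Real.exp (-y))) atTop (𝓝 (3 ^ b * 0)) :=
      (Real.tendsto_pow_mul_exp_neg_atTop_nhds_zero b).const_mul _
    rw [mul_zero] at h1
    obtain ⟨A, hA⟩ := eventually_atTop.1 (h1.eventually_le_const hεp)
    refine ⟨max A 1, le_max_right _ _, fun y hy => le_trans ?_ (hA y ((le_max_left _ _).trans hy))⟩
    have hy1 : 1 ≤ y := (le_max_right _ _).trans hy
    rw [← mul_assoc, ← mul_pow, mul_comm]
    exact mul_le_mul_of_nonneg_right (pow_le_pow_left₀ (by positivity) (by linarith) _)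
      (Real.exp_pos _).le
  have hA0 : 0 < A := by linarith
  have hK0 : 0 < K := by linarith
  refine ⟨A, K, 2 * (C₁ * (1 + 2 * A) ^ b), min u₂ (1 / (2 * A)), hA1, hK, by positivity,
    by positivity, ?_, fun u hu huu => ?_⟩
  · calc A * min u₂ (1 / (2 * A)) ≤ A * (1 / (2 * A)) :=
        mul_le_mul_of_nonneg_left (min_le_right _ _) hA0.le
      _ = 1 / 2 := by field_simp
  have hu2 := huu.trans (min_le_left _ _)
  have hAu : A * u ≤ 1 / 2 := by
    have := huu.trans (min_le_right _ _)
    rw [le_div_iff₀ (by positivity)] at this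
    linarith
  have huA : u ≤ A * u := by nlinarith
  have huK : u / K ≤ u := div_le_self hu.le hK.le
  have huK0 : 0 < u / K := by positivity
  set x := 1 / u with hx
  have hx0 : 0 < x := by positivity
  set σ := divTail ω ν with hσd
  set T := tail ν (1 - u) with hT
  have hTp : 0 < T := hνw.tail_pos _ ⟨by linarith, by linarith⟩
  have h1 : T * moment σ x ≤ C₁ * moment ω (2 * x) := by
    have e1 := one_sub_rpow_ge hu.le (by linarith) hx0.le
    rw [show 2 * u * x = 2 by rw [hx]; field_simp] at e1
    have e2 := hνw.rpow_mul_tail_le_moment hx0.le (r := 1 - u) (by linarith) (by linarith)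
    have e3 := hC₀ x hx0.le
    have hωp : 0 < moment ω (2 * x) := hω.moment_pos (by positivity)
    have hσp : 0 < moment σ x := hσ.moment_pos hx0.le
    rw [div_mul_eq_mul_div, div_le_iff₀ hωp] at e3
    have e4 : T ≤ Real.exp 2 * moment ν x := by
      calc T = Real.exp 2 * (Real.exp (-2) * T) := by
            rw [← mul_assoc, ← Real.exp_add]; simp
        _ ≤ Real.exp 2 * ((1 - u) ^ x * T) := by gcongr
        _ ≤ _ := by gcongr
    calc T * moment σ x ≤ Real.exp 2 * moment ν x * moment σ x := by gcongr
      _ = Real.exp 2 * (moment ν x * moment σ x) := by ring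
      _ ≤ Real.exp 2 * (C₀ * moment ω (2 * x)) := by gcongr
      _ ≤ Real.exp 2 * (max C₀ 1 * moment ω (2 * x)) := by gcongr; exact le_max_left _ _
      _ = _ := by rw [hC₁]; ring
  have ha : 1 - A * u ∈ Icc (0 : ℝ) 1 := ⟨by linarith, by nlinarith⟩
  have hc : 1 - u / K ∈ Icc (0 : ℝ) 1 := ⟨by linarith, by linarith⟩
  have hac : 1 - A * u ≤ 1 - u / K := by linarith
  have p1 : ∫ s in (0 : ℝ)..(1 - A * u), s ^ (2 * x) * ω s ≤
      ε * T * ∫ s in (0 : ℝ)..(1 - A * u), s ^ x * σ s := by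
    refine integral_rpow_mul_le_mul hω hνw hi hx0.le le_rfl ha.1 ha.2 fun s hs => ?_
    have e1 := one_sub_rpow_le (u := 1 - s) (by linarith [hs.1]) hx0.le
    have e2 := hb (1 - s) u (by linarith [hs.2, mul_pos hA0 hu]) (by linarith [hs.1]) hu
      (by linarith)
    rw [sub_sub_cancel] at e1 e2
    have e3 := hA ((1 - s) * x) (by rw [hx, mul_one_div, le_div_iff₀ hu]; linarith [hs.2])
    calc s ^ x * tail ν s ≤ Real.exp (-((1 - s) * x)) * ((1 + 2 * (1 - s) / u) ^ b * T) :=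
          mul_le_mul e1 e2 (hνw.tail_nonneg hs.1.le (by linarith [hs.2, ha.2]))
            (Real.exp_pos _).le
      _ = Real.exp (-((1 - s) * x)) * (1 + 2 * ((1 - s) * x)) ^ b * T := by
          rw [hx]; ring
      _ ≤ _ := by gcongr
  have p2 : ∫ s in (1 - A * u)..(1 - u / K), s ^ (2 * x) * ω s ≤
      (1 + 2 * A) ^ b * T * ∫ s in (1 - A * u)..(1 - u / K), s ^ x * σ s := by
    refine integral_rpow_mul_le_mul hω hνw hi hx0.le ha.1 hac hc.2 fun s hs => ?_
    have hs0 : 0 ≤ s := ha.1.trans hs.1.le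
    have hs1 : s ≤ 1 := hs.2.le.trans hc.2
    have e1 := Real.rpow_le_one hs0 hs1 hx0.le
    have e2 := hνw.tail_anti ha.1 hs.1.le hs1
    have e3 := hb (A * u) u (by positivity) (by linarith) hu (by linarith)
    rw [show 2 * (A * u) / u = 2 * A by field_simp] at e3
    calc s ^ x * tail ν s ≤ 1 * tail ν s :=
          mul_le_mul_of_nonneg_right e1 (hνw.tail_nonneg hs0 hs1)
      _ ≤ _ := by rw [one_mul]; exact e2.trans e3
  have p3 : ∫ s in (1 - u / K)..1, s ^ (2 * x) * ω s ≤
      ε * T * ∫ s in (1 - u / K)..1, s ^ x * σ s := by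
    refine integral_rpow_mul_le_mul hω hνw hi hx0.le hc.1 hc.2 le_rfl fun s hs => ?_
    have hs0 : 0 ≤ s := hc.1.trans hs.1.le
    have e1 := Real.rpow_le_one hs0 hs.2.le hx0.le
    have e2 := hνw.tail_anti hc.1 hs.1.le hs.2.le
    calc s ^ x * tail ν s ≤ 1 * tail ν s :=
          mul_le_mul_of_nonneg_right e1 (hνw.tail_nonneg hs0 hs.2.le)
      _ ≤ _ := by rw [one_mul]; exact e2.trans (hKs u hu hu2)
  have p4 : ∫ s in (1 - A * u)..(1 - u / K), s ^ x * σ s ≤ tail σ (1 - A * u) - tail σ (1 - u / K) := by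
    rw [hσ.tail_sub_tail ha hc]
    refine intervalIntegral.integral_mono_on_of_le_Ioo hac
      (hσ.rpow_intervalIntegrable hx0.le ha hc) (hσ.intervalIntegrable ha hc) fun s hs => ?_
    have hs0 : 0 ≤ s := ha.1.trans hs.1.le
    have hs1 : s < 1 := hs.2.trans_le hc.2
    have e1 := Real.rpow_le_one hs0 hs1.le hx0.le
    have e2 := hσ.nonneg s ⟨hs0, hs1⟩
    nlinarith
  have q0 : 0 ≤ ∫ s in (1 - A * u)..(1 - u / K), s ^ x * σ s :=
    hσ.integral_rpow_mul_nonneg hx0.le ha.1 hac hc.2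
  have s1 := hω.moment_split (x := 2 * x) (by positivity) ha
  have s2 := intervalIntegral.integral_add_adjacent_intervals
    (hω.rpow_intervalIntegrable (x := 2 * x) (by positivity) ha hc)
    (hω.rpow_intervalIntegrable (x := 2 * x) (by positivity) hc (by simp : (1 : ℝ) ∈ Icc (0 : ℝ) 1))
  have s3 := hσ.moment_split hx0.le ha
  have s4 := intervalIntegral.integral_add_adjacent_intervals
    (hσ.rpow_intervalIntegrable hx0.le ha hc)
    (hσ.rpow_intervalIntegrable hx0.le hc (by simp : (1 : ℝ) ∈ Icc (0 : ℝ) 1))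
  set J := tail σ (1 - A * u) - tail σ (1 - u / K)
  have h2 : moment ω (2 * x) ≤ ε * T * moment σ x + (1 + 2 * A) ^ b * T * J := by
    have e1 : (1 + 2 * A) ^ b * T * ∫ s in (1 - A * u)..(1 - u / K), s ^ x * σ s ≤
      (1 + 2 * A) ^ b * T * J := by gcongr
    have e2 : 0 ≤ ε * T * ∫ s in (1 - A * u)..(1 - u / K), s ^ x * σ s := by positivity
    rw [s1, ← s2, s3, ← s4]
    linarith
  have h3 : T * moment σ x ≤ T * (1 / 2 * moment σ x + C₁ * (1 + 2 * A) ^ b * J) := by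
    calc T * moment σ x ≤ C₁ * (ε * T * moment σ x + (1 + 2 * A) ^ b * T * J) := by
          refine h1.trans ?_; gcongr
      _ = _ := by rw [hε]; field_simp
  have h4 := le_of_mul_le_mul_left h3 hTp
  linarith

/-- Both halves come from the window estimate. Dropping the subtracted tail bounds σ_x by σ̂(1 -
Au), while σ_x is at least a multiple of σ̂(1 - 2Au): upper doubling. Keeping it, the mass in the
window dominates σ_x and hence σ̂ at the inner end 1 - u/K: lower doubling. -/
lemma isDoubling_divTail_of_momentCondition (hω : IsRadialWeight ω) (hν : IsUpperDoubling ν)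
    (hν' : IsLowerDoubling ν) (h : MomentCondition ω ν) : IsDoubling (divTail ω ν) := by
  obtain ⟨A, K, C, u₁, hA, hK, hC, hu₁, hAu₁, hm⟩ := exists_moment_divTail_le hω hν hν' h
  have hσ := isRadialWeight_divTail hω hν.1 h.1
  have hA0 : 0 < A := by linarith
  have hK0 : 0 < K := by linarith
  refine ⟨⟨hσ, C * Real.exp (4 * A), by positivity, ?_⟩,
    ⟨hσ, A * K, 1 + Real.exp (-2) / C, by nlinarith, by simp; positivity, ?_⟩⟩
  · refine eventually_nhdsLT_one_iff.2 ⟨min (1 / 2) (A * u₁), by positivity,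
      (min_le_left _ _).trans (by norm_num), fun w hw hw' => ?_⟩
    have hw1 := hw'.trans (min_le_left _ _)
    have hw2 := hw'.trans (min_le_right _ _)
    have hx : 0 < w / (2 * A) := by positivity
    -- The scale u = w/(2A) puts the left end of the window at 1 - w/2.
    have h1 := hm (w / (2 * A)) hx (by rw [div_le_iff₀ (by positivity)]; nlinarith)
    have h2 := hσ.rpow_mul_tail_le_moment (x := 1 / (w / (2 * A))) (by positivity) (r := 1 - w)
      (by linarith) (by linarith)
    have h3 := one_sub_rpow_ge hw.le hw1 (x := 1 / (w / (2 * A))) (by positivity)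
    rw [show 2 * w * (1 / (w / (2 * A))) = 4 * A by field_simp; norm_num] at h3
    rw [show A * (w / (2 * A)) = w / 2 by field_simp] at h1
    rw [show (1 + (1 - w)) / 2 = 1 - w / 2 by ring]
    have h4 : 0 ≤ tail (divTail ω ν) (1 - w / (2 * A) / K) := by
      refine hσ.tail_nonneg ?_ ?_
      · have : w / (2 * A) / K ≤ w := (div_le_self hx.le hK.le).trans
          (div_le_self hw.le (by linarith))
        linarith
      · have : 0 < w / (2 * A) / K := by positivity
        linarith
    have hT : 0 ≤ tail (divTail ω ν) (1 - w) := hσ.tail_nonneg (by linarith) (by linarith)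
    calc tail (divTail ω ν) (1 - w)
        = Real.exp (4 * A) * (Real.exp (-(4 * A)) * tail (divTail ω ν) (1 - w)) := by
          rw [← mul_assoc, ← Real.exp_add]; simp
      _ ≤ Real.exp (4 * A) * (C * tail (divTail ω ν) (1 - w / 2)) := by
          refine mul_le_mul_of_nonneg_left ?_ (Real.exp_pos _).le
          refine (mul_le_mul_of_nonneg_right h3 hT).trans (h2.trans (h1.trans ?_))
          exact mul_le_mul_of_nonneg_left (by linarith) hC.le
      _ = _ := by ring
  · refine eventually_nhdsLT_one_iff.2 ⟨A * u₁, by positivity, by linarith, fun w hw hw' => ?_⟩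
    have hu : 0 < w / A := by positivity
    -- Now u = w/A, and the window runs from 1 - w to 1 - w/(AK).
    have h1 := hm (w / A) hu (by rw [div_le_iff₀ hA0]; linarith)
    have hwA : w / A ≤ w := div_le_self hw.le hA
    have hwK : w / A / K ≤ w / A := div_le_self hu.le hK.le
    have hwK0 : 0 < w / A / K := by positivity
    rw [mul_div_cancel₀ _ hA0.ne'] at h1
    have h2 := hσ.rpow_mul_tail_le_moment (x := 1 / (w / A)) (by positivity) (r := 1 - w / A / K)
      (by linarith) (by linarith)
    have h3 : Real.exp (-2) ≤ (1 - w / A / K) ^ (1 / (w / A)) := by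
      refine le_trans ?_ (one_sub_rpow_ge hwK0.le (by linarith) (by positivity))
      refine Real.exp_le_exp.2 (neg_le_neg ?_)
      rw [mul_one_div, div_le_iff₀ hu]; linarith
    have hT : 0 ≤ tail (divTail ω ν) (1 - w / A / K) := hσ.tail_nonneg (by linarith) (by linarith)
    rw [sub_sub_cancel, ← div_div]
    have h4 := (mul_le_mul_of_nonneg_right h3 hT).trans (h2.trans h1)
    have h5 : Real.exp (-2) / C * tail (divTail ω ν) (1 - w / A / K) ≤
        tail (divTail ω ν) (1 - w) - tail (divTail ω ν) (1 - w / A / K) := by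
      rw [div_mul_eq_mul_div, div_le_iff₀ hC]; linarith
    linarith

/-- With u = (1-r)/K, lower doubling of σ places a fixed share of σ̂(r) in (r, 1-u), where upper
doubling keeps ν̂ comparable to ν̂(r). The mass of ω = ν̂σ there is then at least a multiple of
ν̂(r)σ̂(r). Radii away from 1 are handled by monotonicity of the tails. -/
lemma exists_tail_mul_tail_divTail_le (hω : IsRadialWeight ω) (hν : IsUpperDoubling ν)
    (hσ : IsLowerDoubling (divTail ω ν)) :
    ∃ C : ℝ, ∀ r ∈ Ico (0 : ℝ) 1, tail ν r / tail ω r * tail (divTail ω ν) r ≤ C := by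
  have hσw := hσ.1
  have hνw := hν.1
  obtain ⟨b, hb⟩ := hν.exists_tail_le_pow
  obtain ⟨K, C, u₁, hK, hC, hu₁, hKu, hs⟩ := hσ.exists_mul_tail_le
  have hK0 : 0 < K := by linarith
  have hC0 : 0 < C := by linarith
  have hp : 0 < tail ω (1 - K * u₁) := hω.tail_pos _ ⟨by linarith, by nlinarith⟩
  refine ⟨max ((1 + 2 * K) ^ b * (C / (C - 1)))
    (tail ν 0 * tail (divTail ω ν) 0 / tail ω (1 - K * u₁)), fun r hr => ?_⟩
  have hωr := hω.tail_pos r hr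
  rw [div_mul_eq_mul_div, div_le_iff₀ hωr]
  have hνr := hνw.tail_pos r hr
  have hσr := hσw.tail_pos r hr
  rcases le_total (1 - K * u₁) r with hcase | hcase
  · refine le_trans ?_ (mul_le_mul_of_nonneg_right (le_max_left _ _) hωr.le)
    set u := (1 - r) / K with hu
    have hru : r = 1 - K * u := by rw [hu]; field_simp; ring
    have hu0 : 0 < u := div_pos (by linarith [hr.2]) hK0
    have hu1 : u ≤ u₁ := by rw [hu, div_le_iff₀ hK0]; linarith
    have huK : u ≤ K * u := by nlinarith
    have hKu1 : K * u ≤ 1 := by nlinarith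
    have e1 := hs u hu0 hu1
    have e2 := hb (K * u) u (by positivity) hKu1 hu0 (by linarith)
    rw [show 2 * (K * u) / u = 2 * K by field_simp] at e2
    rw [← hru] at e1 e2
    have hr' : 1 - u ∈ Icc (0 : ℝ) 1 := ⟨by linarith, by linarith⟩
    have hrr' : r ≤ 1 - u := by linarith
    have e3 : tail ν (1 - u) * (tail (divTail ω ν) r - tail (divTail ω ν) (1 - u)) ≤ tail ω r := by
      rw [hσw.tail_sub_tail ⟨hr.1, hr.2.le⟩ hr', ← intervalIntegral.integral_const_mul]
      have := hω.tail_sub_tail ⟨hr.1, hr.2.le⟩ hr'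
      refine le_trans ?_ (show (∫ s in r..(1 - u), ω s) ≤ tail ω r by
        linarith [hω.tail_nonneg hr'.1 hr'.2])
      refine intervalIntegral.integral_mono_on_of_le_Ioo hrr'
        ((hσw.intervalIntegrable ⟨hr.1, hr.2.le⟩ hr').const_mul _)
        (hω.intervalIntegrable ⟨hr.1, hr.2.le⟩ hr') fun s hs => ?_
      have hs' : s ∈ Ico (0 : ℝ) 1 := ⟨hr.1.trans hs.1.le, hs.2.trans_le hr'.2⟩
      rw [← tail_mul_divTail (ω := ω) hνw hs']
      exact mul_le_mul_of_nonneg_right (hνw.tail_anti hs'.1 hs.2.le hr'.2)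
        (hσw.nonneg s hs')
    have e4 : tail (divTail ω ν) r ≤
        C / (C - 1) * (tail (divTail ω ν) r - tail (divTail ω ν) (1 - u)) := by
      rw [div_mul_eq_mul_div, le_div_iff₀ (by linarith)]; nlinarith
    have hν' : 0 ≤ tail ν (1 - u) := hνw.tail_nonneg hr'.1 hr'.2
    calc tail ν r * tail (divTail ω ν) r
        ≤ ((1 + 2 * K) ^ b * tail ν (1 - u)) *
          (C / (C - 1) * (tail (divTail ω ν) r - tail (divTail ω ν) (1 - u))) :=
          mul_le_mul e2 e4 hσr.le (by positivity)
      _ = (1 + 2 * K) ^ b * (C / (C - 1)) *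
          (tail ν (1 - u) * (tail (divTail ω ν) r - tail (divTail ω ν) (1 - u))) := by ring
      _ ≤ _ := mul_le_mul_of_nonneg_left e3
        (mul_nonneg (by positivity) (div_nonneg hC0.le (by linarith)))
  · refine le_trans ?_ (mul_le_mul_of_nonneg_right (le_max_right _ _) hωr.le)
    rw [div_mul_eq_mul_div, le_div_iff₀ hp]
    have e1 := hνw.tail_anti le_rfl hr.1 hr.2.le
    have e2 := hσw.tail_anti le_rfl hr.1 hr.2.le
    have e3 := hω.tail_anti hr.1 hcase (by nlinarith)
    have e4 := hνr.le.trans e1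
    have e5 := hσr.le.trans e2
    gcongr

/-- Here ω̂ is comparable to ν̂σ̂, a product of two quantities that both satisfy the doubling
inequality. -/
lemma upperDoubling_and_tailCondition (hω : IsRadialWeight ω) (hν : IsUpperDoubling ν)
    (hσ : IsDoubling (divTail ω ν)) : IsUpperDoubling ω ∧ TailCondition ω ν := by
  obtain ⟨C, hC⟩ := exists_tail_mul_tail_divTail_le hω hν hσ.2
  refine ⟨⟨hω, ?_⟩, hσ.1.1.integrable, C, hC⟩
  obtain ⟨b, hb⟩ := hν.exists_tail_le_two_pow
  obtain ⟨c, hc⟩ := hσ.1.exists_tail_le_two_pow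
  refine ⟨2 ^ b * 2 ^ c * max C 1, by positivity, ?_⟩
  filter_upwards [Ioo_mem_nhdsLT (zero_lt_one' ℝ)] with r hr
  have hr0 : r ∈ Ico (0 : ℝ) 1 := ⟨hr.1.le, hr.2⟩
  have hr' : (1 + r) / 2 ∈ Ico (0 : ℝ) 1 := ⟨by linarith [hr.1], by linarith [hr.2]⟩
  have h1 := hC _ hr'
  rw [div_mul_eq_mul_div, div_le_iff₀ (hω.tail_pos _ hr')] at h1
  have hν1 := hν.1.tail_pos _ hr'
  calc tail ω r ≤ tail ν r * tail (divTail ω ν) r :=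
        tail_le_tail_mul_tail_divTail hω hν.1 hσ.1.1.integrable hr0
    _ ≤ (2 ^ b * tail ν ((1 + r) / 2)) * (2 ^ c * tail (divTail ω ν) ((1 + r) / 2)) :=
        mul_le_mul (hb r hr0) (hc r hr0) (hσ.1.1.tail_pos r hr0).le (by positivity)
    _ = 2 ^ b * 2 ^ c * (tail ν ((1 + r) / 2) * tail (divTail ω ν) ((1 + r) / 2)) := by ring
    _ ≤ 2 ^ b * 2 ^ c * (max C 1 * tail ω ((1 + r) / 2)) := by
        refine mul_le_mul_of_nonneg_left (h1.trans ?_) (by positivity)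
        exact mul_le_mul_of_nonneg_right (le_max_left _ _) (hω.tail_pos _ hr').le
    _ = _ := by ring

/-- The tail condition makes ω̂ and ν̂σ̂ comparable, so σ inherits upper doubling from ω; all
moments involved may then be replaced by tails at 1 - 1/x. -/
lemma momentCondition_of_tailCondition (hω : IsUpperDoubling ω) (hν : IsUpperDoubling ν)
    (h : TailCondition ω ν) : MomentCondition ω ν := by
  obtain ⟨hi, C, hC⟩ := h
  have hσ := isRadialWeight_divTail hω.1 hν.1 hi
  have hC' : ∀ r ∈ Ico (0 : ℝ) 1, tail ν r * tail (divTail ω ν) r ≤ max C 1 * tail ω r := by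
    intro r hr
    have h1 : tail ν r / tail ω r * tail (divTail ω ν) r ≤ C := hC r hr
    rw [div_mul_eq_mul_div, div_le_iff₀ (hω.1.tail_pos _ hr)] at h1
    exact h1.trans (mul_le_mul_of_nonneg_right (le_max_left _ _) (hω.1.tail_pos _ hr).le)
  have hσd : IsUpperDoubling (divTail ω ν) := by
    obtain ⟨b, hb⟩ := hω.exists_tail_le_two_pow
    refine ⟨hσ, 2 ^ b * max C 1, by positivity, ?_⟩
    filter_upwards [Ioo_mem_nhdsLT (zero_lt_one' ℝ)] with r hr
    have hr0 : r ∈ Ico (0 : ℝ) 1 := ⟨hr.1.le, hr.2⟩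
    have hr' : (1 + r) / 2 ∈ Ico (0 : ℝ) 1 := ⟨by linarith [hr.1], by linarith [hr.2]⟩
    have hνr := hν.1.tail_pos r hr0
    have e1 := tail_le_tail_mul_tail_divTail hω.1 hν.1 hi hr'
    have e2 := hν.1.tail_anti hr.1.le (by linarith [hr.2] : r ≤ (1 + r) / 2) (by linarith [hr.2])
    have hσ' := hσ.tail_pos _ hr'
    refine le_of_mul_le_mul_left ?_ hνr
    calc tail ν r * tail (divTail ω ν) r ≤ max C 1 * (2 ^ b * tail ω ((1 + r) / 2)) :=
          (hC' r hr0).trans (by gcongr; exact hb r hr0)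
      _ ≤ max C 1 * (2 ^ b * (tail ν r * tail (divTail ω ν) ((1 + r) / 2))) := by
          gcongr; exact e1.trans (by gcongr)
      _ = _ := by ring
  obtain ⟨C₁, hC₁, h1⟩ := hσd.exists_moment_le_tail
  obtain ⟨C₂, hC₂, h2⟩ := hν.exists_moment_le_tail
  -- The first constant serves x ≥ 2, with e⁴ from (1 - 1/x)^{2x} ≥ e^{-4}; the second serves x ≤ 2,
  -- where ω_{2x} ≥ ω_4.
  refine ⟨hi, max (C₁ * C₂ * max C 1 * Real.exp 4)
    (tail ν 0 * tail (divTail ω ν) 0 / moment ω 4), fun x hx => ?_⟩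
  have hνm := hν.1.moment_pos hx
  have hσm := hσ.moment_pos hx
  have hωm : 0 < moment ω (2 * x) := hω.1.moment_pos (by positivity)
  rw [div_mul_eq_mul_div, div_le_iff₀ hωm]
  rcases le_total 2 x with hx2 | hx2
  · refine le_trans ?_ (mul_le_mul_of_nonneg_right (le_max_left _ _) hωm.le)
    have hx0 : 0 < x := by linarith
    have hu : 1 / x ≤ 1 / 2 := one_div_le_one_div_of_le two_pos hx2
    have hu0 : 0 < 1 / x := by positivity
    have hr : 1 - 1 / x ∈ Ico (0 : ℝ) 1 := ⟨by linarith, by linarith⟩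
    have e1 := one_sub_rpow_ge hu0.le hu (x := 2 * x) (by positivity)
    rw [show 2 * (1 / x) * (2 * x) = 4 by field_simp; norm_num] at e1
    have e2 := hω.1.rpow_mul_tail_le_moment (x := 2 * x) (by positivity) hr.1 hr.2.le
    have hωr := hω.1.tail_pos _ hr
    have e3 : tail ω (1 - 1 / x) ≤ Real.exp 4 * moment ω (2 * x) := by
      calc tail ω (1 - 1 / x) = Real.exp 4 * (Real.exp (-4) * tail ω (1 - 1 / x)) := by
            rw [← mul_assoc, ← Real.exp_add]; simp
        _ ≤ Real.exp 4 * ((1 - 1 / x) ^ (2 * x) * tail ω (1 - 1 / x)) := by gcongr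
        _ ≤ _ := by gcongr
    have hνr := hν.1.tail_pos _ hr
    calc moment ν x * moment (divTail ω ν) x
        ≤ (C₂ * tail ν (1 - 1 / x)) * (C₁ * tail (divTail ω ν) (1 - 1 / x)) :=
          mul_le_mul (h2 x (by linarith)) (h1 x (by linarith)) hσm.le (by positivity)
      _ = C₁ * C₂ * (tail ν (1 - 1 / x) * tail (divTail ω ν) (1 - 1 / x)) := by ring
      _ ≤ C₁ * C₂ * (max C 1 * (Real.exp 4 * moment ω (2 * x))) := by
          refine mul_le_mul_of_nonneg_left ((hC' _ hr).trans ?_) (by positivity)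
          gcongr
      _ = _ := by ring
  · refine le_trans ?_ (mul_le_mul_of_nonneg_right (le_max_right _ _) hωm.le)
    have hω4 : 0 < moment ω 4 := hω.1.moment_pos (by norm_num)
    rw [div_mul_eq_mul_div, le_div_iff₀ hω4]
    have e1 := hν.1.moment_anti le_rfl hx
    have e2 := hσ.moment_anti le_rfl hx
    have e3 := hω.1.moment_anti (x := 2 * x) (y := 4) (by positivity) (by linarith)
    rw [IsRadialWeight.moment_zero] at e1 e2
    have e4 := hνm.le.trans e1
    have e5 := hσm.le.trans e2
    gcongr

end DivTail

/-! ### Fourier series on the unit circle -/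

/-- The point `e^{iθ}` of the unit circle. -/
def circ (θ : ℝ) : ℂ := Complex.exp (θ * Complex.I)

@[simp] lemma norm_circ (θ : ℝ) : ‖circ θ‖ = 1 := Complex.norm_exp_ofReal_mul_I θ

lemma continuous_circ : Continuous circ := by unfold circ; fun_prop

lemma circ_pow_mul_conj_pow (n m : ℕ) (θ : ℝ) :
    circ θ ^ n * conj (circ θ) ^ m = Complex.exp (((n : ℂ) - m) * Complex.I * θ) := by
  have : conj (circ θ) = Complex.exp (-(θ * Complex.I)) := by
    unfold circ
    rw [← Complex.exp_conj]; simp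
  rw [this, circ, ← Complex.exp_nat_mul, ← Complex.exp_nat_mul, ← Complex.exp_add]
  congr 1; ring

lemma integral_circ_pow_mul_conj_pow (n m : ℕ) :
    ∫ θ in (-Real.pi)..Real.pi, circ θ ^ n * conj (circ θ) ^ m =
      if n = m then 2 * Real.pi else 0 := by
  simp_rw [circ_pow_mul_conj_pow]
  split_ifs with h
  · subst h
    simp only [sub_self, zero_mul, Complex.exp_zero, intervalIntegral.integral_const]
    simp; ring
  · have hnm : ((n : ℂ) - m) ≠ 0 := sub_ne_zero.2 (by exact_mod_cast h)
    rw [integral_exp_mul_complex (mul_ne_zero hnm Complex.I_ne_zero)]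
    have : Complex.exp (((n : ℂ) - m) * Complex.I * (Real.pi : ℝ)) =
        Complex.exp (((n : ℂ) - m) * Complex.I * ((-Real.pi : ℝ) : ℂ)) := by
      rw [Complex.exp_eq_exp_iff_exists_int]
      exact ⟨n - m, by push_cast; ring⟩
    rw [this, sub_self, zero_div, Complex.ofReal_zero]

lemma hasSum_integral_circ_mul {c : ℕ → ℂ} (hc : Summable fun n => ‖c n‖) {g : ℝ → ℂ}
    (hg : AEStronglyMeasurable g (volume.restrict (Ioc (-Real.pi) Real.pi))) {B : ℝ}
    (hB : ∀ θ, ‖g θ‖ ≤ B) :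
    HasSum (fun n => c n * ∫ θ in (-Real.pi)..Real.pi, circ θ ^ n * g θ)
      (∫ θ in (-Real.pi)..Real.pi, (∑' n, c n * circ θ ^ n) * g θ) := by
  have hB0 : 0 ≤ B := (norm_nonneg _).trans (hB 0)
  simp_rw [← intervalIntegral.integral_const_mul]
  refine intervalIntegral.hasSum_integral_of_dominated_convergence (fun n _ => ‖c n‖ * B)
    (fun n => ?_) (fun n => ?_) ?_ ?_ ?_
  · rw [uIoc_of_le (by linarith [Real.pi_pos])]
    exact ((continuous_circ.pow n).aestronglyMeasurable.mul hg).const_mul _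
  · refine ae_of_all _ fun θ _ => ?_
    simp only [norm_mul, norm_pow, norm_circ, one_pow, one_mul]
    exact mul_le_mul_of_nonneg_left (hB θ) (norm_nonneg _)
  · exact ae_of_all _ fun θ _ => hc.mul_right _
  · exact intervalIntegrable_const
  · refine ae_of_all _ fun θ _ => ?_
    have h1 : Summable fun n => c n * circ θ ^ n := by
      refine Summable.of_norm ?_
      simpa using hc
    simpa [mul_assoc] using h1.hasSum.mul_right (g θ)

lemma integral_tsum_mul_conj_pow {c : ℕ → ℂ} (hc : Summable fun n => ‖c n‖) (m : ℕ) :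
    ∫ θ in (-Real.pi)..Real.pi, (∑' n, c n * circ θ ^ n) * conj (circ θ) ^ m =
      2 * Real.pi * c m := by
  have h := hasSum_integral_circ_mul hc (g := fun θ => conj (circ θ) ^ m) (B := 1)
    (((Complex.continuous_conj.comp continuous_circ).pow m).aestronglyMeasurable)
    (fun θ => by simp)
  simp_rw [integral_circ_pow_mul_conj_pow] at h
  rw [← h.tsum_eq, tsum_eq_single m (fun n hn => by simp [hn])]
  simp; ring

lemma continuous_tsum_circ {c : ℕ → ℂ} (hc : Summable fun n => ‖c n‖) :
    Continuous fun θ => ∑' n, c n * circ θ ^ n :=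
  continuous_tsum (fun n => continuous_const.mul (continuous_circ.pow n)) hc fun n θ => by simp

/-- Parseval, obtained by integrating the series termwise against its own conjugate. -/
lemma integral_norm_sq_tsum_circ {c : ℕ → ℂ} (hc : Summable fun n => ‖c n‖) :
    HasSum (fun n => 2 * Real.pi * ‖c n‖ ^ 2)
      (∫ θ in (-Real.pi)..Real.pi, ‖∑' n, c n * circ θ ^ n‖ ^ 2) := by
  set F : ℝ → ℂ := fun θ => ∑' n, c n * circ θ ^ n with hF
  have hFc : Continuous F := continuous_tsum_circ hc
  have hFb : ∀ θ, ‖F θ‖ ≤ ∑' n, ‖c n‖ := fun θ => by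
    refine (norm_tsum_le_tsum_norm (by simpa using hc)).trans ?_
    simp
  have h := hasSum_integral_circ_mul hc (g := fun θ => conj (F θ))
    ((Complex.continuous_conj.comp hFc).aestronglyMeasurable)
    (fun θ => by simpa using hFb θ)
  have h1 : ∀ n, ∫ θ in (-Real.pi)..Real.pi, circ θ ^ n * conj (F θ) =
      2 * Real.pi * conj (c n) := by
    intro n
    have h2 := congrArg conj (integral_tsum_mul_conj_pow hc n)
    rw [intervalIntegral.integral_of_le (by linarith [Real.pi_pos]), ← integral_conj,
      ← intervalIntegral.integral_of_le (by linarith [Real.pi_pos])] at h2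
    simp only [map_mul, map_pow, Complex.conj_conj, Complex.conj_ofReal, Complex.conj_ofNat] at h2
    rw [← h2]
    exact intervalIntegral.integral_congr fun θ _ => mul_comm _ _
  simp_rw [h1] at h
  have h2 : (fun n => c n * (2 * Real.pi * conj (c n))) =
      fun n => ((2 * Real.pi * ‖c n‖ ^ 2 : ℝ) : ℂ) := by
    funext n
    rw [show c n * (2 * Real.pi * conj (c n)) = 2 * Real.pi * (c n * conj (c n)) by ring,
      Complex.mul_conj, Complex.normSq_eq_norm_sq]
    push_cast; ring
  have h3 : (∫ θ in (-Real.pi)..Real.pi, (∑' n, c n * circ θ ^ n) * conj (F θ)) =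
      ((∫ θ in (-Real.pi)..Real.pi, ‖F θ‖ ^ 2 : ℝ) : ℂ) := by
    rw [← intervalIntegral.integral_ofReal]
    refine intervalIntegral.integral_congr fun θ _ => ?_
    rw [← Complex.normSq_eq_norm_sq, ← Complex.mul_conj]
  rw [h2, h3] at h
  exact_mod_cast h

/-- An `L¹` bound on a circle for a power series in terms of the `ℓ²` norm of the differences of
its coefficients. -/
lemma integral_norm_tsum_le {d : ℕ → ℂ} {w : ℂ} (hw : ‖w‖ < 1)
    (hd : Summable fun n => ‖d n‖ * ‖w‖ ^ n) {B : ℝ} (hB : 0 < B) {e : ℕ → ℂ}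
    (he0 : e 0 = d 0) (he : ∀ n, e (n + 1) = d (n + 1) - d n)
    {E : ℕ → ℝ} (hE : ∀ n, (‖e n‖ * ‖w‖ ^ n) ^ 2 ≤ E n) (hEs : Summable E)
    (hEB : ∑' n, E n ≤ B ^ 2 / (1 - ‖w‖)) :
    ∫ θ in (-Real.pi)..Real.pi, ‖∑' n, d n * (w * circ θ) ^ n‖ ≤
      2 * Real.pi * B / (1 - ‖w‖) := by
  have hw1 : 0 < 1 - ‖w‖ := by linarith
  have hpi : -Real.pi ≤ Real.pi := by linarith [Real.pi_pos]
  have hd' : Summable fun n => ‖d n * w ^ n‖ := by simpa using hd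
  have hes : Summable fun n => ‖e n * w ^ n‖ := by
    rw [← summable_nat_add_iff 1]
    have h1 : Summable fun n => ‖d (n + 1) * w ^ (n + 1)‖ + ‖w‖ * ‖d n * w ^ n‖ :=
      ((summable_nat_add_iff 1).2 hd').add (hd'.mul_left _)
    refine h1.of_nonneg_of_le (fun n => norm_nonneg _) fun n => ?_
    rw [he, sub_mul]
    refine (norm_sub_le _ _).trans (add_le_add_right (le_of_eq ?_) _)
    simp only [norm_mul, norm_pow, pow_succ]; ring
  have hgs : Summable fun n : ℕ => ‖w ^ n‖ := by
    simpa using summable_geometric_of_lt_one (norm_nonneg w) hw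
  -- Summation by parts: multiplying the series by 1 - we^{iθ} turns its coefficients into their
  -- differences.
  have key : ∀ θ, (∑' n, d n * (w * circ θ) ^ n) =
      (∑' n, w ^ n * circ θ ^ n) * ∑' n, e n * w ^ n * circ θ ^ n := by
    intro θ
    have hnorm : ‖w * circ θ‖ < 1 := by simpa using hw
    have hg : (∑' n, w ^ n * circ θ ^ n) = (1 - w * circ θ)⁻¹ := by
      simp_rw [← mul_pow]; exact tsum_geometric_of_norm_lt_one hnorm
    have hne : 1 - w * circ θ ≠ 0 := by
      intro h0
      rw [sub_eq_zero] at h0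
      rw [← h0] at hnorm; simp at hnorm
    rw [hg, eq_comm, inv_mul_eq_iff_eq_mul₀ hne]
    have hds : Summable fun n => d n * (w * circ θ) ^ n :=
      Summable.of_norm (by simpa using hd)
    have hes' : Summable fun n => e n * w ^ n * circ θ ^ n :=
      Summable.of_norm (by simpa using hes)
    rw [hes'.tsum_eq_zero_add, sub_mul, one_mul, ← tsum_mul_left]
    have h1 : ∀ n, e (n + 1) * w ^ (n + 1) * circ θ ^ (n + 1) =
        d (n + 1) * (w * circ θ) ^ (n + 1) - w * circ θ * (d n * (w * circ θ) ^ n) := by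
      intro n; rw [he, mul_pow, mul_pow]; ring
    simp_rw [h1]
    rw [Summable.tsum_sub ((summable_nat_add_iff 1).2 hds) (hds.mul_left _), he0]
    rw [hds.tsum_eq_zero_add]
    simp; ring
  set G : ℝ → ℂ := fun θ => ∑' n, w ^ n * circ θ ^ n with hG
  set H : ℝ → ℂ := fun θ => ∑' n, e n * w ^ n * circ θ ^ n with hH
  have hGc : Continuous G := continuous_tsum_circ hgs
  have hHc : Continuous H := continuous_tsum_circ hes
  have hGi : ∫ θ in (-Real.pi)..Real.pi, ‖G θ‖ ^ 2 ≤ 2 * Real.pi / (1 - ‖w‖) := by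
    have h1 := integral_norm_sq_tsum_circ hgs
    have h2 : HasSum (fun n : ℕ => 2 * Real.pi * ‖w ^ n‖ ^ 2) (2 * Real.pi * (1 - ‖w‖ ^ 2)⁻¹) := by
      have := (hasSum_geometric_of_lt_one (sq_nonneg ‖w‖)
        (by nlinarith [norm_nonneg w])).mul_left (2 * Real.pi)
      simpa [← pow_mul, mul_comm] using this
    rw [h1.unique h2, div_eq_mul_inv]
    gcongr
    nlinarith [norm_nonneg w]
  have hHi : ∫ θ in (-Real.pi)..Real.pi, ‖H θ‖ ^ 2 ≤ 2 * Real.pi * (B ^ 2 / (1 - ‖w‖)) := by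
    have h1 := integral_norm_sq_tsum_circ hes
    rw [← h1.tsum_eq, tsum_mul_left]
    refine mul_le_mul_of_nonneg_left (le_trans ?_ hEB) (by positivity)
    have hle : ∀ n, ‖e n * w ^ n‖ ^ 2 ≤ E n := fun n => by simpa using hE n
    exact Summable.tsum_le_tsum hle (hEs.of_nonneg_of_le (fun n => sq_nonneg _) hle) hEs
  calc ∫ θ in (-Real.pi)..Real.pi, ‖∑' n, d n * (w * circ θ) ^ n‖
      ≤ ∫ θ in (-Real.pi)..Real.pi, (B / 2 * ‖G θ‖ ^ 2 + 1 / (2 * B) * ‖H θ‖ ^ 2) := by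
        refine intervalIntegral.integral_mono_on hpi ?_ ?_ fun θ _ => ?_
        · simp_rw [key]
          exact ((hGc.mul hHc).norm).intervalIntegrable _ _
        · exact (Continuous.intervalIntegrable (by fun_prop) _ _)
        · rw [key, norm_mul]
          -- The product is split by a weighted arithmetic–geometric inequality; the weight B makes
          -- the two resulting bounds equal.
          have h0 : (B / 2 * ‖G θ‖ ^ 2 + 1 / (2 * B) * ‖H θ‖ ^ 2) - ‖G θ‖ * ‖H θ‖ =
              1 / (2 * B) * (B * ‖G θ‖ - ‖H θ‖) ^ 2 := by field_simp; ring
          have h1 : 0 ≤ 1 / (2 * B) * (B * ‖G θ‖ - ‖H θ‖) ^ 2 := by positivity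
          linarith
    _ = B / 2 * (∫ θ in (-Real.pi)..Real.pi, ‖G θ‖ ^ 2) +
        1 / (2 * B) * ∫ θ in (-Real.pi)..Real.pi, ‖H θ‖ ^ 2 := by
        rw [intervalIntegral.integral_add, intervalIntegral.integral_const_mul,
          intervalIntegral.integral_const_mul]
        · exact (Continuous.intervalIntegrable (by fun_prop) _ _)
        · exact (Continuous.intervalIntegrable (by fun_prop) _ _)
    _ ≤ B / 2 * (2 * Real.pi / (1 - ‖w‖)) + 1 / (2 * B) * (2 * Real.pi * (B ^ 2 / (1 - ‖w‖))) := by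
        gcongr
    _ = _ := by field_simp; ring

/-- Fourier coefficients of the sawtooth. Their size 1/n is what produces a harmonic sum in the
necessity of lower doubling. -/
lemma integral_mul_circ_conj_pow {n : ℕ} (hn : n ≠ 0) :
    ∫ θ in (-Real.pi)..Real.pi, (θ : ℂ) * conj (circ θ) ^ n =
      2 * Real.pi * (-1) ^ n * Complex.I / n := by
  have hn' : (n : ℂ) ≠ 0 := by exact_mod_cast hn
  have h0 : ∀ θ : ℝ, conj (circ θ) ^ n = Complex.exp (-n * Complex.I * θ) := by
    intro θ
    have := circ_pow_mul_conj_pow 0 n θ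
    simpa using this
  have hIn : (n : ℂ) * Complex.I ≠ 0 := mul_ne_zero hn' Complex.I_ne_zero
  have hd : ∀ θ : ℝ, HasDerivAt
      (fun θ : ℝ => ((θ : ℂ) * (Complex.I / n) + 1 / n ^ 2) * Complex.exp (-n * Complex.I * θ))
      ((θ : ℂ) * Complex.exp (-n * Complex.I * θ)) θ := by
    intro θ
    have h1 : HasDerivAt (fun θ : ℂ => (θ * (Complex.I / n) + 1 / n ^ 2) *
        Complex.exp (-n * Complex.I * θ)) ((1 * (Complex.I / n)) * Complex.exp (-n * Complex.I * θ)
          + (θ * (Complex.I / n) + 1 / n ^ 2) * (Complex.exp (-n * Complex.I * θ) *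
            (-n * Complex.I * 1))) (θ : ℂ) :=
      (((hasDerivAt_id (θ : ℂ)).mul_const _).add_const _).mul
        (((hasDerivAt_id (θ : ℂ)).const_mul _).cexp)
    convert h1.comp_ofReal using 1
    field_simp
    ring_nf
    simp
  simp_rw [h0]
  rw [intervalIntegral.integral_eq_sub_of_hasDerivAt (fun θ _ => hd θ)
    (Continuous.intervalIntegrable (by fun_prop) _ _)]
  have e1 : Complex.exp (-n * Complex.I * (Real.pi : ℝ)) = (-1) ^ n := by
    rw [show (-n * Complex.I * (Real.pi : ℝ) : ℂ) = -(n * (Real.pi * Complex.I)) by ring,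
      Complex.exp_neg, Complex.exp_nat_mul, Complex.exp_pi_mul_I, ← inv_pow]
    norm_num
  have e2 : Complex.exp (-n * Complex.I * ((-Real.pi : ℝ) : ℂ)) = (-1) ^ n := by
    rw [show (-n * Complex.I * ((-Real.pi : ℝ) : ℂ) : ℂ) = n * (Real.pi * Complex.I) by
      push_cast; ring, Complex.exp_nat_mul, Complex.exp_pi_mul_I]
  rw [e1, e2]
  push_cast
  ring

/-! ### Polar coordinates on the disc -/

/-- Polar coordinates. -/
def polarPt (p : ℝ × ℝ) : ℂ := p.1 * circ p.2

/-- Lebesgue measure on the rectangle `(0,1) × (-π,π)`. -/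
def polarRect : Measure (ℝ × ℝ) :=
  (volume.restrict (Ioo 0 1)).prod (volume.restrict (Ioo (-Real.pi) Real.pi))

lemma continuous_polarPt : Continuous polarPt := by
  unfold polarPt
  exact (Complex.continuous_ofReal.comp continuous_fst).mul (continuous_circ.comp continuous_snd)

lemma polarCoord_symm_eq (p : ℝ × ℝ) : Complex.polarCoord.symm p = polarPt p := by
  rw [Complex.polarCoord_symm_apply, polarPt, circ, Complex.exp_mul_I]
  simp

lemma norm_polarPt {p : ℝ × ℝ} (hp : 0 ≤ p.1) : ‖polarPt p‖ = p.1 := by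
  simp [polarPt, abs_of_nonneg hp]

lemma ae_polarRect_mem : ∀ᵐ p ∂polarRect, p.1 ∈ Ioo (0 : ℝ) 1 ∧ p.2 ∈ Ioo (-Real.pi) Real.pi := by
  rw [polarRect, Measure.prod_restrict]
  filter_upwards [ae_restrict_mem (measurableSet_Ioo.prod measurableSet_Ioo)] with p hp
  exact hp

lemma measurableSet_disc : MeasurableSet disc := Metric.isOpen_ball.measurableSet

lemma discArea_eq_map :
    discArea = ENNReal.ofReal Real.pi⁻¹ •
      (polarRect.withDensity fun p => ENNReal.ofReal p.1).map polarPt := by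
  unfold discArea
  congr 1
  ext A hA
  rw [Measure.restrict_apply hA, Measure.map_apply continuous_polarPt.measurable hA,
    withDensity_apply _ (continuous_polarPt.measurable hA)]
  have hAd := hA.inter measurableSet_disc
  rw [← lintegral_indicator_one hAd, ← Complex.lintegral_comp_polarCoord_symm]
  simp only [polarCoord_symm_eq]
  rw [← lintegral_indicator (by exact measurableSet_Ioi.prod measurableSet_Ioo),
    ← lintegral_indicator (continuous_polarPt.measurable hA), polarRect, Measure.prod_restrict,
    ← lintegral_indicator (measurableSet_Ioo.prod measurableSet_Ioo)]
  refine lintegral_congr fun p => ?_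
  by_cases h1 : p ∈ polarCoord.target
  · have h1' : 0 < p.1 ∧ p.2 ∈ Ioo (-Real.pi) Real.pi := h1
    have hd : polarPt p ∈ disc ↔ p.1 < 1 := by
      rw [disc, mem_ball_zero_iff, norm_polarPt h1'.1.le]
    rw [indicator_of_mem h1]
    by_cases h2 : p.1 < 1
    · rw [indicator_of_mem (show p ∈ Ioo (0 : ℝ) 1 ×ˢ Ioo (-Real.pi) Real.pi from
        ⟨⟨h1'.1, h2⟩, h1'.2⟩)]
      by_cases h3 : polarPt p ∈ A
      · rw [indicator_of_mem (show polarPt p ∈ A ∩ disc from ⟨h3, hd.2 h2⟩),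
          indicator_of_mem (show p ∈ polarPt ⁻¹' A from h3)]
        simp
      · rw [indicator_of_notMem (fun h => h3 h.1),
          indicator_of_notMem (show p ∉ polarPt ⁻¹' A from h3)]
        simp
    · rw [indicator_of_notMem (fun h => h2 (hd.1 h.2)), indicator_of_notMem (fun h => h2 h.1.2)]
      simp
  · rw [indicator_of_notMem h1, indicator_of_notMem]
    exact fun h => h1 ⟨h.1.1, h.2⟩

lemma ofReal_inv_pi_ne_zero : ENNReal.ofReal Real.pi⁻¹ ≠ 0 := by
  simp [Real.pi_pos]

lemma measurable_ofReal_fst : Measurable fun p : ℝ × ℝ => ENNReal.ofReal p.1 := by fun_prop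

lemma AEStronglyMeasurable.map_polarPt {E : Type*} [NormedAddCommGroup E] {F : ℂ → E}
    (hF : AEStronglyMeasurable F discArea) :
    AEStronglyMeasurable F ((polarRect.withDensity fun p => ENNReal.ofReal p.1).map polarPt) := by
  rw [discArea_eq_map] at hF
  exact hF.mono_ac (Measure.absolutelyContinuous_smul ofReal_inv_pi_ne_zero)

section

variable {E : Type*} [NormedAddCommGroup E] [NormedSpace ℝ E] {F : ℂ → E}

lemma integrable_discArea_iff (hF : AEStronglyMeasurable F discArea) :
    Integrable F discArea ↔ Integrable (fun p => p.1 • F (polarPt p)) polarRect := by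
  have hm := AEStronglyMeasurable.map_polarPt hF
  rw [discArea_eq_map, integrable_smul_measure ofReal_inv_pi_ne_zero ENNReal.ofReal_ne_top,
    integrable_map_measure hm continuous_polarPt.aemeasurable,
    integrable_withDensity_iff_integrable_smul' measurable_ofReal_fst (by simp)]
  refine integrable_congr ?_
  filter_upwards [ae_polarRect_mem] with p hp
  simp only [ENNReal.toReal_ofReal hp.1.1.le, Function.comp]

lemma integral_discArea (hF : Integrable F discArea) :
    ∫ ζ, F ζ ∂discArea = Real.pi⁻¹ •
      ∫ s in (0 : ℝ)..1, s • ∫ θ in (-Real.pi)..Real.pi, F (s * circ θ) := by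
  have hm := AEStronglyMeasurable.map_polarPt hF.1
  have hi := (integrable_discArea_iff hF.1).1 hF
  rw [discArea_eq_map, integral_smul_measure, ENNReal.toReal_ofReal (by positivity),
    integral_map continuous_polarPt.aemeasurable hm,
    integral_withDensity_eq_integral_toReal_smul measurable_ofReal_fst (by simp)]
  congr 1
  have h1 : ∫ p, (ENNReal.ofReal p.1).toReal • F (polarPt p) ∂polarRect =
      ∫ p, p.1 • F (polarPt p) ∂polarRect := by
    refine integral_congr_ae ?_
    filter_upwards [ae_polarRect_mem] with p hp
    simp only [ENNReal.toReal_ofReal hp.1.1.le]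
  rw [h1, polarRect, integral_prod _ hi, intervalIntegral.integral_of_le zero_le_one,
    ← integral_Ioc_eq_integral_Ioo]
  refine integral_congr_ae (ae_of_all _ fun s => ?_)
  simp only [polarPt]
  rw [integral_smul, intervalIntegral.integral_of_le (by linarith [Real.pi_pos]),
    integral_Ioc_eq_integral_Ioo]

end

/-- Null sets of radii pull back to null sets of the disc, so a.e. measurability of a function on
(0,1) passes to its radial extension. -/
lemma quasiMeasurePreserving_norm :
    Measure.QuasiMeasurePreserving (fun ζ : ℂ => ‖ζ‖) discArea (volume.restrict (Ioo (0 : ℝ) 1)) := by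
  refine ⟨measurable_norm, ?_⟩
  rw [discArea_eq_map, Measure.map_smul, Measure.map_map measurable_norm
    continuous_polarPt.measurable]
  refine Measure.AbsolutelyContinuous.trans Measure.smul_absolutelyContinuous ?_
  have hac : (polarRect.withDensity fun p => ENNReal.ofReal p.1) ≪ polarRect :=
    withDensity_absolutelyContinuous _ _
  have h1 : ((fun ζ : ℂ => ‖ζ‖) ∘ polarPt) =ᵐ[polarRect.withDensity fun p => ENNReal.ofReal p.1]
      Prod.fst := by
    refine hac.ae_le ?_
    filter_upwards [ae_polarRect_mem] with p hp
    exact norm_polarPt hp.1.1.le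
  rw [Measure.map_congr h1]
  refine (hac.map measurable_fst).trans ?_
  exact Measure.quasiMeasurePreserving_fst.absolutelyContinuous

lemma integrable_comp_norm_iff {h : ℝ → ℝ}
    (hm : AEStronglyMeasurable h (volume.restrict (Ioo (0 : ℝ) 1))) :
    Integrable (fun ζ : ℂ => h ‖ζ‖) discArea ↔ IntegrableOn (fun s => s * h s) (Ioo 0 1) := by
  rw [integrable_discArea_iff (F := fun ζ : ℂ => h ‖ζ‖)
    (hm.comp_quasiMeasurePreserving quasiMeasurePreserving_norm)]
  have h1 : (fun p : ℝ × ℝ => p.1 • h ‖polarPt p‖) =ᵐ[polarRect] fun p => (p.1 * h p.1) * 1 := by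
    filter_upwards [ae_polarRect_mem] with p hp
    rw [norm_polarPt hp.1.1.le, smul_eq_mul, mul_one]
  rw [integrable_congr h1]
  constructor
  · intro hi
    have h2 := hi.integral_prod_left
    simp only [integral_const, smul_eq_mul, mul_one] at h2
    have h3 : (volume.restrict (Ioo (-Real.pi) Real.pi)).real univ ≠ 0 := by
      simp [Measure.real, Real.pi_pos, ENNReal.toReal_eq_zero_iff]
    have h4 := h2.const_mul ((volume.restrict (Ioo (-Real.pi) Real.pi)).real univ)⁻¹
    refine h4.congr (ae_of_all _ fun s => ?_)
    simp only
    rw [← mul_assoc, inv_mul_cancel₀ h3, one_mul]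
  · intro hi
    exact Integrable.mul_prod hi (integrable_const (1 : ℝ))

lemma integrable_weight_comp_norm {h : ℝ → ℝ} (hi : IntegrableOn h (Ico 0 1)) :
    Integrable (fun ζ : ℂ => h ‖ζ‖) discArea := by
  have h1 : IntegrableOn h (Ioo 0 1) := hi.mono_set Ioo_subset_Ico_self
  rw [integrable_comp_norm_iff h1.1]
  refine Integrable.bdd_mul (c := 1) h1 continuous_id.aestronglyMeasurable ?_
  filter_upwards [ae_restrict_mem measurableSet_Ioo] with s hs
  simpa [abs_of_pos hs.1] using hs.2.le

lemma ae_discArea_mem : ∀ᵐ ζ ∂discArea, ζ ∈ disc := by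
  unfold discArea
  exact Measure.ae_smul_measure (ae_restrict_mem measurableSet_disc) _

lemma _root_.ContinuousOn.aestronglyMeasurable_discArea {F : Type*} [TopologicalSpace F]
    [TopologicalSpace.PseudoMetrizableSpace F] {f : ℂ → F}
    (hf : ContinuousOn f disc) : AEStronglyMeasurable f discArea := by
  unfold discArea
  exact (hf.aestronglyMeasurable measurableSet_disc).smul_measure _

/-! ### The Bergman kernel of a radial weight -/

lemma differentiableOn_tsum_disc {c : ℕ → ℂ}
    (hc : ∀ ρ : ℝ, 0 ≤ ρ → ρ < 1 → Summable fun n => ‖c n‖ * ρ ^ n) :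
    DifferentiableOn ℂ (fun w => ∑' n, c n * w ^ n) disc := by
  intro w hw
  rw [disc, mem_ball_zero_iff] at hw
  obtain ⟨ρ, h1, h2⟩ := exists_between hw
  have hd : DifferentiableOn ℂ (fun w => ∑' n, c n * w ^ n) (Metric.ball 0 ρ) := by
    refine Complex.differentiableOn_tsum_of_summable_norm
      (hc ρ ((norm_nonneg w).trans h1.le) h2) (fun n => by fun_prop) Metric.isOpen_ball
      fun n ζ hζ => ?_
    rw [mem_ball_zero_iff] at hζ
    rw [norm_mul, norm_pow]
    gcongr
  exact (hd.differentiableAt (Metric.isOpen_ball.mem_nhds (by simpa using h1))).differentiableWithinAt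

/-- The Taylor coefficients of the Bergman kernel. -/
def kernCoef (ω : ℝ → ℝ) (n : ℕ) : ℝ := (2 * moment ω ((2 * n + 1 : ℕ) : ℝ))⁻¹

/-- The power series `∑ wⁿ / (2 ω_{2n+1})`. -/
def kern (ω : ℝ → ℝ) (w : ℂ) : ℂ := ∑' n, (kernCoef ω n : ℂ) * w ^ n

variable {ω ν : ℝ → ℝ}

lemma IsRadialWeight.kernCoef_pos (hω : IsRadialWeight ω) (n : ℕ) : 0 < kernCoef ω n :=
  inv_pos.2 (mul_pos two_pos (hω.moment_pos (by positivity)))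

/-- A moment is at least r^{2n+1} ω̂(r) for each r < 1, so the coefficients grow slower than any
geometric rate above 1, and the series converges in the disc. -/
lemma IsRadialWeight.kernCoef_le (hω : IsRadialWeight ω) (n : ℕ) {r : ℝ} (hr : 0 < r)
    (hr1 : r < 1) : kernCoef ω n ≤ (2 * r * tail ω r)⁻¹ * (r ^ 2)⁻¹ ^ n := by
  have hT := hω.tail_pos r ⟨hr.le, hr1⟩
  have h1 := hω.rpow_mul_tail_le_moment (x := ((2 * n + 1 : ℕ) : ℝ)) (by positivity) hr.le hr1.le
  rw [Real.rpow_natCast] at h1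
  rw [kernCoef, inv_pow, ← mul_inv]
  refine inv_anti₀ (by positivity) ?_
  calc 2 * r * tail ω r * (r ^ 2) ^ n = 2 * (r ^ (2 * n + 1) * tail ω r) := by
        rw [← pow_mul, pow_succ]; ring
    _ ≤ _ := by gcongr

lemma IsRadialWeight.summable_kernCoef (hω : IsRadialWeight ω) {ρ : ℝ} (h0 : 0 ≤ ρ) (h1 : ρ < 1) :
    Summable fun n => kernCoef ω n * ρ ^ n := by
  -- Then r² - ρ = (1-ρ)²/4 > 0, so the comparison series has ratio ρ/r² < 1.
  set r := (1 + ρ) / 2 with hr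
  have hr0 : 0 < r := by positivity
  have hr1 : r < 1 := by linarith
  have hq : (r ^ 2)⁻¹ * ρ < 1 := by
    rw [inv_mul_lt_iff₀ (by positivity), mul_one, hr]
    nlinarith [sq_nonneg (1 - ρ), mul_pos (sub_pos.2 h1) (sub_pos.2 h1)]
  refine Summable.of_nonneg_of_le
    (fun n => mul_nonneg (hω.kernCoef_pos n).le (by positivity)) (fun n => ?_)
    ((summable_geometric_of_lt_one (by positivity) hq).mul_left (2 * r * tail ω r)⁻¹)
  rw [mul_pow, ← mul_assoc]
  exact mul_le_mul_of_nonneg_right (hω.kernCoef_le n hr0 hr1) (by positivity)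

lemma IsRadialWeight.differentiableOn_kern (hω : IsRadialWeight ω) :
    DifferentiableOn ℂ (kern ω) disc :=
  differentiableOn_tsum_disc fun ρ h0 h1 => by
    simpa [abs_of_pos (hω.kernCoef_pos _)] using hω.summable_kernCoef h0 h1

lemma norm_kern_le (hω : IsRadialWeight ω) {w : ℂ} {ρ : ℝ} (hw : ‖w‖ ≤ ρ) (h1 : ρ < 1) :
    ‖kern ω w‖ ≤ ∑' n, kernCoef ω n * ρ ^ n := by
  refine tsum_of_norm_bounded (hω.summable_kernCoef ((norm_nonneg w).trans hw) h1).hasSum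
    fun n => ?_
  rw [norm_mul, norm_pow, Complex.norm_real, Real.norm_of_nonneg (hω.kernCoef_pos n).le]
  have := (hω.kernCoef_pos n).le
  gcongr

lemma norm_conj_mul_lt {z ζ : ℂ} (hz : z ∈ disc) (hζ : ζ ∈ disc) : ‖conj z * ζ‖ < 1 := by
  rw [disc, mem_ball_zero_iff] at hz hζ
  rw [norm_mul, RCLike.norm_conj]
  exact mul_lt_one_of_nonneg_of_lt_one_left (norm_nonneg _) hz hζ.le

lemma norm_conj_mul_le {z ζ : ℂ} (hζ : ζ ∈ disc) : ‖conj z * ζ‖ ≤ ‖z‖ := by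
  rw [disc, mem_ball_zero_iff] at hζ
  rw [norm_mul, RCLike.norm_conj]
  exact mul_le_of_le_one_right (norm_nonneg _) hζ.le

lemma IsRadialWeight.differentiableOn_kern_conj_mul (hω : IsRadialWeight ω) {z : ℂ}
    (hz : z ∈ disc) : DifferentiableOn ℂ (fun ζ => kern ω (conj z * ζ)) disc :=
  hω.differentiableOn_kern.comp (by fun_prop) fun ζ hζ => by
    rw [disc, mem_ball_zero_iff]; exact norm_conj_mul_lt hz hζ

/-- Pairing with the kernel, expanded into a power series. -/
lemma hasSum_integral_mul_kern (hω : IsRadialWeight ω) {z : ℂ} (hz : z ∈ disc) {g : ℂ → ℂ}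
    (hg : Integrable g discArea) :
    Integrable (fun ζ => g ζ * conj (kern ω (conj z * ζ))) discArea ∧
    HasSum (fun n => (kernCoef ω n : ℂ) * z ^ n * ∫ ζ, g ζ * conj ζ ^ n ∂discArea)
      (∫ ζ, g ζ * conj (kern ω (conj z * ζ)) ∂discArea) := by
  have hz' : ‖z‖ < 1 := by rwa [disc, mem_ball_zero_iff] at hz
  constructor
  · refine hg.mul_bdd (c := ∑' n, kernCoef ω n * ‖z‖ ^ n) ?_ ?_
    · exact (Complex.continuous_conj.comp_continuousOn
        (hω.differentiableOn_kern_conj_mul hz).continuousOn).aestronglyMeasurable_discArea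
    · filter_upwards [ae_discArea_mem] with ζ hζ
      rw [RCLike.norm_conj]
      exact norm_kern_le hω (norm_conj_mul_le hζ) hz'
  · simp_rw [← integral_const_mul]
    refine hasSum_integral_of_dominated_convergence
      (fun n ζ => kernCoef ω n * ‖z‖ ^ n * ‖g ζ‖) (fun n => ?_) (fun n => ?_) ?_ ?_ ?_
    · exact (hg.1.mul (Complex.continuous_conj.pow n).aestronglyMeasurable).const_mul _
    · filter_upwards [ae_discArea_mem] with ζ hζ
      rw [disc, mem_ball_zero_iff] at hζ
      have := (hω.kernCoef_pos n).le
      simp only [norm_mul, norm_pow, Complex.norm_real, Real.norm_of_nonneg this, RCLike.norm_conj]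
      have h2 : ‖ζ‖ ^ n ≤ 1 := pow_le_one₀ (norm_nonneg _) hζ.le
      calc kernCoef ω n * ‖z‖ ^ n * (‖g ζ‖ * ‖ζ‖ ^ n)
          ≤ kernCoef ω n * ‖z‖ ^ n * (‖g ζ‖ * 1) := by gcongr
        _ = _ := by ring
    · exact ae_of_all _ fun ζ => (hω.summable_kernCoef (norm_nonneg z) hz').mul_right _
    · simp_rw [tsum_mul_right]
      exact hg.norm.const_mul _
    · filter_upwards [ae_discArea_mem] with ζ hζ
      have hs : Summable fun n => (kernCoef ω n : ℂ) * (conj z * ζ) ^ n := by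
        refine Summable.of_norm ?_
        have h3 := hω.summable_kernCoef (norm_nonneg (conj z * ζ)) (norm_conj_mul_lt hz hζ)
        refine h3.congr fun n => ?_
        rw [norm_mul (kernCoef ω n : ℂ), norm_pow, Complex.norm_real,
          Real.norm_of_nonneg (hω.kernCoef_pos n).le]
      have h4 := (Complex.hasSum_conj'.2 (by simpa [kern] using hs.hasSum) :
        HasSum (fun n => conj ((kernCoef ω n : ℂ) * (conj z * ζ) ^ n)) (conj (kern ω (conj z * ζ))))
      refine (h4.mul_left (g ζ)).congr_fun ?_
      intro n
      simp only [map_mul, map_pow, Complex.conj_conj, Complex.conj_ofReal]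
      ring

/-- The Taylor coefficients at the origin. -/
def taylorCoef (f : ℂ → ℂ) (n : ℕ) : ℂ := (n.factorial : ℂ)⁻¹ * iteratedDeriv n f 0

lemma hasSum_taylorCoef {f : ℂ → ℂ} (hf : DifferentiableOn ℂ f disc) {z : ℂ} (hz : z ∈ disc) :
    HasSum (fun n => taylorCoef f n * z ^ n) (f z) := by
  refine (Complex.hasSum_taylorSeries_on_ball hf hz).congr_fun fun n => ?_
  simp only [taylorCoef, smul_eq_mul, sub_zero]; ring

/-- The factor s of the area element raises the exponent by one; this is the origin of the moments n
+ 1 and 2n + 1. -/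
lemma integral_discArea_of_inner {F : ℂ → ℂ} (hF : Integrable F discArea) {h : ℝ → ℝ} {A : ℂ}
    {n : ℕ} (hA : ∀ s ∈ Ioo (0 : ℝ) 1, ∫ θ in (-Real.pi)..Real.pi, F (s * circ θ) =
      A * ((s ^ n * h s : ℝ) : ℂ)) :
    ∫ ζ, F ζ ∂discArea = (Real.pi : ℂ)⁻¹ * A * moment h ((n + 1 : ℕ) : ℝ) := by
  rw [integral_discArea hF]
  have h1 : ∫ s in (0 : ℝ)..1, s • ∫ θ in (-Real.pi)..Real.pi, F (s * circ θ) =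
      ∫ s in (0 : ℝ)..1, A * ((s ^ ((n + 1 : ℕ) : ℝ) * h s : ℝ) : ℂ) := by
    rw [intervalIntegral.integral_of_le zero_le_one, intervalIntegral.integral_of_le zero_le_one,
      integral_Ioc_eq_integral_Ioo, integral_Ioc_eq_integral_Ioo]
    refine setIntegral_congr_fun measurableSet_Ioo fun s hs => ?_
    rw [hA s hs, Real.rpow_natCast, Complex.real_smul]
    push_cast; ring
  rw [h1, intervalIntegral.integral_const_mul, intervalIntegral.integral_ofReal, Complex.real_smul,
    moment]
  push_cast; ring

lemma integrable_mul_conj_pow {g : ℂ → ℂ} (hg : Integrable g discArea) (n : ℕ) :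
    Integrable (fun ζ => g ζ * conj ζ ^ n) discArea := by
  refine hg.mul_bdd (c := 1) (Complex.continuous_conj.pow n).aestronglyMeasurable ?_
  filter_upwards [ae_discArea_mem] with ζ hζ
  rw [disc, mem_ball_zero_iff] at hζ
  rw [norm_pow, RCLike.norm_conj]
  exact pow_le_one₀ (norm_nonneg _) hζ.le

/-- Orthogonality on each circle isolates the n-th coefficient; sⁿ comes from the Taylor series, sⁿ
from the conjugate power. -/
lemma integral_mul_weight_mul_conj_pow {f : ℂ → ℂ} (hf : DifferentiableOn ℂ f disc)
    (hi : Integrable (fun ζ => f ζ * (ω ‖ζ‖ : ℂ)) discArea) (n : ℕ) :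
    ∫ ζ, f ζ * (ω ‖ζ‖ : ℂ) * conj ζ ^ n ∂discArea =
      2 * moment ω ((2 * n + 1 : ℕ) : ℝ) * taylorCoef f n := by
  rw [integral_discArea_of_inner (integrable_mul_conj_pow hi n) (h := ω) (n := 2 * n)
    (A := 2 * Real.pi * taylorCoef f n)]
  · have : (Real.pi : ℂ) ≠ 0 := by exact_mod_cast Real.pi_ne_zero
    field_simp
  intro s hs
  have hsd : (s : ℂ) ∈ disc := by
    rw [disc, mem_ball_zero_iff, Complex.norm_real, Real.norm_of_nonneg hs.1.le]; exact hs.2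
  have hsum : Summable fun m => ‖taylorCoef f m * (s : ℂ) ^ m‖ :=
    (hasSum_taylorCoef hf hsd).summable.norm
  have h1 := integral_tsum_mul_conj_pow hsum n
  have h2 : ∀ θ : ℝ, f (s * circ θ) * (ω ‖(s : ℂ) * circ θ‖ : ℂ) * conj ((s : ℂ) * circ θ) ^ n =
      (ω s * s ^ n : ℂ) * ((∑' m, taylorCoef f m * (s : ℂ) ^ m * circ θ ^ m) * conj (circ θ) ^ n) := by
    intro θ
    have hd : (s : ℂ) * circ θ ∈ disc := by
      rw [disc, mem_ball_zero_iff] at hsd ⊢; simpa using hsd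
    have h3 : ∑' m, taylorCoef f m * (s : ℂ) ^ m * circ θ ^ m = f (s * circ θ) := by
      rw [← (hasSum_taylorCoef hf hd).tsum_eq]
      exact tsum_congr fun m => by rw [mul_pow, mul_assoc]
    rw [h3, norm_mul, norm_circ, Complex.norm_real, Real.norm_of_nonneg hs.1.le, mul_one, map_mul,
      Complex.conj_ofReal, mul_pow]
    ring
  simp_rw [h2]
  rw [intervalIntegral.integral_const_mul, h1]
  push_cast
  ring

lemma MemBergman.integrable_mul_weight (hω : IsRadialWeight ω) {f : ℂ → ℂ} (hf : MemBergman ω f) :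
    Integrable (fun ζ => f ζ * (ω ‖ζ‖ : ℂ)) discArea := by
  have hw := integrable_weight_comp_norm hω.integrable
  have hwm : AEStronglyMeasurable (fun ζ : ℂ => (ω ‖ζ‖ : ℂ)) discArea :=
    Complex.continuous_ofReal.comp_aestronglyMeasurable hw.1
  refine (hf.2.add hw).mono' (hf.1.continuousOn.aestronglyMeasurable_discArea.mul hwm) ?_
  filter_upwards [ae_discArea_mem] with ζ hζ
  rw [disc, mem_ball_zero_iff] at hζ
  have h0 := hω.nonneg ‖ζ‖ ⟨norm_nonneg _, hζ⟩
  rw [norm_mul, Complex.norm_real, Real.norm_of_nonneg h0, Pi.add_apply]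
  nlinarith [sq_nonneg (‖f ζ‖ - 1), norm_nonneg (f ζ), mul_nonneg h0 (sq_nonneg (‖f ζ‖ - 1)),
    mul_nonneg h0 (norm_nonneg (f ζ))]

lemma memBergman_of_bounded (hω : IsRadialWeight ω) {f : ℂ → ℂ} (hf : DifferentiableOn ℂ f disc)
    {B : ℝ} (hB : ∀ ζ ∈ disc, ‖f ζ‖ ≤ B) : MemBergman ω f := by
  refine ⟨hf, (integrable_weight_comp_norm hω.integrable).bdd_mul (c := B ^ 2)
    (hf.continuousOn.norm.pow 2).aestronglyMeasurable_discArea ?_⟩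
  filter_upwards [ae_discArea_mem] with ζ hζ
  rw [norm_pow, norm_norm]
  exact pow_le_pow_left₀ (norm_nonneg _) (hB ζ hζ) 2

lemma kernCoef_mul_moment (hω : IsRadialWeight ω) (n : ℕ) :
    (kernCoef ω n : ℂ) * (2 * moment ω ((2 * n + 1 : ℕ) : ℝ)) = 1 := by
  have h := (hω.moment_pos (x := ((2 * n + 1 : ℕ) : ℝ)) (by positivity)).ne'
  have : kernCoef ω n * (2 * moment ω ((2 * n + 1 : ℕ) : ℝ)) = 1 :=
    inv_mul_cancel₀ (mul_ne_zero two_ne_zero h)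
  exact_mod_cast this

lemma isReproducingAt_kern (hω : IsRadialWeight ω) {z : ℂ} (hz : z ∈ disc) :
    IsReproducingAt ω z fun ζ => kern ω (conj z * ζ) := by
  have hz' : ‖z‖ < 1 := by rwa [disc, mem_ball_zero_iff] at hz
  refine ⟨memBergman_of_bounded hω (hω.differentiableOn_kern_conj_mul hz)
    fun ζ hζ => norm_kern_le hω (norm_conj_mul_le hζ) hz', fun f hf => ?_⟩
  have hi := hf.integrable_mul_weight hω
  have h1 := (hasSum_integral_mul_kern hω hz hi).2
  simp_rw [integral_mul_weight_mul_conj_pow hf.1 hi] at h1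
  have h2 := (hasSum_taylorCoef hf.1 hz).congr_fun (g := fun n => (kernCoef ω n : ℂ) * z ^ n *
      (2 * moment ω ((2 * n + 1 : ℕ) : ℝ) * taylorCoef f n)) fun n => by
    rw [show (kernCoef ω n : ℂ) * z ^ n * (2 * moment ω ((2 * n + 1 : ℕ) : ℝ) * taylorCoef f n) =
      ((kernCoef ω n : ℂ) * (2 * moment ω ((2 * n + 1 : ℕ) : ℝ))) * (taylorCoef f n * z ^ n) by
        ring, kernCoef_mul_moment hω, one_mul]
  rw [h2.unique h1]
  exact integral_congr_ae (ae_of_all _ fun ζ => by simp only; ring)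

/-- Reproducing the monomials determines all Taylor coefficients of a kernel, so the chosen kernel
is the explicit series on the disc. -/
lemma IsReproducingAt.eq_kern (hω : IsRadialWeight ω) {z : ℂ} {K : ℂ → ℂ}
    (hK : IsReproducingAt ω z K) {ζ : ℂ} (hζ : ζ ∈ disc) : K ζ = kern ω (conj z * ζ) := by
  have hi := hK.1.integrable_mul_weight hω
  have h1 : ∀ n, taylorCoef K n = kernCoef ω n * conj z ^ n := by
    intro n
    have hmem : MemBergman ω fun ζ => ζ ^ n := by
      refine memBergman_of_bounded hω (B := 1) (by fun_prop) fun ζ hζ => ?_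
      rw [disc, mem_ball_zero_iff] at hζ
      rw [norm_pow]; exact pow_le_one₀ (norm_nonneg _) hζ.le
    have h2 := congrArg conj (hK.2 _ hmem)
    rw [← integral_conj] at h2
    have h3 := integral_mul_weight_mul_conj_pow hK.1.1 hi n
    have h4 : ∫ ζ, conj (ζ ^ n * conj (K ζ) * (ω ‖ζ‖ : ℂ)) ∂discArea =
        ∫ ζ, K ζ * (ω ‖ζ‖ : ℂ) * conj ζ ^ n ∂discArea := by
      refine integral_congr_ae (ae_of_all _ fun ζ => ?_)
      simp only [map_mul, map_pow, Complex.conj_conj, Complex.conj_ofReal]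
      ring
    rw [h4, h3, map_pow] at h2
    rw [h2, ← mul_assoc, kernCoef_mul_moment hω, one_mul]
  rw [← (hasSum_taylorCoef hK.1.1 hζ).tsum_eq, kern]
  exact tsum_congr fun n => by rw [h1, mul_pow, mul_assoc]

lemma bergmanKernel_eq_kern (hω : IsRadialWeight ω) {z : ℂ} (hz : z ∈ disc) {ζ : ℂ}
    (hζ : ζ ∈ disc) : bergmanKernel ω z ζ = kern ω (conj z * ζ) := by
  have h : ∃ K, IsReproducingAt ω z K := ⟨_, isReproducingAt_kern hω hz⟩
  rw [bergmanKernel, dif_pos h]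
  exact (Classical.choose_spec h).eq_kern hω hζ

lemma projIntegrand_ae_eq (hω : IsRadialWeight ω) (f : ℂ → ℂ) {z : ℂ} (hz : z ∈ disc) :
    projIntegrand ω f z =ᵐ[discArea]
      fun ζ => f ζ * (ω ‖ζ‖ : ℂ) * conj (kern ω (conj z * ζ)) := by
  filter_upwards [ae_discArea_mem] with ζ hζ
  rw [projIntegrand, bergmanKernel_eq_kern hω hz hζ]; ring

lemma integrable_projIntegrand (hω : IsRadialWeight ω) {f : ℂ → ℂ}
    (hf : Integrable (fun ζ => f ζ * (ω ‖ζ‖ : ℂ)) discArea) {z : ℂ} (hz : z ∈ disc) :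
    Integrable (projIntegrand ω f z) discArea :=
  (hasSum_integral_mul_kern hω hz hf).1.congr (projIntegrand_ae_eq hω f hz).symm

/-- The power series of a Bergman projection. -/
lemma hasSum_bergmanProj (hω : IsRadialWeight ω) {f : ℂ → ℂ}
    (hf : Integrable (fun ζ => f ζ * (ω ‖ζ‖ : ℂ)) discArea) {z : ℂ} (hz : z ∈ disc) :
    HasSum (fun n => (kernCoef ω n : ℂ) * (∫ ζ, f ζ * (ω ‖ζ‖ : ℂ) * conj ζ ^ n ∂discArea) * z ^ n)
      (bergmanProj ω f z) := by
  rw [bergmanProj, integral_congr_ae (projIntegrand_ae_eq hω f hz)]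
  exact (hasSum_integral_mul_kern hω hz hf).2.congr_fun fun n => by ring

lemma differentiableOn_bergmanProj (hω : IsRadialWeight ω) {f : ℂ → ℂ}
    (hf : Integrable (fun ζ => f ζ * (ω ‖ζ‖ : ℂ)) discArea) :
    DifferentiableOn ℂ (bergmanProj ω f) disc := by
  refine (differentiableOn_tsum_disc (c := fun n => (kernCoef ω n : ℂ) *
    ∫ ζ, f ζ * (ω ‖ζ‖ : ℂ) * conj ζ ^ n ∂discArea) fun ρ h0 h1 => ?_).congr fun z hz =>
      (hasSum_bergmanProj hω hf hz).tsum_eq.symm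
  have hρ : (ρ : ℂ) ∈ disc := by
    rw [disc, mem_ball_zero_iff, Complex.norm_real, Real.norm_of_nonneg h0]; exact h1
  refine (hasSum_bergmanProj hω hf hρ).summable.norm.congr fun n => ?_
  rw [norm_mul _ ((ρ : ℂ) ^ n), norm_pow, Complex.norm_real, Real.norm_of_nonneg h0]

/-! ### An `L¹` estimate for the Bergman kernel of an upper doubling weight -/

lemma IsUpperDoubling.exists_moment_half_le (hω : IsUpperDoubling ω) :
    ∃ C : ℝ, 0 < C ∧ ∀ x, 2 ≤ x → moment ω (x / 2) ≤ C * moment ω x := by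
  obtain ⟨C, hC, h⟩ := hω.exists_moment_le_tail
  obtain ⟨b, hb⟩ := hω.exists_tail_le_pow
  refine ⟨C * 5 ^ b * Real.exp 2, by positivity, fun x hx => ?_⟩
  have hx0 : 0 < x := by linarith
  have hu : 1 / x ≤ 1 / 2 := one_div_le_one_div_of_le two_pos hx
  have hu0 : 0 < 1 / x := by positivity
  have e1 := h (x / 2) (by linarith)
  rw [show 1 / (x / 2) = 2 * (1 / x) by field_simp] at e1
  have e2 := hb (2 * (1 / x)) (1 / x) (by positivity) (by linarith) hu0 (by linarith)
  rw [show 1 + 2 * (2 * (1 / x)) / (1 / x) = 5 by field_simp; norm_num] at e2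
  have e3 := one_sub_rpow_ge hu0.le hu hx0.le
  rw [show 2 * (1 / x) * x = 2 by field_simp] at e3
  have e4 := hω.1.rpow_mul_tail_le_moment hx0.le (r := 1 - 1 / x) (by linarith) (by linarith)
  have hT := hω.1.tail_pos (1 - 1 / x) ⟨by linarith, by linarith⟩
  have e5 : tail ω (1 - 1 / x) ≤ Real.exp 2 * moment ω x := by
    calc tail ω (1 - 1 / x) = Real.exp 2 * (Real.exp (-2) * tail ω (1 - 1 / x)) := by
          rw [← mul_assoc, ← Real.exp_add]; simp
      _ ≤ Real.exp 2 * ((1 - 1 / x) ^ x * tail ω (1 - 1 / x)) := by gcongr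
      _ ≤ _ := by gcongr
  calc moment ω (x / 2) ≤ C * (5 ^ b * (Real.exp 2 * moment ω x)) := by
        refine e1.trans (mul_le_mul_of_nonneg_left (e2.trans ?_) hC.le)
        gcongr
    _ = _ := by ring

/-- In s^x - s^{x+2} = s^x(1-s)(1+s), half of the power pays for the factor x, since x s^{x/2}(1-s)
≤ 2. What is left is ω_{x/2}, which upper doubling compares with ω_x. -/
lemma IsUpperDoubling.exists_moment_sub_le (hω : IsUpperDoubling ω) :
    ∃ C : ℝ, 0 < C ∧ ∀ x, 2 ≤ x → x * (moment ω x - moment ω (x + 2)) ≤ C * moment ω x := by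
  obtain ⟨C, hC, h⟩ := hω.exists_moment_half_le
  have hw := hω.1
  refine ⟨4 * C, by positivity, fun x hx => ?_⟩
  have hx0 : 0 < x := by linarith
  have h01 : (0 : ℝ) ∈ Icc (0 : ℝ) 1 := by simp
  have h11 : (1 : ℝ) ∈ Icc (0 : ℝ) 1 := by simp
  suffices h1 : x * (moment ω x - moment ω (x + 2)) ≤ 4 * moment ω (x / 2) by
    linarith [h x hx]
  unfold moment
  rw [← intervalIntegral.integral_sub (hw.rpow_intervalIntegrable hx0.le h01 h11)
      (hw.rpow_intervalIntegrable (by positivity) h01 h11),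
    ← intervalIntegral.integral_const_mul, ← intervalIntegral.integral_const_mul]
  refine intervalIntegral.integral_mono_on_of_le_Ioo zero_le_one
    (((hw.rpow_intervalIntegrable hx0.le h01 h11).sub
      (hw.rpow_intervalIntegrable (by positivity) h01 h11)).const_mul _)
    ((hw.rpow_intervalIntegrable (by positivity) h01 h11).const_mul _) fun s hs => ?_
  have hω0 := hw.nonneg s ⟨hs.1.le, hs.2⟩
  have e1 : s ^ x = s ^ (x / 2) * s ^ (x / 2) := by rw [← Real.rpow_add hs.1]; congr 1; ring
  have e2 : s ^ (x + 2) = s ^ x * s ^ 2 := by rw [Real.rpow_add hs.1]; norm_num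
  have e3 : x * (s ^ (x / 2) * (1 - s)) ≤ 2 := by
    have h1 := one_sub_rpow_le (u := 1 - s) (x := x / 2) (by linarith [hs.1]) (by positivity)
    rw [sub_sub_cancel] at h1
    have h2 := Real.add_one_le_exp ((1 - s) * (x / 2))
    have h3 : Real.exp (-((1 - s) * (x / 2))) * ((1 - s) * (x / 2)) ≤ 1 := by
      rw [Real.exp_neg, inv_mul_le_iff₀ (Real.exp_pos _)]; linarith
    have h4 : 0 ≤ (1 - s) * (x / 2) := mul_nonneg (by linarith [hs.2]) (by positivity)
    have := (mul_le_mul_of_nonneg_right h1 h4).trans h3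
    linarith
  have hp : 0 ≤ s ^ (x / 2) * ω s := mul_nonneg (Real.rpow_nonneg hs.1.le _) hω0
  calc x * (s ^ x * ω s - s ^ (x + 2) * ω s)
      = x * (s ^ (x / 2) * (1 - s)) * ((1 + s) * (s ^ (x / 2) * ω s)) := by
        rw [e2, e1]; ring
    _ ≤ 2 * (2 * (s ^ (x / 2) * ω s)) := by
        refine mul_le_mul e3 ?_ (mul_nonneg (by linarith [hs.1]) hp) two_pos.le
        exact mul_le_mul_of_nonneg_right (by linarith [hs.2]) hp
    _ = _ := by ring

/-- The Taylor coefficients of the derivative of `kern ω`. -/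
def kernDerivCoef (ω : ℝ → ℝ) (n : ℕ) : ℝ := (n + 1) * kernCoef ω (n + 1)

/-- Differencing removes the factor n + 1 brought in by the derivative: the relative change of
consecutive odd moments is O(1/n). -/
lemma IsUpperDoubling.exists_abs_kernDerivCoef_sub_le (hω : IsUpperDoubling ω) :
    ∃ C : ℝ, 1 ≤ C ∧ ∀ n, |kernDerivCoef ω (n + 1) - kernDerivCoef ω n| ≤
      C * kernCoef ω (n + 2) := by
  obtain ⟨C, hC, h⟩ := hω.exists_moment_sub_le
  refine ⟨1 + C, by linarith, fun n => ?_⟩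
  have hx := h ((2 * (n + 1) + 1 : ℕ) : ℝ) (by exact_mod_cast (by omega : 2 ≤ 2 * (n + 1) + 1))
  rw [show (((2 * (n + 1) + 1 : ℕ) : ℝ) + 2) = ((2 * (n + 2) + 1 : ℕ) : ℝ) by push_cast; ring] at hx
  have p1 := hω.1.moment_pos (x := ((2 * (n + 1) + 1 : ℕ) : ℝ)) (by positivity)
  have p2 := hω.1.moment_pos (x := ((2 * (n + 2) + 1 : ℕ) : ℝ)) (by positivity)
  have p3 := hω.1.moment_anti (x := ((2 * (n + 1) + 1 : ℕ) : ℝ))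
    (y := ((2 * (n + 2) + 1 : ℕ) : ℝ)) (by positivity) (by exact_mod_cast (by omega))
  unfold kernDerivCoef kernCoef
  set m₁ := moment ω ((2 * (n + 1) + 1 : ℕ) : ℝ)
  set m₂ := moment ω ((2 * (n + 2) + 1 : ℕ) : ℝ)
  have e1 : ((n + 1 : ℕ) + 1 : ℝ) * (2 * m₂)⁻¹ - ((n : ℝ) + 1) * (2 * m₁)⁻¹ =
      (2 * m₂)⁻¹ * (1 + (n + 1) * (m₁ - m₂) / m₁) := by
    push_cast; field_simp; ring
  have e2 : (n + 1) * (m₁ - m₂) / m₁ ≤ C := by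
    rw [div_le_iff₀ p1]
    refine le_trans ?_ hx
    refine mul_le_mul_of_nonneg_right ?_ (by linarith)
    push_cast; nlinarith [(Nat.cast_nonneg n : (0 : ℝ) ≤ n)]
  have e3 : 0 ≤ (n + 1) * (m₁ - m₂) / m₁ :=
    div_nonneg (mul_nonneg (by positivity) (by linarith)) p1.le
  rw [e1, abs_of_nonneg (mul_nonneg (by positivity) (by linarith)),
    mul_comm]
  gcongr

lemma IsUpperDoubling.exists_kernCoef_le (hω : IsUpperDoubling ω) :
    ∃ b : ℕ, ∀ (n : ℕ) (t : ℝ), 0 ≤ t → t < 1 →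
      kernCoef ω (n + 1) ≤ Real.exp 2 * (1 + 2 * (1 - t) * (2 * n + 3)) ^ b / tail ω t := by
  obtain ⟨b, hb⟩ := hω.exists_tail_le_pow
  refine ⟨b, fun n t ht ht1 => ?_⟩
  set x : ℝ := ((2 * (n + 1) + 1 : ℕ) : ℝ) with hx
  have hxn : x = 2 * n + 3 := by rw [hx]; push_cast; ring
  have hx2 : 2 ≤ x := by rw [hxn]; linarith [(Nat.cast_nonneg n : (0 : ℝ) ≤ n)]
  have hx0 : 0 < x := by linarith
  have hu : 1 / x ≤ 1 / 2 := one_div_le_one_div_of_le two_pos hx2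
  have hu0 : 0 < 1 / x := by positivity
  have e2 := hb (1 - t) (1 / x) (by linarith) (by linarith) hu0 (by linarith)
  rw [sub_sub_cancel, show 2 * (1 - t) / (1 / x) = 2 * (1 - t) * x by field_simp] at e2
  have e3 := one_sub_rpow_ge hu0.le hu hx0.le
  rw [show 2 * (1 / x) * x = 2 by field_simp] at e3
  have e4 := hω.1.rpow_mul_tail_le_moment hx0.le (r := 1 - 1 / x) (by linarith) (by linarith)
  have hT := hω.1.tail_pos (1 - 1 / x) ⟨by linarith, by linarith⟩
  have hTt := hω.1.tail_pos t ⟨ht, ht1⟩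
  have hm := hω.1.moment_pos hx0.le
  rw [kernCoef, ← hx, ← hxn]
  have hp : 0 ≤ 1 + 2 * (1 - t) * x := by nlinarith
  rw [le_div_iff₀ hTt, inv_mul_le_iff₀ (by positivity)]
  calc tail ω t ≤ (1 + 2 * (1 - t) * x) ^ b * tail ω (1 - 1 / x) := e2
    _ = (1 + 2 * (1 - t) * x) ^ b * (Real.exp 2 * (Real.exp (-2) * tail ω (1 - 1 / x))) := by
        rw [← mul_assoc (Real.exp 2), ← Real.exp_add]; simp
    _ ≤ (1 + 2 * (1 - t) * x) ^ b * (Real.exp 2 * moment ω x) := by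
        refine mul_le_mul_of_nonneg_left ?_ (pow_nonneg hp b)
        refine mul_le_mul_of_nonneg_left (le_trans ?_ e4) (Real.exp_pos _).le
        exact mul_le_mul_of_nonneg_right e3 hT.le
    _ ≤ (1 + 2 * (1 - t) * x) ^ b * (Real.exp 2 * moment ω x) * 2 := by
        have : 0 ≤ (1 + 2 * (1 - t) * x) ^ b * (Real.exp 2 * moment ω x) := by positivity
        linarith
    _ = _ := by ring

/-- Of the decay t^{2n} ≤ e^{-2n(1-t)}, one half absorbs the polynomial in n(1-t) and the other half
remains as a geometric sequence with sum of order 1/(1-t). -/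
lemma exists_pow_mul_pow_le (m : ℕ) :
    ∃ M : ℝ, 0 < M ∧ ∀ (n : ℕ) (t : ℝ), 0 ≤ t → t ≤ 1 →
      (1 + 2 * (1 - t) * (2 * n + 3)) ^ m * (t ^ n) ^ 2 ≤ M * Real.exp (-(1 - t)) ^ n := by
  refine ⟨4 ^ m * m.factorial * Real.exp 2, by positivity, fun n t ht ht1 => ?_⟩
  set y : ℝ := 1 + 2 * (1 - t) * (2 * n + 3) with hy
  have hn : (0 : ℝ) ≤ n := Nat.cast_nonneg n
  have hy0 : 0 ≤ y := by
    have : 0 ≤ (1 - t) * (2 * n + 3) := mul_nonneg (by linarith) (by linarith)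
    linarith
  have h1 := Real.pow_div_factorial_le_exp (x := y / 4) (by positivity) m
  rw [div_le_iff₀ (by positivity), div_pow, div_le_iff₀ (by positivity)] at h1
  have h2 : t ≤ Real.exp (-(1 - t)) := by have := Real.add_one_le_exp (-(1 - t)); linarith
  have h3 : (t ^ n) ^ 2 ≤ Real.exp (-(1 - t)) ^ n * Real.exp (-(1 - t)) ^ n := by
    rw [sq]; gcongr
  -- The divisor 4 makes the n-dependence of y/4 exactly n(1-t), which cancels; the remaining
  -- exponent is at most 7/4.
  have h4 : Real.exp (y / 4) * Real.exp (-(1 - t)) ^ n ≤ Real.exp 2 := by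
    rw [← Real.exp_nat_mul, ← Real.exp_add]
    refine Real.exp_le_exp.2 ?_
    rw [hy]; nlinarith
  calc y ^ m * (t ^ n) ^ 2
      ≤ (Real.exp (y / 4) * m.factorial * 4 ^ m) *
        (Real.exp (-(1 - t)) ^ n * Real.exp (-(1 - t)) ^ n) := by gcongr
    _ = 4 ^ m * m.factorial * (Real.exp (y / 4) * Real.exp (-(1 - t)) ^ n) *
        Real.exp (-(1 - t)) ^ n := by ring
    _ ≤ _ := by gcongr

lemma hasSum_exp_neg_pow {y : ℝ} (hy : 0 < y) :
    HasSum (fun n : ℕ => Real.exp (-y) ^ n) (1 - Real.exp (-y))⁻¹ :=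
  hasSum_geometric_of_lt_one (Real.exp_pos _).le (by simpa using hy)

lemma inv_one_sub_exp_neg_le {y : ℝ} (hy : 0 < y) (hy1 : y ≤ 1) :
    (1 - Real.exp (-y))⁻¹ ≤ 2 / y := by
  rw [inv_le_comm₀ (by simpa using hy) (by positivity), inv_div]
  have h1 : Real.exp (-y) ≤ 1 / (1 + y) := by
    rw [Real.exp_neg, ← one_div]
    exact one_div_le_one_div_of_le (by linarith) (by linarith [Real.add_one_le_exp y])
  have h2 : 1 / (1 + y) ≤ 1 - y / 2 := by
    rw [div_le_iff₀ (by linarith)]; nlinarith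
  linarith

lemma IsRadialWeight.summable_kernDerivCoef (hω : IsRadialWeight ω) {ρ : ℝ} (h0 : 0 ≤ ρ)
    (h1 : ρ < 1) : Summable fun n => ‖(kernDerivCoef ω n : ℂ)‖ * ρ ^ n := by
  set r := (1 + ρ) / 2 with hr
  have hr0 : 0 < r := by positivity
  have hr1 : r < 1 := by linarith
  have hq : (r ^ 2)⁻¹ * ρ < 1 := by
    rw [inv_mul_lt_iff₀ (by positivity), mul_one, hr]
    nlinarith [mul_pos (sub_pos.2 h1) (sub_pos.2 h1)]
  have hq0 : 0 ≤ (r ^ 2)⁻¹ * ρ := by positivity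
  have hs1 : Summable fun n : ℕ => ((n : ℝ) + 1) * ((r ^ 2)⁻¹ * ρ) ^ n := by
    have e1 := summable_pow_mul_geometric_of_norm_lt_one 1
      (by rwa [Real.norm_of_nonneg hq0] : ‖(r ^ 2)⁻¹ * ρ‖ < 1)
    have e2 := e1.add (summable_geometric_of_lt_one hq0 hq)
    refine e2.congr fun n => ?_
    simp; ring
  have hTr := hω.tail_pos r ⟨hr0.le, hr1⟩
  refine Summable.of_nonneg_of_le (fun n => by positivity) (fun n => ?_)
    (hs1.mul_left ((2 * r * tail ω r)⁻¹ * (r ^ 2)⁻¹))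
  have hp := (hω.kernCoef_pos (n + 1)).le
  have hk := hω.kernCoef_le (n + 1) hr0 hr1
  rw [Complex.norm_real, kernDerivCoef, Real.norm_of_nonneg (by positivity)]
  calc (n + 1 : ℝ) * kernCoef ω (n + 1) * ρ ^ n
      ≤ (n + 1 : ℝ) * ((2 * r * tail ω r)⁻¹ * (r ^ 2)⁻¹ ^ (n + 1)) * ρ ^ n := by gcongr
    _ = _ := by rw [pow_succ, mul_pow]; ring

/-- The derivative of `kern ω`, as a power series. -/
def kernDeriv (ω : ℝ → ℝ) (w : ℂ) : ℂ := ∑' n, (kernDerivCoef ω n : ℂ) * w ^ n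

/-- The coefficient differences are dominated by kernel coefficients, which are 1/ω̂(t) up to powers
of 1 + n(1-t). Weighted by tⁿ, their ℓ² norm is at most a constant times 1/(ω̂(t)√(1-t)), as the L¹
bound for power series requires. -/
lemma IsUpperDoubling.exists_integral_norm_kernDeriv_le (hω : IsUpperDoubling ω) :
    ∃ C : ℝ, 0 < C ∧ ∀ w : ℂ, ‖w‖ < 1 →
      ∫ θ in (-Real.pi)..Real.pi, ‖kernDeriv ω (w * circ θ)‖ ≤
        C / ((1 - ‖w‖) * tail ω ‖w‖) := by
  obtain ⟨C₁, hC₁, h1⟩ := hω.exists_abs_kernDerivCoef_sub_le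
  obtain ⟨b, hb⟩ := hω.exists_kernCoef_le
  obtain ⟨M, hM, h2⟩ := exists_pow_mul_pow_le (b * 2)
  have hC₁0 : 0 < C₁ := by linarith
  refine ⟨2 * Real.pi * (C₁ * Real.exp 2 * Real.sqrt (2 * M)), by positivity, fun w hw => ?_⟩
  set t := ‖w‖ with ht
  have ht0 : 0 ≤ t := norm_nonneg w
  have hT := hω.1.tail_pos t ⟨ht0, hw⟩
  set B := C₁ * Real.exp 2 * Real.sqrt (2 * M) / tail ω t with hB
  have hBp : 0 < B := by positivity
  set D := C₁ * Real.exp 2 / tail ω t with hD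
  -- The zeroth difference is the zeroth coefficient itself, as if the sequence were preceded by 0.
  set e : ℕ → ℂ := fun n => Nat.casesOn n (kernDerivCoef ω 0 : ℂ)
    fun k => (kernDerivCoef ω (k + 1) : ℂ) - kernDerivCoef ω k with he
  have hen : ∀ n, ‖e n‖ ≤ C₁ * kernCoef ω (n + 1) := by
    intro n
    cases n with
    | zero =>
      have hp := hω.1.kernCoef_pos 1
      change ‖(kernDerivCoef ω 0 : ℂ)‖ ≤ _
      rw [Complex.norm_real, kernDerivCoef]
      simp only [Nat.cast_zero, zero_add, one_mul]
      rw [Real.norm_of_nonneg hp.le]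
      nlinarith
    | succ k =>
      change ‖(kernDerivCoef ω (k + 1) : ℂ) - kernDerivCoef ω k‖ ≤ _
      rw [← Complex.ofReal_sub, Complex.norm_real, Real.norm_eq_abs]
      exact h1 k
  have hsum := hasSum_exp_neg_pow (y := 1 - t) (by linarith)
  have key := integral_norm_tsum_le (d := fun n => (kernDerivCoef ω n : ℂ)) hw
    (hω.1.summable_kernDerivCoef ht0 hw) hBp (e := e) rfl (fun n => rfl)
    (E := fun n => D ^ 2 * (M * Real.exp (-(1 - t)) ^ n)) ?_
    ((hsum.summable.mul_left M).mul_left (D ^ 2)) ?_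
  · refine (le_of_eq_of_le rfl key).trans (le_of_eq ?_)
    rw [hB, ← ht]; field_simp
  · intro n
    have h3 := hb n t ht0 hw
    have hy : 0 ≤ 1 + 2 * (1 - t) * (2 * n + 3) := by
      have : 0 ≤ (1 - t) * (2 * n + 3) := mul_nonneg (by linarith) (by positivity)
      linarith
    have h4 : ‖e n‖ ≤ D * (1 + 2 * (1 - t) * (2 * n + 3)) ^ b := by
      refine (hen n).trans ((mul_le_mul_of_nonneg_left h3 hC₁0.le).trans (le_of_eq ?_))
      rw [hD]; ring
    calc (‖e n‖ * ‖w‖ ^ n) ^ 2 ≤ (D * (1 + 2 * (1 - t) * (2 * n + 3)) ^ b * t ^ n) ^ 2 := by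
          gcongr
      _ = D ^ 2 * ((1 + 2 * (1 - t) * (2 * n + 3)) ^ (b * 2) * (t ^ n) ^ 2) := by
          rw [pow_mul]; ring
      _ ≤ _ := mul_le_mul_of_nonneg_left (h2 n t ht0 hw.le) (by positivity)
  · rw [tsum_mul_left, tsum_mul_left, hsum.tsum_eq]
    have h5 := inv_one_sub_exp_neg_le (y := 1 - t) (by linarith) (by linarith)
    calc D ^ 2 * (M * (1 - Real.exp (-(1 - t)))⁻¹) ≤ D ^ 2 * (M * (2 / (1 - t))) := by gcongr
      _ = (D * Real.sqrt (2 * M)) ^ 2 / (1 - t) := by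
          rw [mul_pow, Real.sq_sqrt (by positivity)]; ring
      _ = _ := by rw [hD, hB]; ring

lemma IsRadialWeight.continuousOn_kernDeriv (hω : IsRadialWeight ω) :
    ContinuousOn (kernDeriv ω) disc :=
  (differentiableOn_tsum_disc fun _ h0 h1 => hω.summable_kernDerivCoef h0 h1).continuousOn

lemma kern_eq_add_integral (hω : IsRadialWeight ω) {v : ℂ} (hv : ‖v‖ < 1) :
    kern ω v = kernCoef ω 0 + ∫ t in (0 : ℝ)..1, v * kernDeriv ω (t * v) := by
  have hs : Summable fun n => (kernCoef ω n : ℂ) * v ^ n := by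
    refine Summable.of_norm ?_
    simpa [abs_of_pos (hω.kernCoef_pos _)] using hω.summable_kernCoef (norm_nonneg v) hv
  have hd := hω.summable_kernDerivCoef (norm_nonneg v) hv
  have h1 : HasSum (fun n => ∫ t in (0 : ℝ)..1, v * ((kernDerivCoef ω n : ℂ) * (t * v) ^ n))
      (∫ t in (0 : ℝ)..1, v * kernDeriv ω (t * v)) := by
    refine intervalIntegral.hasSum_integral_of_dominated_convergence
      (fun n _ => ‖v‖ * (‖(kernDerivCoef ω n : ℂ)‖ * ‖v‖ ^ n)) (fun n => ?_) (fun n => ?_) ?_ ?_ ?_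
    · exact (Continuous.aestronglyMeasurable (by fun_prop))
    · refine ae_of_all _ fun t ht => ?_
      rw [uIoc_of_le zero_le_one] at ht
      have h5 : ‖(t : ℂ) * v‖ ≤ ‖v‖ := by
        rw [norm_mul, Complex.norm_real, Real.norm_of_nonneg ht.1.le]
        exact mul_le_of_le_one_left (norm_nonneg _) ht.2
      rw [norm_mul, norm_mul, norm_pow]
      gcongr
    · exact ae_of_all _ fun t _ => hd.mul_left _
    · exact intervalIntegrable_const
    · refine ae_of_all _ fun t ht => ?_
      rw [uIoc_of_le zero_le_one] at ht
      have hs' : Summable fun n => (kernDerivCoef ω n : ℂ) * (t * v) ^ n := by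
        refine Summable.of_norm_bounded hd fun n => ?_
        have h5 : ‖(t : ℂ) * v‖ ≤ ‖v‖ := by
          rw [norm_mul, Complex.norm_real, Real.norm_of_nonneg ht.1.le]
          exact mul_le_of_le_one_left (norm_nonneg _) ht.2
        rw [norm_mul, norm_pow]
        gcongr
      exact hs'.hasSum.mul_left v
  have h2 : ∀ n : ℕ, ∫ t in (0 : ℝ)..1, v * ((kernDerivCoef ω n : ℂ) * (t * v) ^ n) =
      (kernCoef ω (n + 1) : ℂ) * v ^ (n + 1) := by
    intro n
    have h3 : ∀ t : ℝ, v * ((kernDerivCoef ω n : ℂ) * (t * v) ^ n) =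
        (v ^ (n + 1) * kernDerivCoef ω n) * ((t ^ n : ℝ) : ℂ) := by
      intro t; push_cast; ring
    simp_rw [h3]
    rw [intervalIntegral.integral_const_mul, intervalIntegral.integral_ofReal, integral_pow,
      kernDerivCoef]
    have : ((n : ℂ) + 1) ≠ 0 := by exact_mod_cast n.succ_ne_zero
    push_cast
    simp
    field_simp
  simp_rw [h2] at h1
  rw [← h1.tsum_eq, kern, hs.tsum_eq_zero_add]
  simp

/-- The majorant `∫_0^ρ dt / ((1-t) ω̂(t))` of the `L¹` means of the kernel. -/
def kernMajorant (ω : ℝ → ℝ) (ρ : ℝ) : ℝ := ∫ t in (0 : ℝ)..ρ, 1 / ((1 - t) * tail ω t)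

lemma IsRadialWeight.continuousOn_majorant_integrand (hω : IsRadialWeight ω) :
    ContinuousOn (fun t => 1 / ((1 - t) * tail ω t)) (Ico 0 1) := by
  refine continuousOn_const.div ((by fun_prop : Continuous fun t : ℝ => 1 - t).continuousOn.mul
    (hω.tail_continuousOn.mono Ico_subset_Icc_self)) fun t ht => ?_
  exact (mul_pos (by linarith [ht.2]) (hω.tail_pos t ht)).ne'

lemma IsRadialWeight.intervalIntegrable_majorant (hω : IsRadialWeight ω) {a b : ℝ}
    (ha : a ∈ Ico (0 : ℝ) 1) (hb : b ∈ Ico (0 : ℝ) 1) :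
    IntervalIntegrable (fun t => 1 / ((1 - t) * tail ω t)) volume a b := by
  refine (hω.continuousOn_majorant_integrand.mono fun t ht => ?_).intervalIntegrable
  exact (ordConnected_Ico (a := (0 : ℝ)) (b := 1)).uIcc_subset ha hb ht

lemma IsRadialWeight.kernMajorant_sub (hω : IsRadialWeight ω) {a b : ℝ}
    (ha : a ∈ Ico (0 : ℝ) 1) (hb : b ∈ Ico (0 : ℝ) 1) :
    kernMajorant ω b - kernMajorant ω a = ∫ t in a..b, 1 / ((1 - t) * tail ω t) :=
  intervalIntegral.integral_interval_sub_left
    (hω.intervalIntegrable_majorant (by simp) hb) (hω.intervalIntegrable_majorant (by simp) ha)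

lemma IsRadialWeight.kernMajorant_mono (hω : IsRadialWeight ω) {a b : ℝ} (ha : 0 ≤ a)
    (hab : a ≤ b) (hb : b < 1) : kernMajorant ω a ≤ kernMajorant ω b := by
  have h1 := hω.kernMajorant_sub (a := a) (b := b) ⟨ha, by linarith⟩ ⟨by linarith, hb⟩
  have h2 : 0 ≤ ∫ t in a..b, 1 / ((1 - t) * tail ω t) := by
    refine intervalIntegral.integral_nonneg hab fun t ht => ?_
    have := hω.tail_pos t ⟨ha.trans ht.1, by linarith [ht.2]⟩
    exact one_div_nonneg.2 (mul_nonneg (by linarith [ht.2]) this.le)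
  linarith

lemma IsRadialWeight.kernMajorant_sub_le (hω : IsRadialWeight ω) {a b : ℝ} (ha : 0 ≤ a)
    (hab : a ≤ b) (hb : b < 1) :
    kernMajorant ω b - kernMajorant ω a ≤ (b - a) * (1 / ((1 - b) * tail ω b)) := by
  rw [hω.kernMajorant_sub ⟨ha, by linarith⟩ ⟨by linarith, hb⟩]
  have hTb := hω.tail_pos b ⟨by linarith, hb⟩
  have h1 : ∫ t in a..b, 1 / ((1 - t) * tail ω t) ≤ ∫ t in a..b, 1 / ((1 - b) * tail ω b) := by
    refine intervalIntegral.integral_mono_on hab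
      (hω.intervalIntegrable_majorant ⟨ha, by linarith⟩ ⟨by linarith, hb⟩)
      intervalIntegrable_const fun t ht => ?_
    have h2 := hω.tail_anti (ha.trans ht.1) ht.2 hb.le
    refine one_div_le_one_div_of_le (mul_pos (by linarith) hTb) ?_
    exact mul_le_mul (by linarith [ht.2]) h2 hTb.le (by linarith [ht.2])
  rwa [intervalIntegral.integral_const, smul_eq_mul] at h1

lemma IsRadialWeight.continuousOn_kernMajorant (hω : IsRadialWeight ω) {R : ℝ} (hR : 0 ≤ R)
    (hR1 : R < 1) : ContinuousOn (kernMajorant ω) (Icc 0 R) := by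
  have := intervalIntegral.continuousOn_primitive_interval (μ := volume) (a := 0) (b := R)
    (f := fun t => 1 / ((1 - t) * tail ω t)) (by
      rw [uIcc_of_le hR]
      exact (hω.continuousOn_majorant_integrand.mono
        fun t ht => ⟨ht.1, ht.2.trans_lt hR1⟩).integrableOn_Icc)
  rwa [uIcc_of_le hR] at this

/-- The kernel is recovered from its derivative along the radius; exchanging the integrals leaves
the L¹ bound for the derivative, integrated over the circles of radius at most |w|. -/
lemma IsUpperDoubling.exists_integral_norm_kern_le (hω : IsUpperDoubling ω) :
    ∃ C : ℝ, 0 < C ∧ ∀ w : ℂ, ‖w‖ < 1 →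
      ∫ θ in (-Real.pi)..Real.pi, ‖kern ω (w * circ θ)‖ ≤ C * (1 + kernMajorant ω ‖w‖) := by
  obtain ⟨C, hC, h⟩ := hω.exists_integral_norm_kernDeriv_le
  have hw := hω.1
  have hpi : -Real.pi ≤ Real.pi := by linarith [Real.pi_pos]
  have hk0 := hw.kernCoef_pos 0
  refine ⟨max (2 * Real.pi * kernCoef ω 0) C, lt_max_of_lt_right hC, fun w hw1 => ?_⟩
  set ρ := ‖w‖ with hρ
  have hρ0 : 0 ≤ ρ := norm_nonneg w
  have hmem : ∀ t ∈ Icc (0 : ℝ) 1, ∀ θ, (t : ℂ) * (w * circ θ) ∈ disc := by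
    intro t ht θ
    rw [disc, mem_ball_zero_iff, norm_mul, norm_mul, norm_circ, mul_one, Complex.norm_real,
      Real.norm_of_nonneg ht.1]
    nlinarith [ht.2]
  have hcont : ContinuousOn (fun p : ℝ × ℝ => ρ * ‖kernDeriv ω ((p.2 : ℂ) * (w * circ p.1))‖)
      (univ ×ˢ Icc (0 : ℝ) 1) := by
    refine continuousOn_const.mul (ContinuousOn.norm (hw.continuousOn_kernDeriv.comp ?_ ?_))
    · have := continuous_circ
      exact Continuous.continuousOn (by fun_prop)
    · intro p hp; exact hmem p.2 hp.2 p.1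
  have hpt : ∀ θ : ℝ, ‖kern ω (w * circ θ)‖ ≤ kernCoef ω 0 +
      ∫ t in (0 : ℝ)..1, ρ * ‖kernDeriv ω (t * (w * circ θ))‖ := by
    intro θ
    rw [kern_eq_add_integral hw (by simpa using hw1)]
    refine (norm_add_le _ _).trans (add_le_add ?_ ?_)
    · rw [Complex.norm_real, Real.norm_of_nonneg hk0.le]
    · refine (intervalIntegral.norm_integral_le_integral_norm zero_le_one).trans (le_of_eq ?_)
      refine intervalIntegral.integral_congr fun t _ => ?_
      simp only [norm_mul, norm_circ, mul_one, ← hρ]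
  have hprod : IntegrableOn (Function.uncurry fun θ t : ℝ =>
      ρ * ‖kernDeriv ω (t * (w * circ θ))‖) (uIoc (-Real.pi) Real.pi ×ˢ uIoc (0 : ℝ) 1) := by
    rw [uIoc_of_le hpi, uIoc_of_le zero_le_one]
    refine (ContinuousOn.integrableOn_compact (isCompact_Icc.prod isCompact_Icc)
      (hcont.mono (prod_mono (subset_univ (Icc (-Real.pi) Real.pi)) subset_rfl))).mono_set ?_
    exact prod_mono Ioc_subset_Icc_self Ioc_subset_Icc_self
  have hinner : IntervalIntegrable
      (fun θ => ∫ t in (0 : ℝ)..1, ρ * ‖kernDeriv ω (t * (w * circ θ))‖) volume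
      (-Real.pi) Real.pi := by
    rw [intervalIntegrable_iff, IntegrableOn]
    simp_rw [intervalIntegral.integral_of_le (zero_le_one' ℝ)]
    rw [IntegrableOn, Measure.volume_eq_prod, ← Measure.prod_restrict,
      uIoc_of_le (zero_le_one' ℝ)] at hprod
    exact hprod.integral_prod_left
  have hkc : ContinuousOn (fun θ => ‖kern ω (w * circ θ)‖) (uIcc (-Real.pi) Real.pi) := by
    refine (hw.differentiableOn_kern.continuousOn.comp
      (continuous_const.mul continuous_circ).continuousOn fun θ _ => ?_).norm
    simpa using hmem 1 (by simp) θ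
  have hTt : ∀ t ∈ Icc (0 : ℝ) 1, ρ * t ∈ Ico (0 : ℝ) 1 := fun t ht =>
    ⟨mul_nonneg hρ0 ht.1, by nlinarith [ht.1, ht.2]⟩
  have hgc : ContinuousOn (fun t => ρ * (C * (1 / ((1 - ρ * t) * tail ω (ρ * t)))))
      (uIcc (0 : ℝ) 1) := by
    rw [uIcc_of_le zero_le_one]
    exact continuousOn_const.mul (continuousOn_const.mul
      (hw.continuousOn_majorant_integrand.comp (by fun_prop) hTt))
  calc ∫ θ in (-Real.pi)..Real.pi, ‖kern ω (w * circ θ)‖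
      ≤ ∫ θ in (-Real.pi)..Real.pi, (kernCoef ω 0 +
        ∫ t in (0 : ℝ)..1, ρ * ‖kernDeriv ω (t * (w * circ θ))‖) :=
        intervalIntegral.integral_mono_on hpi hkc.intervalIntegrable
          (intervalIntegrable_const.add hinner) fun θ _ => hpt θ
    _ = 2 * Real.pi * kernCoef ω 0 + ∫ t in (0 : ℝ)..1, ∫ θ in (-Real.pi)..Real.pi,
        ρ * ‖kernDeriv ω (t * (w * circ θ))‖ := by
        rw [intervalIntegral.integral_add intervalIntegrable_const hinner,
          intervalIntegral_intervalIntegral_swap hprod, intervalIntegral.integral_const, smul_eq_mul]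
        ring
    _ ≤ 2 * Real.pi * kernCoef ω 0 +
        ∫ t in (0 : ℝ)..1, ρ * (C * (1 / ((1 - ρ * t) * tail ω (ρ * t)))) := by
        refine add_le_add_right ?_ _
        rw [intervalIntegral.integral_of_le zero_le_one, intervalIntegral.integral_of_le zero_le_one]
        refine integral_mono_of_nonneg (ae_of_all _ fun t =>
          intervalIntegral.integral_nonneg hpi fun θ _ => by positivity) ?_ ?_
        · have := hgc.intervalIntegrable (μ := volume)
          rwa [intervalIntegrable_iff, uIoc_of_le zero_le_one] at this
        · filter_upwards [ae_restrict_mem measurableSet_Ioc] with t ht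
          have hn : ‖(t : ℂ) * w‖ = ρ * t := by
            rw [norm_mul, Complex.norm_real, Real.norm_of_nonneg ht.1.le, mul_comm]
          have h1 := h ((t : ℂ) * w) (by rw [hn]; exact (hTt t ⟨ht.1.le, ht.2⟩).2)
          rw [hn] at h1
          simp_rw [mul_assoc] at h1
          rw [intervalIntegral.integral_const_mul]
          refine mul_le_mul_of_nonneg_left (h1.trans (le_of_eq (by rw [mul_one_div]))) hρ0
    _ = 2 * Real.pi * kernCoef ω 0 + C * kernMajorant ω ρ := by
        congr 1
        have e1 := intervalIntegral.mul_integral_comp_mul_left (a := 0) (b := 1)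
          (f := fun t => 1 / ((1 - t) * tail ω t)) ρ
        rw [mul_zero, mul_one] at e1
        rw [kernMajorant, ← e1, intervalIntegral.integral_const_mul,
          intervalIntegral.integral_const_mul]
        ring
    _ ≤ _ := by
        have hG : 0 ≤ kernMajorant ω ρ := by
          have := hw.kernMajorant_mono le_rfl hρ0 hw1
          simpa [kernMajorant] using this
        have e1 := le_max_left (2 * Real.pi * kernCoef ω 0) C
        have e2 := le_max_right (2 * Real.pi * kernCoef ω 0) C
        nlinarith

/-! ### Sufficiency -/

/-- The integral of the truncated majorant against a weight. -/
def majorantIntegral (ω σ : ℝ → ℝ) (R : ℝ) : ℝ :=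
  ∫ s in (0 : ℝ)..1, σ s * kernMajorant ω (min s R)

lemma continuousOn_kernMajorant_min (hω : IsRadialWeight ω) {R : ℝ} (hR : R ∈ Ico (0 : ℝ) 1) :
    ContinuousOn (fun s => kernMajorant ω (min s R)) (Icc 0 1) :=
  (hω.continuousOn_kernMajorant hR.1 hR.2).comp (by fun_prop)
    fun _ hs => ⟨le_min hs.1 hR.1, min_le_right _ _⟩

lemma intervalIntegrable_mul_kernMajorant {σ : ℝ → ℝ} (hω : IsRadialWeight ω)
    (hσ : IsRadialWeight σ) {R : ℝ} (hR : R ∈ Ico (0 : ℝ) 1) {a b : ℝ} (ha : a ∈ Icc (0 : ℝ) 1)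
    (hb : b ∈ Icc (0 : ℝ) 1) :
    IntervalIntegrable (fun s => σ s * kernMajorant ω (min s R)) volume a b :=
  (hσ.intervalIntegrable ha hb).mul_continuousOn
    ((continuousOn_kernMajorant_min hω hR).mono (uIcc_subset_Icc ha hb))

lemma kernMajorant_nonneg (hω : IsRadialWeight ω) {R : ℝ} (hR : R ∈ Ico (0 : ℝ) 1) :
    0 ≤ kernMajorant ω R := by
  have := hω.kernMajorant_mono le_rfl hR.1 hR.2
  simpa [kernMajorant] using this

lemma majorantIntegral_nonneg {σ : ℝ → ℝ} (hω : IsRadialWeight ω) (hσ : IsRadialWeight σ) {R : ℝ}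
    (hR : R ∈ Ico (0 : ℝ) 1) : 0 ≤ majorantIntegral ω σ R := by
  have : ∫ s in (0 : ℝ)..1, (0 : ℝ) ≤ majorantIntegral ω σ R := by
    refine intervalIntegral.integral_mono_on_of_le_Ioo zero_le_one (by simp)
      (intervalIntegrable_mul_kernMajorant hω hσ hR (by simp) (by simp)) fun s hs => ?_
    exact mul_nonneg (hσ.nonneg s ⟨hs.1.le, hs.2⟩)
      (kernMajorant_nonneg hω ⟨le_min hs.1.le hR.1, (min_le_right _ _).trans_lt hR.2⟩)
  simpa using this

/-- Moving the truncation from R to R' affects only s > R, and there the majorant grows by at most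
its increment between R and R'. -/
lemma majorantIntegral_sub_le {σ : ℝ → ℝ} (hω : IsRadialWeight ω) (hσ : IsRadialWeight σ)
    {R R' : ℝ} (hR : 0 ≤ R) (hRR' : R ≤ R') (hR' : R' < 1) :
    majorantIntegral ω σ R' - majorantIntegral ω σ R ≤
      (kernMajorant ω R' - kernMajorant ω R) * tail σ R := by
  have hRm : R ∈ Ico (0 : ℝ) 1 := ⟨hR, by linarith⟩
  have hRm' : R' ∈ Ico (0 : ℝ) 1 := ⟨by linarith, hR'⟩
  have hRc : R ∈ Icc (0 : ℝ) 1 := ⟨hR, by linarith⟩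
  have h0 : (0 : ℝ) ∈ Icc (0 : ℝ) 1 := by simp
  have h1 : (1 : ℝ) ∈ Icc (0 : ℝ) 1 := by simp
  unfold majorantIntegral
  rw [← intervalIntegral.integral_add_adjacent_intervals
      (intervalIntegrable_mul_kernMajorant hω hσ hRm' h0 hRc)
      (intervalIntegrable_mul_kernMajorant hω hσ hRm' hRc h1),
    ← intervalIntegral.integral_add_adjacent_intervals
      (intervalIntegrable_mul_kernMajorant hω hσ hRm h0 hRc)
      (intervalIntegrable_mul_kernMajorant hω hσ hRm hRc h1)]
  have e1 : ∫ s in (0 : ℝ)..R, σ s * kernMajorant ω (min s R') =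
      ∫ s in (0 : ℝ)..R, σ s * kernMajorant ω (min s R) := by
    refine intervalIntegral.integral_congr fun s hs => ?_
    rw [uIcc_of_le hR] at hs
    rw [min_eq_left hs.2, min_eq_left (hs.2.trans hRR')]
  have e2 : ∫ s in R..1, σ s * kernMajorant ω (min s R') ≤
      ∫ s in R..1, (σ s * kernMajorant ω (min s R) +
        (kernMajorant ω R' - kernMajorant ω R) * σ s) := by
    refine intervalIntegral.integral_mono_on_of_le_Ioo hRc.2
      (intervalIntegrable_mul_kernMajorant hω hσ hRm' hRc h1)
      ((intervalIntegrable_mul_kernMajorant hω hσ hRm hRc h1).add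
        ((hσ.intervalIntegrable hRc h1).const_mul _)) fun s hs => ?_
    have hs0 := hσ.nonneg s ⟨hR.trans hs.1.le, hs.2⟩
    have e3 : kernMajorant ω (min s R') ≤ kernMajorant ω R' :=
      hω.kernMajorant_mono (le_min (hR.trans hs.1.le) hRm'.1) (min_le_right _ _) hR'
    rw [min_eq_right hs.1.le]
    nlinarith [mul_le_mul_of_nonneg_left e3 hs0]
  rw [intervalIntegral.integral_add (intervalIntegrable_mul_kernMajorant hω hσ hRm hRc h1)
    ((hσ.intervalIntegrable hRc h1).const_mul _), intervalIntegral.integral_const_mul] at e2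
  unfold tail
  linarith

/-- Let f(u) be the product at R = 1 - u. From 1 - Ku to 1 - u the majorant grows by at most
(K-1)/ω̂(1-u), and the tail condition with upper doubling of ω turns this into a bounded
contribution A. The old part is multiplied by at most 1/C by lower doubling of ν, so f(u) ≤ A +
f(Ku)/C. -/
lemma exists_tail_mul_majorantIntegral_le (hω : IsUpperDoubling ω) (hν : IsLowerDoubling ν)
    (h : TailCondition ω ν) :
    ∃ C : ℝ, 0 < C ∧ ∀ R ∈ Ico (0 : ℝ) 1,
      tail ν R * majorantIntegral ω (divTail ω ν) R ≤ C := by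
  obtain ⟨hi, C₀, hC₀⟩ := h
  have hw := hω.1
  have hνw := hν.1
  have hσ := isRadialWeight_divTail hw hνw hi
  obtain ⟨b, hb⟩ := hω.exists_tail_le_pow
  obtain ⟨K, C, u₁, hK, hC, hu₁, hKu, hs⟩ := hν.exists_mul_tail_le
  have hK0 : 0 < K := by linarith
  have hC0 : 0 < C := by linarith
  set A := (K - 1) * (max C₀ 1 * (1 + 2 * K) ^ b) with hA
  have hAp : 0 < A := mul_pos (by linarith) (by positivity)
  set f : ℝ → ℝ := fun u => tail ν (1 - u) * majorantIntegral ω (divTail ω ν) (1 - u) with hf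
  have hu₁1 : u₁ ≤ 1 := by nlinarith
  have hq : 1 / C < 1 := by rw [div_lt_one hC0]; exact hC
  -- Bound on the initial range u₁ ≤ u ≤ 1, comparing with truncation at 0.
  set B := tail ν 0 * (majorantIntegral ω (divTail ω ν) 0 +
    kernMajorant ω (1 - u₁) * tail (divTail ω ν) 0) with hB
  have key : ∀ u, 0 < u → u ≤ 1 → f u ≤ max B (A / (1 - 1 / C)) := by
    intro u hu hu1
    refine le_max_of_le_add_mul hK (by positivity) hq hKu hu₁ ?_ ?_ hu hu1
    · intro u hu hu'
      have hKu' : K * u ≤ 1 := by nlinarith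
      have huK : u < K * u := by nlinarith
      have h1 : 1 - K * u ∈ Ico (0 : ℝ) 1 := ⟨by linarith, by nlinarith⟩
      have h2 : 1 - u ∈ Ico (0 : ℝ) 1 := ⟨by linarith, by linarith⟩
      have e1 := majorantIntegral_sub_le hw hσ h1.1 (by linarith : 1 - K * u ≤ 1 - u) h2.2
      have e2 := hw.kernMajorant_sub_le h1.1 (by linarith : 1 - K * u ≤ 1 - u) h2.2
      have hT := hw.tail_pos _ h2
      have hT1 := hw.tail_pos _ h1
      rw [sub_sub_cancel, show (1 - u - (1 - K * u)) * (1 / (u * tail ω (1 - u))) =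
        (K - 1) / tail ω (1 - u) by field_simp; ring] at e2
      have e3 := hs u hu hu'
      have e4 : tail ν (1 - K * u) / tail ω (1 - K * u) * tail (divTail ω ν) (1 - K * u) ≤ C₀ :=
        hC₀ _ h1
      rw [div_mul_eq_mul_div, div_le_iff₀ hT1] at e4
      have e5 := hb (K * u) u (by positivity) hKu' hu (by linarith)
      rw [show 2 * (K * u) / u = 2 * K by field_simp] at e5
      have hν1 := hνw.tail_pos _ h1
      have hν2 := hνw.tail_pos _ h2
      have hσ1 := hσ.tail_pos _ h1
      have hH := majorantIntegral_nonneg hw hσ h1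
      have e6 : tail ν (1 - u) ≤ tail ν (1 - K * u) :=
        hνw.tail_anti h1.1 (by linarith) h2.2.le
      have e7 : tail ν (1 - u) * ((K - 1) / tail ω (1 - u) * tail (divTail ω ν) (1 - K * u)) ≤ A := by
        rw [show tail ν (1 - u) * ((K - 1) / tail ω (1 - u) * tail (divTail ω ν) (1 - K * u)) =
          (K - 1) * (tail ν (1 - u) * tail (divTail ω ν) (1 - K * u)) / tail ω (1 - u) by ring,
          div_le_iff₀ hT, hA]
        have hK1 : 0 ≤ K - 1 := by linarith
        calc (K - 1) * (tail ν (1 - u) * tail (divTail ω ν) (1 - K * u))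
            ≤ (K - 1) * (tail ν (1 - K * u) * tail (divTail ω ν) (1 - K * u)) := by gcongr
          _ ≤ (K - 1) * (max C₀ 1 * tail ω (1 - K * u)) := by
              refine mul_le_mul_of_nonneg_left (e4.trans ?_) hK1
              exact mul_le_mul_of_nonneg_right (le_max_left _ _) hT1.le
          _ ≤ (K - 1) * (max C₀ 1 * ((1 + 2 * K) ^ b * tail ω (1 - u))) := by gcongr
          _ = _ := by ring
      have e8 : tail ν (1 - u) ≤ 1 / C * tail ν (1 - K * u) := by
        rw [div_mul_eq_mul_div, one_mul, le_div_iff₀ hC0]; linarith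
      have e9 := mul_le_mul_of_nonneg_right e2 hσ1.le
      simp only [hf]
      calc tail ν (1 - u) * majorantIntegral ω (divTail ω ν) (1 - u)
          ≤ tail ν (1 - u) * (majorantIntegral ω (divTail ω ν) (1 - K * u) +
            (K - 1) / tail ω (1 - u) * tail (divTail ω ν) (1 - K * u)) :=
            mul_le_mul_of_nonneg_left (by linarith) hν2.le
        _ = tail ν (1 - u) * ((K - 1) / tail ω (1 - u) * tail (divTail ω ν) (1 - K * u)) +
            tail ν (1 - u) * majorantIntegral ω (divTail ω ν) (1 - K * u) := by ring
        _ ≤ A + 1 / C * tail ν (1 - K * u) * majorantIntegral ω (divTail ω ν) (1 - K * u) := by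
            gcongr
        _ = _ := by ring
    · intro u hu hu1
      have h2 : 1 - u ∈ Ico (0 : ℝ) 1 := ⟨by linarith, by linarith⟩
      have e1 := majorantIntegral_sub_le hw hσ le_rfl h2.1 h2.2
      have e2 := hw.kernMajorant_mono h2.1 (by linarith : 1 - u ≤ 1 - u₁) (by linarith)
      have e3 := hνw.tail_anti le_rfl h2.1 h2.2.le
      have e4 : kernMajorant ω 0 = 0 := by simp [kernMajorant]
      have hσ0 := hσ.tail_pos 0 (by simp)
      rw [e4, sub_zero] at e1
      refine mul_le_mul e3 ?_ (majorantIntegral_nonneg hw hσ h2) (hνw.tail_nonneg le_rfl zero_le_one)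
      have e5 := mul_le_mul_of_nonneg_right e2 hσ0.le
      linarith
  refine ⟨max B (A / (1 - 1 / C)), lt_max_of_lt_right (div_pos hAp (by linarith)),
    fun R hR => ?_⟩
  have := key (1 - R) (by linarith [hR.2]) (by linarith [hR.1])
  simpa only [hf, sub_sub_cancel] using this

lemma exists_integral_norm_kern_mul_le (hω : IsUpperDoubling ω) (hν : IsLowerDoubling ν)
    (h : TailCondition ω ν) :
    ∃ C : ℝ, 0 < C ∧ ∀ z ∈ disc,
      tail ν ‖z‖ * ∫ ζ, ‖kern ω (conj z * ζ)‖ * divTail ω ν ‖ζ‖ ∂discArea ≤ C := by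
  obtain ⟨C, hC, hL⟩ := hω.exists_integral_norm_kern_le
  obtain ⟨C', hC', hH⟩ := exists_tail_mul_majorantIntegral_le hω hν h
  have hw := hω.1
  have hσ := isRadialWeight_divTail hw hν.1 h.1
  have hν0 := hν.1.tail_pos 0 (by simp)
  have hσ0 := hσ.tail_pos 0 (by simp)
  refine ⟨Real.pi⁻¹ * C * (tail ν 0 * tail (divTail ω ν) 0 + C'), by positivity, fun z hz => ?_⟩
  have hz' : ‖z‖ < 1 := by rwa [disc, mem_ball_zero_iff] at hz
  have hR : ‖z‖ ∈ Ico (0 : ℝ) 1 := ⟨norm_nonneg _, hz'⟩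
  set R := ‖z‖ with hRdef
  have hint : Integrable (fun ζ => ‖kern ω (conj z * ζ)‖ * divTail ω ν ‖ζ‖) discArea := by
    refine (integrable_weight_comp_norm hσ.integrable).bdd_mul
      (c := ∑' n, kernCoef ω n * R ^ n) ?_ ?_
    · exact (hw.differentiableOn_kern_conj_mul hz).continuousOn.norm.aestronglyMeasurable_discArea
    · filter_upwards [ae_discArea_mem] with ζ hζ
      rw [norm_norm]
      exact norm_kern_le hw (norm_conj_mul_le hζ) hz'
  have hνR := hν.1.tail_pos R hR
  have hmaj : ∫ s in (0 : ℝ)..1, s • ∫ θ in (-Real.pi)..Real.pi,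
      ‖kern ω (conj z * (s * circ θ))‖ * divTail ω ν ‖(s : ℂ) * circ θ‖ ≤
      ∫ s in (0 : ℝ)..1, C * (divTail ω ν s + divTail ω ν s * kernMajorant ω (min s R)) := by
    rw [intervalIntegral.integral_of_le zero_le_one, intervalIntegral.integral_of_le zero_le_one,
      integral_Ioc_eq_integral_Ioo, integral_Ioc_eq_integral_Ioo]
    have hI : ∀ s ∈ Ioo (0 : ℝ) 1, ∫ θ in (-Real.pi)..Real.pi,
        ‖kern ω (conj z * (s * circ θ))‖ * divTail ω ν ‖(s : ℂ) * circ θ‖ =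
        (∫ θ in (-Real.pi)..Real.pi, ‖kern ω (conj z * s * circ θ)‖) * divTail ω ν s := by
      intro s hs
      rw [← intervalIntegral.integral_mul_const]
      refine intervalIntegral.integral_congr fun θ _ => ?_
      simp only [norm_mul, norm_circ, mul_one, Complex.norm_real, Real.norm_of_nonneg hs.1.le,
        mul_assoc]
    have hpi : -Real.pi ≤ Real.pi := by linarith [Real.pi_pos]
    refine integral_mono_of_nonneg ?_ ?_ ?_
    · filter_upwards [ae_restrict_mem measurableSet_Ioo] with s hs
      rw [hI s hs]
      exact smul_nonneg hs.1.le (mul_nonneg (intervalIntegral.integral_nonneg hpi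
        fun θ _ => norm_nonneg _) (hσ.nonneg s ⟨hs.1.le, hs.2⟩))
    · have := ((hσ.intervalIntegrable (a := 0) (b := 1) (by simp) (by simp)).add
        (intervalIntegrable_mul_kernMajorant hw hσ hR (a := 0) (b := 1) (by simp)
          (by simp))).const_mul C
      rw [intervalIntegrable_iff_integrableOn_Ioo_of_le zero_le_one] at this
      exact this
    · filter_upwards [ae_restrict_mem measurableSet_Ioo] with s hs
      rw [hI s hs, smul_eq_mul]
      have hσs := hσ.nonneg s ⟨hs.1.le, hs.2⟩
      have hn : ‖conj z * (s : ℂ)‖ = R * s := by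
        rw [norm_mul, RCLike.norm_conj, Complex.norm_real, Real.norm_of_nonneg hs.1.le]
      have hRs : R * s < 1 := by nlinarith [hs.1, hs.2, hR.1]
      have e1 := hL (conj z * s) (by rw [hn]; exact hRs)
      rw [hn] at e1
      -- The circle of radius s meets the kernel at radius Rs, below both s and R; this is why the
      -- truncated majorant suffices.
      have hm : R * s ≤ min s R := le_min (by nlinarith [hs.1]) (by nlinarith [hs.2, hR.1])
      have e2 := hw.kernMajorant_mono (mul_nonneg hR.1 hs.1.le) hm
        ((min_le_right _ _).trans_lt hz')
      have e3 : 0 ≤ ∫ θ in (-Real.pi)..Real.pi, ‖kern ω (conj z * s * circ θ)‖ :=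
        intervalIntegral.integral_nonneg hpi fun θ _ => norm_nonneg _
      calc s * ((∫ θ in (-Real.pi)..Real.pi, ‖kern ω (conj z * s * circ θ)‖) * divTail ω ν s)
          ≤ 1 * ((C * (1 + kernMajorant ω (min s R))) * divTail ω ν s) := by
            refine mul_le_mul hs.2.le ?_ (mul_nonneg e3 hσs) zero_le_one
            refine mul_le_mul_of_nonneg_right (e1.trans ?_) hσs
            exact mul_le_mul_of_nonneg_left (by linarith) hC.le
        _ = _ := by ring
  rw [integral_discArea hint, smul_eq_mul]
  have hval : ∫ s in (0 : ℝ)..1, C * (divTail ω ν s + divTail ω ν s * kernMajorant ω (min s R)) =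
      C * (tail (divTail ω ν) 0 + majorantIntegral ω (divTail ω ν) R) := by
    rw [intervalIntegral.integral_const_mul, intervalIntegral.integral_add
      (hσ.intervalIntegrable (by simp) (by simp))
      (intervalIntegrable_mul_kernMajorant hw hσ hR (by simp) (by simp))]
    rfl
  rw [hval] at hmaj
  have e1 := hH R hR
  have e2 : tail ν R ≤ tail ν 0 := hν.1.tail_anti le_rfl hR.1 hR.2.le
  calc tail ν R * (Real.pi⁻¹ * _)
      ≤ tail ν R * (Real.pi⁻¹ * (C * (tail (divTail ω ν) 0 +
        majorantIntegral ω (divTail ω ν) R))) := by gcongr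
    _ = Real.pi⁻¹ * C * (tail ν R * tail (divTail ω ν) 0 +
        tail ν R * majorantIntegral ω (divTail ω ν) R) := by ring
    _ ≤ _ := by gcongr

lemma MemGrowth.ae_le {v : ℝ → ℝ} {f : ℂ → ℂ} (hf : MemGrowth v f) (hv : ∀ r ∈ Ico (0 : ℝ) 1, 0 < v r) :
    ∀ᵐ ζ ∂discArea, ‖f ζ‖ * v ‖ζ‖ ≤ (growthNorm v f).toReal := by
  have h1 : ∀ᵐ ζ ∂discArea, ‖f ζ‖ₑ * ENNReal.ofReal (v ‖ζ‖) ≤ growthNorm v f :=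
    ENNReal.ae_le_essSup _
  filter_upwards [h1, ae_discArea_mem] with ζ h2 hζ
  rw [disc, mem_ball_zero_iff] at hζ
  have hvp := hv ‖ζ‖ ⟨norm_nonneg _, hζ⟩
  have h3 := ENNReal.toReal_mono hf.2.ne h2
  rwa [ENNReal.toReal_mul, toReal_enorm, ENNReal.toReal_ofReal hvp.le] at h3

lemma growthNorm_le {v : ℝ → ℝ} {f : ℂ → ℂ} {M : ℝ} (h : ∀ ζ ∈ disc, ‖f ζ‖ * v ‖ζ‖ ≤ M) :
    growthNorm v f ≤ ENNReal.ofReal M := by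
  refine essSup_le_of_ae_le _ ?_
  filter_upwards [ae_discArea_mem] with ζ hζ
  rw [← ofReal_norm, ← ENNReal.ofReal_mul (norm_nonneg _)]
  exact ENNReal.ofReal_le_ofReal (h ζ hζ)

lemma MemGrowth.integrable_mul_weight (hω : IsRadialWeight ω) (hν : IsRadialWeight ν)
    (hi : IntegrableOn (divTail ω ν) (Ico 0 1)) {f : ℂ → ℂ} (hf : MemGrowth (tail ν) f) :
    Integrable (fun ζ => f ζ * (ω ‖ζ‖ : ℂ)) discArea ∧
    ∀ᵐ ζ ∂discArea, ‖f ζ * (ω ‖ζ‖ : ℂ)‖ ≤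
      (growthNorm (tail ν) f).toReal * divTail ω ν ‖ζ‖ := by
  have hle : ∀ᵐ ζ ∂discArea, ‖f ζ * (ω ‖ζ‖ : ℂ)‖ ≤
      (growthNorm (tail ν) f).toReal * divTail ω ν ‖ζ‖ := by
    filter_upwards [hf.ae_le hν.tail_pos, ae_discArea_mem] with ζ h1 hζ
    rw [disc, mem_ball_zero_iff] at hζ
    have hm : ‖ζ‖ ∈ Ico (0 : ℝ) 1 := ⟨norm_nonneg _, hζ⟩
    rw [norm_mul, Complex.norm_real, Real.norm_of_nonneg (hω.nonneg _ hm),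
      ← tail_mul_divTail (ω := ω) hν hm, ← mul_assoc]
    exact mul_le_mul_of_nonneg_right h1 (divTail_nonneg hω hν hm)
  refine ⟨((integrable_weight_comp_norm hi).const_mul _).mono' ?_ hle, hle⟩
  exact hf.1.mul (Complex.continuous_ofReal.comp_aestronglyMeasurable
    (integrable_weight_comp_norm hω.integrable).1)

/-- No cancellation in f is used: the integral operator with kernel |B_z| is already bounded. -/
theorem projBounded_of_tailCondition (hω : IsUpperDoubling ω) (hν : IsLowerDoubling ν)
    (h : TailCondition ω ν) : ProjBounded ω (tail ν) := by
  obtain ⟨C, hC, hb⟩ := exists_integral_norm_kern_mul_le hω hν h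
  have hw := hω.1
  have hσ := isRadialWeight_divTail hw hν.1 h.1
  refine ⟨C.toNNReal, fun f hf => ?_⟩
  obtain ⟨hi, hle⟩ := hf.integrable_mul_weight hw hν.1 h.1
  set M := (growthNorm (tail ν) f).toReal with hM
  have hM0 : 0 ≤ M := ENNReal.toReal_nonneg
  have hpt : ∀ z ∈ disc, ‖bergmanProj ω f z‖ * tail ν ‖z‖ ≤ C * M := by
    intro z hz
    have hz' : ‖z‖ < 1 := by rwa [disc, mem_ball_zero_iff] at hz
    have hνz := hν.1.tail_pos ‖z‖ ⟨norm_nonneg _, hz'⟩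
    have hint : Integrable (fun ζ => ‖kern ω (conj z * ζ)‖ * divTail ω ν ‖ζ‖) discArea := by
      refine (integrable_weight_comp_norm hσ.integrable).bdd_mul
        (c := ∑' n, kernCoef ω n * ‖z‖ ^ n) ?_ ?_
      · exact (hw.differentiableOn_kern_conj_mul hz).continuousOn.norm.aestronglyMeasurable_discArea
      · filter_upwards [ae_discArea_mem] with ζ hζ
        rw [norm_norm]
        exact norm_kern_le hw (norm_conj_mul_le hζ) hz'
    have h1 : ‖bergmanProj ω f z‖ ≤
        ∫ ζ, M * (‖kern ω (conj z * ζ)‖ * divTail ω ν ‖ζ‖) ∂discArea := by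
      rw [bergmanProj, integral_congr_ae (projIntegrand_ae_eq hw f hz)]
      refine norm_integral_le_of_norm_le (hint.const_mul M) ?_
      filter_upwards [hle] with ζ hζ
      rw [norm_mul, RCLike.norm_conj]
      refine (mul_le_mul_of_nonneg_right hζ (norm_nonneg _)).trans (le_of_eq (by ring))
    rw [integral_const_mul] at h1
    calc ‖bergmanProj ω f z‖ * tail ν ‖z‖
        ≤ M * (∫ ζ, ‖kern ω (conj z * ζ)‖ * divTail ω ν ‖ζ‖ ∂discArea) * tail ν ‖z‖ :=
          mul_le_mul_of_nonneg_right h1 hνz.le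
      _ = (tail ν ‖z‖ * ∫ ζ, ‖kern ω (conj z * ζ)‖ * divTail ω ν ‖ζ‖ ∂discArea) * M := by ring
      _ ≤ _ := mul_le_mul_of_nonneg_right (hb z hz) hM0
  have hnorm : growthNorm (tail ν) (bergmanProj ω f) ≤ C.toNNReal * growthNorm (tail ν) f := by
    refine (growthNorm_le hpt).trans (le_of_eq ?_)
    rw [ENNReal.ofReal_mul hC.le, hM, ENNReal.ofReal_toReal hf.2.ne]
    rfl
  have hd := differentiableOn_bergmanProj hw hi
  refine ⟨fun z hz => integrable_projIntegrand hw hi hz, ⟨hd, ?_, ?_⟩, hnorm⟩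
  · exact hd.continuousOn.aestronglyMeasurable_discArea
  · exact hnorm.trans_lt (ENNReal.mul_lt_top ENNReal.coe_lt_top hf.2)

/-! ### Necessity -/

lemma IsRadialWeight.continuousOn_tail_norm (hν : IsRadialWeight ν) :
    ContinuousOn (fun ζ : ℂ => tail ν ‖ζ‖) disc :=
  hν.tail_continuousOn.comp continuous_norm.continuousOn fun ζ hζ => by
    rw [disc, mem_ball_zero_iff] at hζ; exact ⟨norm_nonneg _, hζ.le⟩

/-- The growth norm is an essential supremum, while the test functions are evaluated at single
points; continuity bridges the two. -/
lemma le_of_ae_le_of_continuousOn {φ : ℂ → ℝ} (hφ : ContinuousOn φ disc) {c : ℝ}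
    (h : ∀ᵐ ζ ∂discArea, φ ζ ≤ c) {z : ℂ} (hz : z ∈ disc) : φ z ≤ c := by
  unfold discArea at h
  rw [Measure.ae_ennreal_smul_measure_eq ofReal_inv_pi_ne_zero] at h
  -- Taking the maximum with c turns the inequality into an a.e. equality of continuous functions on
  -- an open set.
  have h1 : (fun ζ => max (φ ζ) c) =ᵐ[volume.restrict disc] fun _ => c := by
    filter_upwards [h] with ζ hζ
    exact max_eq_right hζ
  have h2 := Measure.eqOn_open_of_ae_eq h1 Metric.isOpen_ball (hφ.sup continuousOn_const)
    continuousOn_const hz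
  exact max_eq_right_iff.1 h2

lemma ProjBounded.exists_norm_le (hν : IsRadialWeight ν) (h : ProjBounded ω (tail ν)) :
    ∃ C : ℝ, 0 ≤ C ∧ ∀ (f : ℂ → ℂ) (B : ℝ), 0 ≤ B → AEStronglyMeasurable f discArea →
      (∀ ζ ∈ disc, ‖f ζ‖ * tail ν ‖ζ‖ ≤ B) →
      ∀ z ∈ disc, ‖bergmanProj ω f z‖ * tail ν ‖z‖ ≤ C * B := by
  obtain ⟨C, hC⟩ := h
  refine ⟨C, C.2, fun f B hB hfm hfB z hz => ?_⟩
  have hg := growthNorm_le hfB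
  have hf : MemGrowth (tail ν) f := ⟨hfm, hg.trans_lt ENNReal.ofReal_lt_top⟩
  obtain ⟨-, ⟨hd, hmem⟩, hle⟩ := hC f hf
  refine le_of_ae_le_of_continuousOn (φ := fun z => ‖bergmanProj ω f z‖ * tail ν ‖z‖)
    (hd.continuousOn.norm.mul hν.continuousOn_tail_norm) ?_ hz
  filter_upwards [hmem.ae_le hν.tail_pos] with ζ hζ
  refine hζ.trans ?_
  have h1 : growthNorm (tail ν) (bergmanProj ω f) ≤ ENNReal.ofReal (C * B) := by
    rw [ENNReal.ofReal_mul C.coe_nonneg, ENNReal.ofReal_coe_nnreal]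
    exact hle.trans (by gcongr)
  exact ENNReal.toReal_le_of_le_ofReal (by positivity) h1

/-- The function `g(arg ζ) / ν̂(ζ)`. -/
def angularTest (ν : ℝ → ℝ) (g : ℝ → ℂ) (ζ : ℂ) : ℂ := g ζ.arg * ((tail ν ‖ζ‖)⁻¹ : ℝ)

lemma aestronglyMeasurable_angularTest (hν : IsRadialWeight ν) {g : ℝ → ℂ} (hg : Measurable g) :
    AEStronglyMeasurable (angularTest ν g) discArea := by
  refine (hg.comp Complex.measurable_arg).aestronglyMeasurable.mul
    (Complex.continuous_ofReal.comp_aestronglyMeasurable ?_)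
  refine (hν.continuousOn_tail_norm.inv₀ fun ζ hζ => ?_).aestronglyMeasurable_discArea
  rw [disc, mem_ball_zero_iff] at hζ
  exact (hν.tail_pos _ ⟨norm_nonneg _, hζ⟩).ne'

lemma norm_angularTest_mul_le (hν : IsRadialWeight ν) {g : ℝ → ℂ} {B : ℝ}
    (hB : ∀ θ ∈ Ioc (-Real.pi) Real.pi, ‖g θ‖ ≤ B) {ζ : ℂ} (hζ : ζ ∈ disc) :
    ‖angularTest ν g ζ‖ * tail ν ‖ζ‖ ≤ B := by
  rw [disc, mem_ball_zero_iff] at hζ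
  have hT := hν.tail_pos _ ⟨norm_nonneg _, hζ⟩
  rw [angularTest, norm_mul, Complex.norm_real, Real.norm_of_nonneg (inv_nonneg.2 hT.le), mul_assoc,
    inv_mul_cancel₀ hT.ne', mul_one]
  exact hB _ (Complex.arg_mem_Ioc ζ)

lemma angularTest_mul_weight (g : ℝ → ℂ) (ζ : ℂ) :
    angularTest ν g ζ * (ω ‖ζ‖ : ℂ) = g ζ.arg * (divTail ω ν ‖ζ‖ : ℂ) := by
  rw [angularTest, divTail]; push_cast; ring

lemma arg_mul_circ {s θ : ℝ} (hs : 0 < s) (hθ : θ ∈ Ioc (-Real.pi) Real.pi) :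
    Complex.arg (s * circ θ) = θ := by
  rw [circ, Complex.exp_mul_I]
  exact Complex.arg_mul_cos_add_sin_mul_I hs hθ

lemma integrable_angularTest (hi : IntegrableOn (divTail ω ν) (Ico 0 1)) {g : ℝ → ℂ}
    (hg : Measurable g) {B : ℝ} (hB : ∀ θ ∈ Ioc (-Real.pi) Real.pi, ‖g θ‖ ≤ B) :
    Integrable (fun ζ => angularTest ν g ζ * (ω ‖ζ‖ : ℂ)) discArea := by
  simp_rw [angularTest_mul_weight]
  exact (integrable_weight_comp_norm hi).ofReal.bdd_mul (c := B)
    (hg.comp Complex.measurable_arg).aestronglyMeasurable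
    (ae_of_all _ fun ζ => hB _ (Complex.arg_mem_Ioc ζ))

/-- After multiplication by ω the test function is g(arg ζ)σ(|ζ|), so each pairing with a power
factors into a Fourier coefficient of g and a moment of σ. -/
lemma hasSum_bergmanProj_angularTest (hω : IsRadialWeight ω)
    (hi : IntegrableOn (divTail ω ν) (Ico 0 1)) {g : ℝ → ℂ}
    (hg : Measurable g) {B : ℝ} (hB : ∀ θ ∈ Ioc (-Real.pi) Real.pi, ‖g θ‖ ≤ B) {z : ℂ}
    (hz : z ∈ disc) :
    HasSum (fun n : ℕ => (kernCoef ω n : ℂ) * ((Real.pi : ℂ)⁻¹ *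
      (∫ θ in (-Real.pi)..Real.pi, g θ * conj (circ θ) ^ n) *
      moment (divTail ω ν) ((n + 1 : ℕ) : ℝ)) * z ^ n)
      (bergmanProj ω (angularTest ν g) z) := by
  have hint := integrable_angularTest (ω := ω) hi hg hB
  refine (hasSum_bergmanProj hω hint hz).congr_fun fun n => ?_
  congr 2
  rw [integral_discArea_of_inner (integrable_mul_conj_pow hint n) (h := divTail ω ν) (n := n)]
  intro s hs
  rw [← intervalIntegral.integral_mul_const]
  have hpi : -Real.pi ≤ Real.pi := by linarith [Real.pi_pos]
  rw [intervalIntegral.integral_of_le hpi, intervalIntegral.integral_of_le hpi]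
  refine setIntegral_congr_fun measurableSet_Ioc fun θ hθ => ?_
  simp only [angularTest_mul_weight]
  rw [arg_mul_circ hs.1 hθ, norm_mul, norm_circ, mul_one, Complex.norm_real,
    Real.norm_of_nonneg hs.1.le, map_mul, Complex.conj_ofReal, mul_pow]
  push_cast; ring

/-- At z = 0 the kernel is a nonzero constant, so absolute convergence for f = 1/ν̂ says that σ is
integrable over the disc. -/
lemma integrableOn_divTail_of_projBounded (hω : IsRadialWeight ω) (hν : IsRadialWeight ν)
    (h : ProjBounded ω (tail ν)) : IntegrableOn (divTail ω ν) (Ico 0 1) := by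
  obtain ⟨C, hC⟩ := h
  have hB : ∀ θ ∈ Ioc (-Real.pi) Real.pi, ‖(fun _ => 1 : ℝ → ℂ) θ‖ ≤ 1 := by simp
  have hf : MemGrowth (tail ν) (angularTest ν fun _ => 1) :=
    ⟨aestronglyMeasurable_angularTest hν measurable_const,
      (growthNorm_le fun ζ hζ => norm_angularTest_mul_le hν hB hζ).trans_lt ENNReal.ofReal_lt_top⟩
  have h0 : (0 : ℂ) ∈ disc := by simp [disc]
  have h1 := (hC _ hf).1 0 h0
  have hk : kern ω 0 = kernCoef ω 0 := by
    rw [kern, tsum_eq_single 0 (fun n hn => by simp [hn])]; simp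
  have hk0 := hω.kernCoef_pos 0
  have h2 : Integrable (fun ζ : ℂ => divTail ω ν ‖ζ‖) discArea := by
    have h3 := (h1.congr (projIntegrand_ae_eq hω _ h0)).re.const_mul (kernCoef ω 0)⁻¹
    refine h3.congr (ae_of_all _ fun ζ => ?_)
    simp only [angularTest_mul_weight, map_zero, zero_mul, hk, one_mul, Complex.conj_ofReal]
    rw [← Complex.ofReal_mul]
    simp only [RCLike.re_to_complex, Complex.ofReal_re]
    field_simp
  have hsub : IntegrableOn ω (Ioo 0 1) := hω.integrable.mono_set Ioo_subset_Ico_self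
  have hm : AEStronglyMeasurable (divTail ω ν) (volume.restrict (Ioo 0 1)) := by
    refine hsub.1.div₀ ?_
    exact (hν.tail_continuousOn.mono Ioo_subset_Icc_self).aestronglyMeasurable measurableSet_Ioo
  have h4 := (integrable_comp_norm_iff hm).1 h2
  rw [integrableOn_Ico_iff_integrableOn_Ioo]
  have hT := hν.tail_pos (1 / 2) (by norm_num)
  refine ((h4.const_mul 2).add (hsub.const_mul (tail ν (1 / 2))⁻¹)).mono' hm ?_
  filter_upwards [ae_restrict_mem measurableSet_Ioo] with s hs
  have hs' : s ∈ Ico (0 : ℝ) 1 := ⟨hs.1.le, hs.2⟩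
  have hσ := divTail_nonneg hω hν hs'
  have hω0 := hω.nonneg s hs'
  rw [Real.norm_of_nonneg hσ, Pi.add_apply]
  -- Polar coordinates only control sσ(s). Near 0 the factor s is useless, but there ν̂ ≥ ν̂(1/2)
  -- and σ is bounded by a multiple of ω.
  rcases le_total s (1 / 2) with hcase | hcase
  · have h5 : divTail ω ν s ≤ (tail ν (1 / 2))⁻¹ * ω s := by
      rw [divTail, div_eq_inv_mul]
      exact mul_le_mul_of_nonneg_right
        (inv_anti₀ hT (hν.tail_anti hs.1.le hcase (by norm_num))) hω0
    have : 0 ≤ s * divTail ω ν s := mul_nonneg hs.1.le hσ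
    linarith
  · have : 0 ≤ (tail ν (1 / 2))⁻¹ * ω s := by positivity
    nlinarith

lemma two_mul_kernCoef (n : ℕ) : 2 * kernCoef ω n = 1 / moment ω ((2 * n + 1 : ℕ) : ℝ) := by
  rw [kernCoef, mul_inv, ← mul_assoc, mul_inv_cancel₀ two_ne_zero, one_mul, one_div]

/-- The test function with angular part e^{iNθ} projects to a single monomial. -/
lemma exists_tail_mul_pow_mul_moment_le (hω : IsRadialWeight ω) (hν : IsRadialWeight ν)
    (h : ProjBounded ω (tail ν)) :
    ∃ C : ℝ, 0 ≤ C ∧ ∀ (N : ℕ) (r : ℝ), 0 ≤ r → r < 1 →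
      tail ν r * r ^ N * moment (divTail ω ν) ((N + 1 : ℕ) : ℝ) ≤
        C * moment ω ((2 * N + 1 : ℕ) : ℝ) := by
  have hi := integrableOn_divTail_of_projBounded hω hν h
  obtain ⟨C, hC, hb⟩ := h.exists_norm_le hν
  refine ⟨C, hC, fun N r hr hr1 => ?_⟩
  have hgm : Measurable fun θ => circ θ ^ N := (continuous_circ.pow N).measurable
  have hgB : ∀ θ ∈ Ioc (-Real.pi) Real.pi, ‖circ θ ^ N‖ ≤ 1 := by simp
  have hz : (r : ℂ) ∈ disc := by
    rw [disc, mem_ball_zero_iff, Complex.norm_real, Real.norm_of_nonneg hr]; exact hr1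
  have h1 := hb _ 1 zero_le_one (aestronglyMeasurable_angularTest hν hgm)
    (fun ζ hζ => norm_angularTest_mul_le hν hgB hζ) _ hz
  have h2 := hasSum_bergmanProj_angularTest hω hi hgm hgB hz
  simp_rw [integral_circ_pow_mul_conj_pow] at h2
  have hm := hω.moment_pos (x := ((2 * N + 1 : ℕ) : ℝ)) (by positivity)
  have hσ := (isRadialWeight_divTail hω hν hi).moment_pos (x := ((N + 1 : ℕ) : ℝ)) (by positivity)
  have hπ : (Real.pi : ℂ) ≠ 0 := by exact_mod_cast Real.pi_ne_zero
  have h3 : bergmanProj ω (angularTest ν fun θ => circ θ ^ N) r =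
      ((r ^ N * moment (divTail ω ν) ((N + 1 : ℕ) : ℝ) / moment ω ((2 * N + 1 : ℕ) : ℝ) : ℝ) : ℂ) := by
    rw [← h2.tsum_eq, tsum_eq_single N (fun n hn => by simp [hn.symm])]
    rw [if_pos rfl, div_eq_mul_one_div, ← two_mul_kernCoef]
    push_cast
    field_simp
  rw [h3, Complex.norm_real, Complex.norm_real, Real.norm_of_nonneg hr,
    Real.norm_of_nonneg (by positivity), mul_one, div_mul_eq_mul_div, div_le_iff₀ hm] at h1
  linarith

/-- The test function with angular part θ, evaluated on the negative radius: the signs (-1)ⁿ of the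
Fourier coefficients cancel those of (-r)ⁿ, and up to the factor i all terms are nonnegative, so
partial sums are controlled. -/
lemma exists_tail_mul_sum_le (hω : IsRadialWeight ω) (hν : IsRadialWeight ν)
    (h : ProjBounded ω (tail ν)) :
    ∃ C : ℝ, 0 ≤ C ∧ ∀ (F : Finset ℕ) (r : ℝ), 0 ≤ r → r < 1 →
      tail ν r * ∑ n ∈ F, r ^ n / n * (moment (divTail ω ν) ((n + 1 : ℕ) : ℝ) /
        moment ω ((2 * n + 1 : ℕ) : ℝ)) ≤ C := by
  have hi := integrableOn_divTail_of_projBounded hω hν h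
  obtain ⟨C, hC, hb⟩ := h.exists_norm_le hν
  refine ⟨C * Real.pi, by positivity, fun F r hr hr1 => ?_⟩
  have hgm : Measurable fun θ : ℝ => (θ : ℂ) := Complex.measurable_ofReal
  have hgB : ∀ θ ∈ Ioc (-Real.pi) Real.pi, ‖(θ : ℂ)‖ ≤ Real.pi := fun θ hθ => by
    rw [Complex.norm_real, Real.norm_eq_abs, abs_le]; exact ⟨hθ.1.le, hθ.2⟩
  have hn : ‖(-r : ℂ)‖ = r := by rw [norm_neg, Complex.norm_real, Real.norm_of_nonneg hr]
  have hz : (-r : ℂ) ∈ disc := by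
    rw [disc, mem_ball_zero_iff, hn]; exact hr1
  have h1 := hb _ Real.pi Real.pi_pos.le (aestronglyMeasurable_angularTest hν hgm)
    (fun ζ hζ => norm_angularTest_mul_le hν hgB hζ) _ hz
  have h2 := hasSum_bergmanProj_angularTest hω hi hgm hgB hz
  have hπ : (Real.pi : ℂ) ≠ 0 := by exact_mod_cast Real.pi_ne_zero
  set c : ℕ → ℝ := fun n => r ^ n / n * (moment (divTail ω ν) ((n + 1 : ℕ) : ℝ) /
        moment ω ((2 * n + 1 : ℕ) : ℝ)) with hc
  have hc0 : ∀ n, 0 ≤ c n := fun n => by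
    have hm := hω.moment_pos (x := ((2 * n + 1 : ℕ) : ℝ)) (by positivity)
    have hσ := (isRadialWeight_divTail hω hν hi).moment_pos (x := ((n + 1 : ℕ) : ℝ)) (by positivity)
    positivity
  have h3 : HasSum (fun n => (c n : ℂ) * Complex.I)
      (bergmanProj ω (angularTest ν fun θ : ℝ => (θ : ℂ)) (-r)) := by
    refine h2.congr_fun fun n => ?_
    -- For n = 0 both sides vanish: θ has mean zero, and division by zero is zero.
    rcases eq_or_ne n 0 with rfl | hn0
    · have : ∫ θ in (-Real.pi)..Real.pi, (θ : ℂ) = 0 := by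
        rw [intervalIntegral.integral_ofReal, integral_id]; simp
      simp [hc, this]
    · rw [integral_mul_circ_conj_pow hn0]
      have hn' : (n : ℂ) ≠ 0 := by exact_mod_cast hn0
      have hs : ((-1 : ℂ) ^ n) * (-1) ^ n = 1 := by rw [← mul_pow]; simp
      simp only [hc]
      rw [div_eq_mul_one_div (moment (divTail ω ν) _), ← two_mul_kernCoef, neg_pow (r : ℂ)]
      push_cast
      field_simp
      linear_combination (-((r : ℂ) ^ n * moment (divTail ω ν) (n + 1) * kernCoef ω n)) * hs
  have h4 := h3.mul_right (-Complex.I)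
  have h5 : HasSum c (bergmanProj ω (angularTest ν fun θ : ℝ => (θ : ℂ)) (-r) * -Complex.I).re := by
    refine (Complex.hasSum_re h4).congr_fun fun n => ?_
    rw [mul_assoc, mul_neg, Complex.I_mul_I]; simp
  have h6 := sum_le_hasSum F (fun n _ => hc0 n) h5
  have h7 : (bergmanProj ω (angularTest ν fun θ : ℝ => (θ : ℂ)) (-r) * -Complex.I).re ≤
      ‖bergmanProj ω (angularTest ν fun θ : ℝ => (θ : ℂ)) (-r)‖ := by
    refine (Complex.re_le_norm _).trans (le_of_eq ?_)
    simp
  rw [hn] at h1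
  have hT := hν.tail_pos r ⟨hr, hr1⟩
  nlinarith [mul_le_mul_of_nonneg_left (h6.trans h7) hT.le]

theorem momentCondition_of_projBounded (hω : IsRadialWeight ω) (hν : IsUpperDoubling ν)
    (h : ProjBounded ω (tail ν)) : MomentCondition ω ν := by
  have hνw := hν.1
  have hi := integrableOn_divTail_of_projBounded hω hνw h
  have hσ := isRadialWeight_divTail hω hνw hi
  obtain ⟨C, hC, hA⟩ := exists_tail_mul_pow_mul_moment_le hω hνw h
  obtain ⟨C₁, hC₁, h1⟩ := hν.exists_moment_le_tail
  obtain ⟨C₂, hC₂, h2⟩ := hσ.exists_moment_le_mul_moment_add_one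
  obtain ⟨C₃, hC₃, h3⟩ := hω.exists_moment_le_mul_moment_add_one
  -- The first entry serves N ≥ 2, using the radius 1 - 1/N; the second serves N ≤ 1, where 2N + 1 ≤
  -- 3.
  set D := max (C₁ * Real.exp 2 * C) (tail ν 0 * tail (divTail ω ν) 0 / moment ω 3) with hD
  have hm3 : 0 < moment ω 3 := hω.moment_pos (by norm_num)
  have hν0 := hνw.tail_pos 0 (by simp)
  have hσ0 := hσ.tail_pos 0 (by simp)
  have hD0 : 0 < D := lt_max_of_lt_right (by positivity)
  have key : ∀ N : ℕ, moment ν N * moment (divTail ω ν) ((N + 1 : ℕ) : ℝ) ≤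
      D * moment ω ((2 * N + 1 : ℕ) : ℝ) := by
    intro N
    have hm := hω.moment_pos (x := ((2 * N + 1 : ℕ) : ℝ)) (by positivity)
    have hσN := hσ.moment_pos (x := ((N + 1 : ℕ) : ℝ)) (by positivity)
    have hνN := hνw.moment_pos (x := (N : ℝ)) (by positivity)
    rcases le_or_gt 2 N with hN | hN
    · have hN2 : (2 : ℝ) ≤ N := by exact_mod_cast hN
      have hN0 : (0 : ℝ) < N := by linarith
      have hu : 1 / (N : ℝ) ≤ 1 / 2 := one_div_le_one_div_of_le two_pos hN2
      have hu0 : 0 < 1 / (N : ℝ) := by positivity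
      have e1 := hA N (1 - 1 / N) (by linarith) (by linarith)
      have e2 := one_sub_rpow_ge hu0.le hu hN0.le
      rw [show 2 * (1 / (N : ℝ)) * N = 2 by field_simp, Real.rpow_natCast] at e2
      have e3 := h1 N (by linarith)
      have hT := hνw.tail_pos (1 - 1 / (N : ℝ)) ⟨by linarith, by linarith⟩
      have e4 : tail ν (1 - 1 / (N : ℝ)) ≤
          Real.exp 2 * (tail ν (1 - 1 / (N : ℝ)) * (1 - 1 / (N : ℝ)) ^ N) := by
        calc tail ν (1 - 1 / (N : ℝ))
            = Real.exp 2 * (tail ν (1 - 1 / (N : ℝ)) * Real.exp (-2)) := by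
              rw [mul_comm (tail ν _), ← mul_assoc, ← Real.exp_add]; simp
          _ ≤ _ := by gcongr
      calc moment ν N * moment (divTail ω ν) ((N + 1 : ℕ) : ℝ)
          ≤ (C₁ * (Real.exp 2 * (tail ν (1 - 1 / (N : ℝ)) * (1 - 1 / (N : ℝ)) ^ N))) *
            moment (divTail ω ν) ((N + 1 : ℕ) : ℝ) := by
            refine mul_le_mul_of_nonneg_right (e3.trans ?_) hσN.le
            gcongr
        _ = C₁ * Real.exp 2 * (tail ν (1 - 1 / (N : ℝ)) * (1 - 1 / (N : ℝ)) ^ N *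
            moment (divTail ω ν) ((N + 1 : ℕ) : ℝ)) := by ring
        _ ≤ C₁ * Real.exp 2 * (C * moment ω ((2 * N + 1 : ℕ) : ℝ)) := by gcongr
        _ = C₁ * Real.exp 2 * C * moment ω ((2 * N + 1 : ℕ) : ℝ) := by ring
        _ ≤ _ := mul_le_mul_of_nonneg_right (le_max_left _ _) hm.le
    · refine le_trans ?_ (mul_le_mul_of_nonneg_right (le_max_right _ _) hm.le)
      rw [div_mul_eq_mul_div, le_div_iff₀ hm3]
      have e1 := hνw.moment_anti (x := 0) (y := N) le_rfl (by positivity)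
      have e2 := hσ.moment_anti (x := 0) (y := ((N + 1 : ℕ) : ℝ)) le_rfl (by positivity)
      have e3 := hω.moment_anti (x := ((2 * N + 1 : ℕ) : ℝ)) (y := 3) (by positivity)
        (by exact_mod_cast (by omega : 2 * N + 1 ≤ 3))
      rw [IsRadialWeight.moment_zero] at e1 e2
      gcongr
  refine ⟨hi, C₂ * D * C₃, fun x hx => ?_⟩
  have hωx := hω.moment_pos (x := 2 * x) (by positivity)
  rw [div_mul_eq_mul_div, div_le_iff₀ hωx]
  -- Rounding x down shifts the exponents by at most a bounded amount; the unit-shift comparisons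
  -- for σ and ω compensate.
  set N := ⌊x⌋₊
  have hN : (N : ℝ) ≤ x := Nat.floor_le hx
  have hN' : x < N + 1 := Nat.lt_floor_add_one x
  have e1 := hνw.moment_anti (x := N) (y := x) (by positivity) hN
  have e2 := hσ.moment_anti (x := N) (y := x) (by positivity) hN
  have e3 := h2 N (by positivity)
  have e4 := key N
  have e5 := h3 ((2 * N + 1 : ℕ) : ℝ) (by positivity)
  have e6 := hω.moment_anti (x := 2 * x) (y := ((2 * N + 1 : ℕ) : ℝ) + 1) (by positivity)
    (by push_cast; linarith)
  have hνN := hνw.moment_pos (x := (N : ℝ)) (by positivity)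
  have hσx := hσ.moment_pos hx
  push_cast at e3 e4 e5 e6
  calc moment ν x * moment (divTail ω ν) x
      ≤ moment ν N * (C₂ * moment (divTail ω ν) (N + 1)) :=
        mul_le_mul e1 (e2.trans e3) hσx.le hνN.le
    _ = C₂ * (moment ν N * moment (divTail ω ν) (N + 1)) := by ring
    _ ≤ C₂ * (D * moment ω (2 * N + 1)) := by gcongr
    _ ≤ C₂ * (D * (C₃ * moment ω (2 * x))) := by
        gcongr
        exact e5.trans (by gcongr)
    _ = _ := by ring

/-- Each of the j dyadic blocks contributes at least 1/2. -/
lemma half_le_sum_one_div_Ico {M : ℕ} (hM : 0 < M) (j : ℕ) :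
    (j : ℝ) / 2 ≤ ∑ n ∈ Finset.Ico M (2 ^ j * M), 1 / (n : ℝ) := by
  induction j with
  | zero => simp
  | succ j ih =>
    have h1 : M ≤ 2 ^ j * M := Nat.le_mul_of_pos_left M (by positivity)
    have h2 : 2 ^ j * M ≤ 2 ^ (j + 1) * M := Nat.mul_le_mul_right M
      (Nat.pow_le_pow_right two_pos (Nat.le_succ j))
    rw [← Finset.sum_Ico_consecutive _ h1 h2]
    have hMj : (0 : ℝ) < 2 ^ j * M := by positivity
    have h3 : (1 : ℝ) / 2 ≤ ∑ n ∈ Finset.Ico (2 ^ j * M) (2 ^ (j + 1) * M), 1 / (n : ℝ) := by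
      have h4 := Finset.card_nsmul_le_sum (Finset.Ico (2 ^ j * M) (2 ^ (j + 1) * M))
        (fun n : ℕ => 1 / (n : ℝ)) (1 / (2 ^ (j + 1) * M)) fun n hn => by
          rw [Finset.mem_Ico] at hn
          have hn0 : 0 < n := lt_of_lt_of_le (by positivity) hn.1
          refine one_div_le_one_div_of_le (by exact_mod_cast hn0) ?_
          exact_mod_cast hn.2.le
      refine le_trans (le_of_eq ?_) h4
      rw [Nat.card_Ico, show 2 ^ (j + 1) * M - 2 ^ j * M = 2 ^ j * M by rw [pow_succ]; lia,
        nsmul_eq_mul]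
      push_cast
      rw [pow_succ]
      field_simp
    push_cast
    linarith

/-- For n ≥ M ≥ 1/u the free inequality gives σ_{n+1}/ω_{2n+1} ≳ 1/ν_n ≳ 1/ν̂(1-u). Over j dyadic
blocks from M on, with r = 1 - u/K close enough to 1 that rⁿ ≥ e^{-2}, the sawtooth series is at
least a constant times j/ν̂(1-u). Its boundedness by C/ν̂(1 - u/K) gives the drop, once j is large.
-/
theorem isLowerDoubling_of_projBounded (hω : IsRadialWeight ω) (hν : IsUpperDoubling ν)
    (h : ProjBounded ω (tail ν)) : IsLowerDoubling ν := by
  have hνw := hν.1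
  have hi := integrableOn_divTail_of_projBounded hω hνw h
  have hσ := isRadialWeight_divTail hω hνw hi
  obtain ⟨C, hC, hS⟩ := exists_tail_mul_sum_le hω hνw h
  obtain ⟨C₁, hC₁, h1⟩ := hν.exists_moment_le_tail
  obtain ⟨C₂, hC₂, h2⟩ := hσ.exists_moment_le_mul_moment_add_one
  -- The argument yields j c ν̂(1 - u/K) ≤ ν̂(1-u), and `j` is taken so that j c ≥ 2. Using C + 1
  -- avoids dividing by a possibly zero C.
  set c := Real.exp (-2) / (2 * C₁ * C₂ * (C + 1)) with hc
  have hcp : 0 < c := by positivity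
  obtain ⟨j, hj⟩ := exists_nat_ge (2 / c)
  rw [div_le_iff₀ hcp] at hj
  refine ⟨hνw, 2 ^ (j + 1), 2, one_lt_pow₀ one_lt_two (by simp), one_lt_two,
    eventually_nhdsLT_one_iff.2 ⟨1, one_pos, le_rfl, fun u hu hu1 => ?_⟩⟩
  rw [sub_sub_cancel]
  set K : ℝ := 2 ^ (j + 1) with hK
  have hK2 : 2 ≤ K := by rw [hK, pow_succ]; nlinarith [one_le_pow₀ (one_le_two (α := ℝ)) (n := j)]
  set M := ⌈1 / u⌉₊ with hM
  have hM1 : 1 / u ≤ M := Nat.le_ceil _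
  have hu1' : 1 ≤ 1 / u := by rwa [one_le_div hu]
  have hM2 : (M : ℝ) ≤ 2 / u := by
    have := Nat.ceil_lt_add_one (a := 1 / u) (by positivity)
    rw [← hM] at this
    have h3 : 2 / u = 1 / u + 1 / u := by ring
    linarith
  have hM0 : 0 < M := by
    have : (0 : ℝ) < M := by linarith
    exact_mod_cast this
  have hMr : (1 : ℝ) ≤ M := by exact_mod_cast hM0
  have huK0 : 0 < u / K := by positivity
  have huK : u / K ≤ 1 / 2 := by
    rw [div_le_iff₀ (by linarith)]; linarith
  have hr : 1 - u / K ∈ Ico (0 : ℝ) 1 := ⟨by linarith, by linarith⟩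
  have hTr := hνw.tail_pos _ hr
  have hTu := hνw.tail_nonneg (a := 1 - u) (by linarith) (by linarith)
  have hMu : tail ν (1 - 1 / M) ≤ tail ν (1 - u) := by
    have h3 : 1 / (M : ℝ) ≤ u := by
      rw [div_le_iff₀ (by linarith)]; rw [div_le_iff₀ hu] at hM1; linarith
    have h4 : 0 < 1 / (M : ℝ) := by positivity
    exact hνw.tail_anti (by linarith) (by linarith) (by linarith)
  have hνM := hνw.moment_pos (x := (M : ℝ)) (by positivity)
  have hTu' : 0 < tail ν (1 - u) := by
    have h3 := h1 M hMr
    by_contra hneg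
    have : tail ν (1 - 1 / M) ≤ 0 := hMu.trans (not_lt.1 hneg)
    nlinarith
  have hterm : ∀ n ∈ Finset.Ico M (2 ^ j * M),
      Real.exp (-2) / (C₁ * C₂ * tail ν (1 - u)) * (1 / (n : ℝ)) ≤
      (1 - u / K) ^ n / n * (moment (divTail ω ν) ((n + 1 : ℕ) : ℝ) /
        moment ω ((2 * n + 1 : ℕ) : ℝ)) := by
    intro n hn
    rw [Finset.mem_Ico] at hn
    have hMn : (M : ℝ) ≤ n := by exact_mod_cast hn.1
    have hn0 : (0 : ℝ) < n := by linarith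
    -- Since M ≤ 2/u, the last block ends before 2^{j+1}/u; hence the exponent j + 1 in `K`.
    have hnK : (n : ℝ) ≤ K / u := by
      have h3 : (n : ℝ) ≤ 2 ^ j * M := by exact_mod_cast hn.2.le
      refine h3.trans ((mul_le_mul_of_nonneg_left hM2 (by positivity)).trans (le_of_eq ?_))
      rw [hK, pow_succ]; ring
    have e1 : Real.exp (-2) ≤ (1 - u / K) ^ n := by
      have h3 := one_sub_rpow_ge huK0.le huK hn0.le
      rw [Real.rpow_natCast] at h3
      refine le_trans (Real.exp_le_exp.2 (neg_le_neg ?_)) h3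
      have h4 : u / K * n ≤ 1 := by
        rw [div_mul_eq_mul_div, div_le_one (by linarith)]
        rw [le_div_iff₀ hu] at hnK; linarith
      linarith
    have hm := hω.moment_pos (x := ((2 * n + 1 : ℕ) : ℝ)) (by positivity)
    have hσn := hσ.moment_pos (x := ((n + 1 : ℕ) : ℝ)) (by positivity)
    have e2 : 1 / (C₁ * C₂ * tail ν (1 - u)) ≤
        moment (divTail ω ν) ((n + 1 : ℕ) : ℝ) / moment ω ((2 * n + 1 : ℕ) : ℝ) := by
      rw [div_le_div_iff₀ (by positivity) hm, one_mul]
      have f1 := hω.moment_anti (x := 2 * n) (y := ((2 * n + 1 : ℕ) : ℝ)) (by positivity)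
        (by push_cast; linarith)
      have f2 := moment_two_mul_le hω hνw hi hn0.le
      have f3 := h2 n hn0.le
      have f4 : moment ν n ≤ C₁ * tail ν (1 - u) :=
        (hνw.moment_anti (by positivity) hMn).trans ((h1 M hMr).trans (by gcongr))
      have hσn' := hσ.moment_pos hn0.le
      push_cast at f1 ⊢
      calc moment ω (2 * n + 1) ≤ moment ν n * moment (divTail ω ν) n := f1.trans f2
        _ ≤ (C₁ * tail ν (1 - u)) * (C₂ * moment (divTail ω ν) (n + 1)) :=
            mul_le_mul f4 f3 hσn'.le (by positivity)
        _ = _ := by ring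
    calc Real.exp (-2) / (C₁ * C₂ * tail ν (1 - u)) * (1 / (n : ℝ))
        = Real.exp (-2) / n * (1 / (C₁ * C₂ * tail ν (1 - u))) := by ring
      _ ≤ _ := mul_le_mul (by gcongr) e2 (by positivity)
          (div_nonneg (pow_nonneg hr.1 n) hn0.le)
  have hsum := Finset.sum_le_sum hterm
  rw [← Finset.mul_sum] at hsum
  have hj2 := half_le_sum_one_div_Ico hM0 j
  have e1 : Real.exp (-2) / (C₁ * C₂ * tail ν (1 - u)) * (j / 2) ≤
      Real.exp (-2) / (C₁ * C₂ * tail ν (1 - u)) *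
        ∑ n ∈ Finset.Ico M (2 ^ j * M), 1 / (n : ℝ) :=
    mul_le_mul_of_nonneg_left hj2 (by positivity)
  have e2 := hS (Finset.Ico M (2 ^ j * M)) (1 - u / K) hr.1 hr.2
  have e3 := (mul_le_mul_of_nonneg_left (e1.trans hsum) hTr.le).trans e2
  have e4 : tail ν (1 - u / K) * (j * c) ≤ tail ν (1 - u) := by
    have h3 : tail ν (1 - u / K) * (j * c) =
        tail ν (1 - u / K) * (Real.exp (-2) / (C₁ * C₂ * tail ν (1 - u)) * (j / 2)) *
          (tail ν (1 - u) / (C + 1)) := by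
      rw [hc]; field_simp
    rw [h3]
    calc _ ≤ C * (tail ν (1 - u) / (C + 1)) := mul_le_mul_of_nonneg_right e3 (by positivity)
      _ = tail ν (1 - u) * (C / (C + 1)) := by ring
      _ ≤ tail ν (1 - u) * 1 := by
          refine mul_le_mul_of_nonneg_left ?_ hTu
          rw [div_le_one (by linarith)]; linarith
      _ = _ := mul_one _
  nlinarith

end BergmanGrowth

end

/-! ### The cycle of implications. -/

theorem mainTheorem1 (ω ν : ℝ → ℝ) (hω : BergmanGrowth.IsRadialWeight ω)
    (hν : BergmanGrowth.IsUpperDoubling ν) :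
    List.TFAE [
      BergmanGrowth.ProjBounded ω (BergmanGrowth.tail ν),
      BergmanGrowth.IsLowerDoubling ν ∧ BergmanGrowth.MomentCondition ω ν,
      BergmanGrowth.IsUpperDoubling ω ∧ BergmanGrowth.IsLowerDoubling ν ∧
        BergmanGrowth.TailCondition ω ν,
      BergmanGrowth.IsDoubling (BergmanGrowth.divTail ω ν) ∧
        BergmanGrowth.IsLowerDoubling ν] := by
  tfae_have 1 → 2 := fun h =>
    ⟨BergmanGrowth.isLowerDoubling_of_projBounded hω hν h,
      BergmanGrowth.momentCondition_of_projBounded hω hν h⟩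
  tfae_have 2 → 4 := fun h =>
    ⟨BergmanGrowth.isDoubling_divTail_of_momentCondition hω hν h.1 h.2, h.1⟩
  tfae_have 4 → 3 := fun h =>
    have h' := BergmanGrowth.upperDoubling_and_tailCondition hω hν h.1
    ⟨h'.1, h.2, h'.2⟩
  tfae_have 3 → 2 := fun h =>
    ⟨h.2.1, BergmanGrowth.momentCondition_of_tailCondition h.1 hν h.2.2⟩
  tfae_have 3 → 1 := fun h =>
    BergmanGrowth.projBounded_of_tailCondition h.1 h.2.1 h.2.2
  tfae_finish
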